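/- Let $Q$ be a smooth $n$-manifold (Hausdorff, second countable), $g$ a smooth Riemannian metric on $Q$, $V\in C^\infty(Q)$, and $L(q,\dot q)=\frac12 g_q(\dot q,\dot q)-V(q)$. Write $\mathbb{F}L(v)=g(v,\cdot)$, let $H:T^*Q\to\mathbb{R}$ be the Legendre transform of $L$, $\omega=dq^i\wedge dp_i$ the canonical symplectic form and $\pi_Q:T^*Q\to Q$ the projection. For a vector field $Y$ on $Q$ put $P(Y)(q,p)=\langle p,Y(q)\rangle$. Let $\mathscr{C}=\{\eta^1,\dots,\eta^m\}$ be smooth, pointwise linearly independent $1$-forms on $Q$, let $\mathcal{D}=\bigcap_\alpha\ker\eta^\alpha$ be the corresponding regular distribution, $W^\alpha=\mathbb{F}L^{-1}\eta^\alpha$, $(m_{\alpha\beta})$ the inverse of the matrix $m^{\alpha\beta}=\eta^\alpha(W^\beta)$, and $\mathcal{D}^*=\mathbb{F}L(\mathcal{D})=\{P(W^1)=\dots=P(W^m)=0\}\subset T^*Q$. The nonholonomic vector field $X_H^{\mathcal{D}}$ is the vector field on $\mathcal{D}^*$, tangent to $\mathcal{D}^*$, with $i_{X_H^{\mathcal{D}}}\omega=dH+\lambda_\alpha\pi_Q^*\eta^\alpha$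 for some multipliers $\lambda_\alpha$. The nonholonomic volume form on $\mathcal{D}^*$ is $\mu_{\mathscr{C}}=\iota^*\varepsilon$, where $\iota:\mathcal{D}^*\hookrightarrow T^*Q$ is the inclusion and $dP(W^1)\wedge\dots\wedge dP(W^m)\wedge\varepsilon=\omega^n$. Let $h:Q\to\mathbb{R}$ be smooth and, for every $q\in S:=h^{-1}(0)$, let $dh_q$ be nonzero on $\mathcal{D}_q$. With $\nabla h=\mathbb{F}L^{-1}dh$, let $S^*_{\mathcal{D}}=\{(q,p)\in\mathcal{D}^*: h(q)=0,\ P(\nabla h)(q,p)<0\}$, and let $\Delta^{\mathcal{D}}:S^*_{\mathcal{D}}\to\mathcal{D}^*$ be the nonholonomic impact map: $\Delta^{\mathcal{D}}(q,\mathbb{F}L(\dot q))=(q,\mathbb{F}L(\dot q+\lambda_kW^k+\varepsilon\nabla h))$, where $$\varepsilon=\frac{-2\,dh(\dot q)}{dh(\nabla h)-m_{\alpha\beta}dh(W^\alpha)dh(W^\beta)},\qquad \lambda_k=\frac{2\,m_{k\ell}\,dh(W^\ell)\,dh(\dot q)}{dh(\nabla h)-m_{\alpha\beta}dh(W^\alpha)dh(W^\beta)}.$$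 The hybrid flow $\varphi_t^{\mathcal{H}}$ ($t\ge0$) of $\mathcal{H}=(\mathcal{D}^*,S^*_{\mathcal{D}},X_H^{\mathcal{D}},\Delta^{\mathcal{D}})$ is the partial map on $\mathcal{D}^*$ that follows $X_H^{\mathcal{D}}$ until $S^*_{\mathcal{D}}$ is reached, then continues from the image under $\Delta^{\mathcal{D}}$, and so on, with finitely many impacts up to time $t$ (at an instant of impact, its value is the state before the impact). A form $\alpha$ on $\mathcal{D}^*$ is called hybrid-invariant if, for every $t\ge0$, $(\varphi_t^{\mathcal{H}})^*\alpha=\alpha$ on every open subset of $\mathcal{D}^*$ on which $\varphi_t^{\mathcal{H}}$ is defined and smooth; invariance under the flow of $X_H^{\mathcal{D}}$ is the same notion without impacts. **Proposition.** Let $\rho:Q\to\mathbb{R}$ be smooth, $f=\pi_Q^*\rho$, and suppose that $f\mu_{\mathscr{C}}$ (a volume form if $\rho$ vanishes nowhere) is invariant under the flow of $X_H^{\mathcal{D}}$. Then, for every impact surface $S=h^{-1}(0)$ as above, $f\mu_{\mathscr{C}}$ is hybrid-invariant for $\mathcal{H}=(\mathcal{D}^*,S^*_{\mathcal{D}},X_H^{\mathcal{D}},\Delta^{\mathcal{D}})$.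 -/

import Mathlib

open Manifold Bundle ContDiff

noncomputable section

namespace ImpactMechanics

/-! ### Exterior algebra on a real vector space -/

section Exterior

variable {W : Type*} [AddCommGroup W] [Module ℝ W]

/-- The wedge product of alternating forms: the signed sum over shuffles, so that
`(dx ∧ dy) (v, w) = dx v * dy w - dx w * dy v`. -/
def wedge {a b : ℕ} (φ : W [⋀^Fin a]→ₗ[ℝ] ℝ) (ψ : W [⋀^Fin b]→ₗ[ℝ] ℝ) :
    W [⋀^Fin (a + b)]→ₗ[ℝ] ℝ :=
  ((LinearMap.mul' ℝ ℝ).compAlternatingMap (φ.domCoprod ψ)).domDomCongr finSumFinEquiv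

/-- A covector, regarded as an alternating form of degree one. -/
def oneForm (θ : W →ₗ[ℝ] ℝ) : W [⋀^Fin 1]→ₗ[ℝ] ℝ :=
  AlternatingMap.ofSubsingleton ℝ W ℝ (0 : Fin 1) θ

theorem wedge_oneForm (θ η : W →ₗ[ℝ] ℝ) (v : Fin 2 → W) :
    wedge (oneForm θ) (oneForm η) v = θ (v 0) * η (v 1) - θ (v 1) * η (v 0) := by
  have key := MultilinearMap.domCoprod_alternization_eq (oneForm θ) (oneForm η)
  simp only [Fintype.card_fin, Nat.factorial_one, mul_one, one_smul] at key
  unfold wedge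
  rw [← key]
  simp only [AlternatingMap.domDomCongr_apply, LinearMap.compAlternatingMap_apply,
    MultilinearMap.alternatization_apply, map_sum]
  have hu : (Finset.univ : Finset (Equiv.Perm (Fin 1 ⊕ Fin 1))) =
      {1, Equiv.swap (Sum.inl 0) (Sum.inr 0)} := by decide
  have hne : (1 : Equiv.Perm (Fin 1 ⊕ Fin 1)) ≠ Equiv.swap (Sum.inl 0) (Sum.inr 0) := by decide
  rw [hu, Finset.sum_pair hne]
  simp [oneForm, finSumFinEquiv, MultilinearMap.domDomCongr_apply,
    MultilinearMap.domCoprod_apply, sub_eq_add_neg]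

/-- `θ₀ ∧ θ₁ ∧ ⋯ ∧ θ_{m-1}` for a finite family of covectors. -/
def wedgeFamily : (m : ℕ) → (Fin m → (W →ₗ[ℝ] ℝ)) → W [⋀^Fin m]→ₗ[ℝ] ℝ
  | 0, _ => AlternatingMap.constOfIsEmpty ℝ W (Fin 0) (1 : ℝ)
  | m + 1, θ => wedge (wedgeFamily m fun i => θ i.castSucc) (oneForm (θ (Fin.last m)))

/-- The power `Ω ∧ Ω ∧ ⋯ ∧ Ω` (`k` factors) of a two-form. -/
def wedgePow (Ω : W [⋀^Fin 2]→ₗ[ℝ] ℝ) : (k : ℕ) → W [⋀^Fin (2 * k)]→ₗ[ℝ] ℝ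
  | 0 => AlternatingMap.constOfIsEmpty ℝ W (Fin 0) (1 : ℝ)
  | k + 1 => wedge (wedgePow Ω k) Ω

end Exterior

/-! ### Hybrid systems, hybrid flow and invariant forms -/

section Hybrid

variable {E H : Type*} [NormedAddCommGroup E] [NormedSpace ℝ E] [TopologicalSpace H]
  (I : ModelWithCorners ℝ E H) (M : Type*) [TopologicalSpace M] [ChartedSpace H M]

/-- The data of a hybrid system whose state space is an embedded submanifold `space` of a manifold
`M`. The submanifold comes with its tangent spaces, seen inside those of `M`; only the values of
`field` on `space` and of `reset` on `impact` matter. -/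
structure HybridSystem where
  space : Set M
  tangent : (x : M) → Submodule ℝ (TangentSpace I x)
  impact : Set M
  field : (x : M) → TangentSpace I x
  reset : M → M

variable {I M}

/-- `γ` is, on the time interval `[0, t]`, a solution of `ẋ = X(x)` in the state space. -/
def HybridSystem.IsSolution (𝓗 : HybridSystem I M) (γ : ℝ → M) (t : ℝ) : Prop :=
  IsMIntegralCurveOn γ 𝓗.field (Set.Icc 0 t) ∧ ∀ s ∈ Set.Icc 0 t, γ s ∈ 𝓗.space

/-- The hybrid flow as a partial map: `𝓗.Flow t x y` says that `φ^𝓗(t, x)` is defined and equals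
`y`. The state follows the vector field until it lies in the impact surface; there it is still
unchanged at the moment of the impact (the flow is left-continuous in time), and the motion goes on
from its image under the reset map. Finitely many impacts may take place. -/
inductive HybridSystem.Flow (𝓗 : HybridSystem I M) : ℝ → M → M → Prop
  | smooth {t : ℝ} {γ : ℝ → M} (ht : 0 ≤ t) (hγ : 𝓗.IsSolution γ t)
      (havoid : ∀ s ∈ Set.Ico 0 t, γ s ∉ 𝓗.impact) :
      HybridSystem.Flow 𝓗 t (γ 0) (γ t)
  | impact {t₁ t₂ : ℝ} {γ : ℝ → M} {y : M} (ht₁ : 0 ≤ t₁) (ht₂ : 0 < t₂)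
      (hγ : 𝓗.IsSolution γ t₁) (havoid : ∀ s ∈ Set.Ico 0 t₁, γ s ∉ 𝓗.impact)
      (hhit : γ t₁ ∈ 𝓗.impact) (hrest : HybridSystem.Flow 𝓗 t₂ (𝓗.reset (γ t₁)) y) :
      HybridSystem.Flow 𝓗 (t₁ + t₂) (γ 0) y

/-- A `k`-form on the state space of `𝓗`. -/
abbrev HybridSystem.Form (𝓗 : HybridSystem I M) (k : ℕ) : Type _ :=
  (x : M) → 𝓗.tangent x [⋀^Fin k]→ₗ[ℝ] ℝ

/-- `(φ_t^𝓗)^* α = α` for every `t ≥ 0`, on every open piece of the state space on which `φ_t^𝓗` is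
defined and smooth. A map on an open piece of the embedded submanifold `𝓗.space` is smooth iff it
is locally the restriction of a smooth map `F` of the ambient manifold, and its differential is
then the restriction of that of `F`, which sends tangent vectors of `𝓗.space` to such vectors. -/
def HybridSystem.IsInvariant (𝓗 : HybridSystem I M) {k : ℕ} (α : 𝓗.Form k) : Prop :=
  ∀ (t : ℝ) (U : Set M) (F : M → M), 0 ≤ t → IsOpen U → ContMDiffOn I I ∞ F U →
    (∀ x ∈ U ∩ 𝓗.space, 𝓗.Flow t x (F x)) →
    ∀ x ∈ U ∩ 𝓗.space,
      ∃ hF : ∀ v ∈ 𝓗.tangent x, mfderiv I I F x v ∈ 𝓗.tangent (F x),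
        (α (F x)).compLinearMap
          (LinearMap.restrict (mfderiv I I F x).toLinearMap hF) = α x

end Hybrid

/-! ### The cotangent bundle -/

section Cotangent

variable (n : ℕ) (Q : Type*) [TopologicalSpace Q] [ChartedSpace (EuclideanSpace ℝ (Fin n)) Q]
  [IsManifold (𝓡 n) ∞ Q]

/-- The model fibre of the cotangent bundle of an `n`-dimensional manifold. -/
abbrev Covector : Type := EuclideanSpace ℝ (Fin n) →L[ℝ] ℝ

/-- The cotangent bundle `T^*Q`; a point is a pair `(q, p)` with `p` a linear form on `T_q Q`. -/
abbrev Cotangent : Type _ :=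
  TotalSpace (Covector n) fun q : Q => TangentSpace (𝓡 n) q →L[ℝ] Bundle.Trivial Q ℝ q

/-- The model with corners of `T^*Q`. -/
abbrev cotangentModel : ModelWithCorners ℝ (EuclideanSpace ℝ (Fin n) × Covector n)
    (ModelProd (EuclideanSpace ℝ (Fin n)) (Covector n)) :=
  (𝓡 n).prod 𝓘(ℝ, Covector n)

/-- The symplectic form `∑ᵢ dqⁱ ∧ dpᵢ` on `ℝⁿ × (ℝⁿ)^*`. -/
def coordinateSymplecticForm :
    (EuclideanSpace ℝ (Fin n) × Covector n) [⋀^Fin 2]→ₗ[ℝ] ℝ :=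
  ∑ i : Fin n, wedge
    (oneForm ((EuclideanSpace.proj i : EuclideanSpace ℝ (Fin n) →L[ℝ] ℝ).toLinearMap ∘ₗ
      LinearMap.fst ℝ (EuclideanSpace ℝ (Fin n)) (Covector n)))
    (oneForm ((ContinuousLinearMap.apply ℝ ℝ (EuclideanSpace.single i (1 : ℝ))).toLinearMap ∘ₗ
      LinearMap.snd ℝ (EuclideanSpace ℝ (Fin n)) (Covector n)))

theorem coordinateSymplecticForm_apply
    (v : Fin 2 → EuclideanSpace ℝ (Fin n) × Covector n) :
    coordinateSymplecticForm n v = (v 1).2 (v 0).1 - (v 0).2 (v 1).1 := by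
  have key : ∀ (b : Covector n) (a : EuclideanSpace ℝ (Fin n)),
      b a = ∑ i, a i * b (EuclideanSpace.single i (1 : ℝ)) := by
    intro b a
    conv_lhs => rw [← (EuclideanSpace.basisFun (Fin n) ℝ).sum_repr a]
    simp
  rw [key, key, ← Finset.sum_sub_distrib]
  let ev : ((EuclideanSpace ℝ (Fin n) × Covector n) [⋀^Fin 2]→ₗ[ℝ] ℝ) →+ ℝ :=
    { toFun := fun φ => φ v, map_zero' := rfl, map_add' := fun _ _ => rfl }
  change ev (coordinateSymplecticForm n) = _
  rw [coordinateSymplecticForm, map_sum]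
  refine Finset.sum_congr rfl fun i _ => ?_
  change wedge (oneForm _) (oneForm _) v = _
  rw [wedge_oneForm]
  rfl

variable {n Q}

/-- The canonical symplectic form `ω = dqⁱ ∧ dpᵢ` of `T^*Q`. The tangent space of `T^*Q` at `x` is
`ℝⁿ × (ℝⁿ)^*` by means of the natural coordinates `(q, p)` around `x` which are induced by the
preferred chart of `Q` at the base point of `x`. -/
def symplecticForm (x : Cotangent n Q) :
    TangentSpace (cotangentModel n) x [⋀^Fin 2]→ₗ[ℝ] ℝ :=
  coordinateSymplecticForm n

/-- The differential at `x` of a function on `T^*Q`. -/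
def differential (f : Cotangent n Q → ℝ) (x : Cotangent n Q) :
    TangentSpace (cotangentModel n) x →ₗ[ℝ] ℝ :=
  (mfderiv (cotangentModel n) 𝓘(ℝ) f x).toLinearMap

/-- The pullback `π_Q^* η` to `T^*Q` of a one-form `η` on `Q`. -/
def pullbackOneForm (η : (q : Q) → TangentSpace (𝓡 n) q →L[ℝ] ℝ) (x : Cotangent n Q) :
    TangentSpace (cotangentModel n) x →ₗ[ℝ] ℝ :=
  (η x.proj).toLinearMap ∘ₗ
    (mfderiv (cotangentModel n) (𝓡 n) (TotalSpace.proj : Cotangent n Q → Q) x).toLinearMap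

/-- The momentum function `P(Y)(q, p) = ⟨p, Y(q)⟩` of a vector field `Y` on `Q`. -/
def momentum (Y : (q : Q) → TangentSpace (𝓡 n) q) (x : Cotangent n Q) : ℝ :=
  x.snd (Y x.proj)

/-- The differential at `q` of a function on `Q`, as a linear form on `T_q Q`. -/
def dfun (h : Q → ℝ) (q : Q) : TangentSpace (𝓡 n) q →L[ℝ] ℝ :=
  mfderiv (𝓡 n) 𝓘(ℝ) h q

/-- A one-form on `Q` is smooth as a section of the cotangent bundle. -/
def IsSmoothOneForm (η : (q : Q) → TangentSpace (𝓡 n) q →L[ℝ] ℝ) : Prop :=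
  ContMDiff (𝓡 n) (cotangentModel n) ∞ fun q => (⟨q, η q⟩ : Cotangent n Q)

end Cotangent

/-! ### Natural mechanical systems with linear constraints -/

section Mechanics

variable (n : ℕ) (Q : Type*) [TopologicalSpace Q] [ChartedSpace (EuclideanSpace ℝ (Fin n)) Q]
  [IsManifold (𝓡 n) ∞ Q]

/-- A natural Lagrangian: kinetic energy of a smooth Riemannian metric minus a smooth potential. -/
structure NaturalLagrangian where
  metric : ContMDiffRiemannianMetric (𝓡 n) ∞ (EuclideanSpace ℝ (Fin n))
    fun q : Q => TangentSpace (𝓡 n) q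
  potential : Q → ℝ
  smooth_potential : ContMDiff (𝓡 n) 𝓘(ℝ) ∞ potential

variable {n Q}

theorem isInvertible_of_injective {E : Type*} [NormedAddCommGroup E] [NormedSpace ℝ E]
    [FiniteDimensional ℝ E] (A : E →L[ℝ] (E →L[ℝ] ℝ)) (hA : Function.Injective A) :
    A.IsInvertible := by
  have hrank : Module.finrank ℝ E = Module.finrank ℝ (E →L[ℝ] ℝ) := by
    rw [← (LinearMap.toContinuousLinearMap : (E →ₗ[ℝ] ℝ) ≃ₗ[ℝ] (E →L[ℝ] ℝ)).finrank_eq]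
    exact (Subspace.dual_finrank_eq (K := ℝ) (V := E)).symm
  refine ⟨(LinearMap.linearEquivOfInjective A.toLinearMap hA hrank).toContinuousLinearEquiv, ?_⟩
  ext v w
  rfl

namespace NaturalLagrangian

variable (L : NaturalLagrangian n Q)

/-- `L(q, v) = ½ g_q(v, v) - V(q)`. -/
def lagrangian (q : Q) (v : TangentSpace (𝓡 n) q) : ℝ :=
  1 / 2 * L.metric.inner q v v - L.potential q

/-- The fibre derivative `FL(v) = g(v, ·)`. -/
def fiberDeriv (q : Q) : TangentSpace (𝓡 n) q →L[ℝ] (TangentSpace (𝓡 n) q →L[ℝ] ℝ) :=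
  L.metric.inner q

theorem hasDerivAt_lagrangian (q : Q) (v w : TangentSpace (𝓡 n) q) :
    HasDerivAt (fun t : ℝ => L.lagrangian q (v + t • w)) (L.fiberDeriv q v w) 0 := by
  have h : (fun t : ℝ => L.lagrangian q (v + t • w)) = fun t : ℝ =>
      L.lagrangian q v + t * L.fiberDeriv q v w + t ^ 2 * (1 / 2 * L.metric.inner q w w) := by
    funext t
    simp only [lagrangian, fiberDeriv, map_add, map_smul, add_apply,
      smul_apply, smul_eq_mul, L.metric.symm q w v]
    ring
  rw [h]
  have h1 : HasDerivAt (fun t : ℝ => t * L.fiberDeriv q v w) (1 * L.fiberDeriv q v w) 0 :=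
    (hasDerivAt_id (0 : ℝ)).mul_const _
  have h2 : HasDerivAt (fun t : ℝ => t ^ 2 * (1 / 2 * L.metric.inner q w w)) 0 0 := by
    simpa using (hasDerivAt_pow 2 (0 : ℝ)).mul_const (1 / 2 * L.metric.inner q w w)
  have h3 := (h1.const_add (L.lagrangian q v)).add h2
  rw [one_mul, add_zero] at h3
  exact h3

/-- The inverse `FL⁻¹ : T_q^*Q → T_q Q` of the fibre derivative. -/
def sharp (q : Q) : (TangentSpace (𝓡 n) q →L[ℝ] ℝ) →L[ℝ] TangentSpace (𝓡 n) q :=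
  (L.fiberDeriv q).inverse

theorem fiberDeriv_sharp (q : Q) (p : TangentSpace (𝓡 n) q →L[ℝ] ℝ) :
    L.fiberDeriv q (L.sharp q p) = p := by
  have hinj : Function.Injective (L.fiberDeriv q) := by
    refine (injective_iff_map_eq_zero (L.fiberDeriv q)).2 fun v hv => ?_
    by_contra hne
    have hpos := L.metric.pos q v hne
    have hzero : L.metric.inner q v v = 0 := by
      change L.fiberDeriv q v v = 0
      rw [hv]; rfl
    exact hpos.ne' hzero
  have hinv : (L.fiberDeriv q).IsInvertible :=
    isInvertible_of_injective (E := EuclideanSpace ℝ (Fin n)) (L.fiberDeriv q) hinj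
  exact hinv.self_apply_inverse p

/-- The Hamiltonian `H(q, p) = ⟨p, v⟩ - L(q, v)` with `p = FL(v)`. -/
def hamiltonian (x : Cotangent n Q) : ℝ :=
  x.snd (L.sharp x.proj x.snd) - L.lagrangian x.proj (L.sharp x.proj x.snd)

/-- The vector field `FL⁻¹ η` on `Q` which is dual to a one-form `η`. -/
def dualField (η : (q : Q) → TangentSpace (𝓡 n) q →L[ℝ] ℝ) (q : Q) : TangentSpace (𝓡 n) q :=
  L.sharp q (η q)

/-- The gradient `∇h` of a function on `Q` with respect to the metric. -/
def grad (h : Q → ℝ) : (q : Q) → TangentSpace (𝓡 n) q :=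
  L.dualField (dfun h)

end NaturalLagrangian

variable {m : ℕ} (L : NaturalLagrangian n Q)
  (η : Fin m → (q : Q) → TangentSpace (𝓡 n) q →L[ℝ] ℝ)

/-- The distribution `𝓓 = ⋂ ker η^α` on `Q`. -/
def distribution (q : Q) : Submodule ℝ (TangentSpace (𝓡 n) q) :=
  ⨅ a, LinearMap.ker (η a q).toLinearMap

/-- The realization `η¹, …, η^m` of the constraints is smooth and pointwise linearly independent,
so that it is a frame of the annihilator of a regular distribution. -/
structure IsRegularRealization : Prop where
  smooth : ∀ a, IsSmoothOneForm (η a)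
  independent : ∀ q, LinearIndependent ℝ fun a => η a q

/-- The state space `𝓓^* = FL(𝓓) ⊆ T^*Q`. -/
def phaseSpace : Set (Cotangent n Q) :=
  {x | ∃ v ∈ distribution η x.proj, L.fiberDeriv x.proj v = x.snd}

/-- The tangent spaces of `𝓓^*`. As `𝓓^*` is the regular joint zero set of the momentum functions
`P(W^α)`, `W^α = FL⁻¹ η^α`, they are the joint kernels of the differentials `dP(W^α)`. -/
def phaseTangent (x : Cotangent n Q) : Submodule ℝ (TangentSpace (cotangentModel n) x) :=
  ⨅ a, LinearMap.ker (differential (momentum (L.dualField (η a))) x)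

/-- The equations of motion of Lagrange and d'Alembert for the velocity `v` at the point `x` of
`𝓓^*`: `i_v ω = dH + λ_α π_Q^* η^α` for some multipliers, with `v` tangent to `𝓓^*`. -/
def IsNonholonomicVelocity (x : Cotangent n Q) (v : TangentSpace (cotangentModel n) x) : Prop :=
  v ∈ phaseTangent L η x ∧
    ∃ c : Fin m → ℝ, ∀ w : TangentSpace (cotangentModel n) x,
      symplecticForm x ![v, w] =
        differential L.hamiltonian x w + ∑ a, c a * pullbackOneForm (η a) x w

/-- The nonholonomic vector field `X_H^𝓓`: its value at a point of `𝓓^*` is the unique vector that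
satisfies the equations of motion. -/
def nonholonomicField (x : Cotangent n Q) : TangentSpace (cotangentModel n) x :=
  Classical.epsilon (IsNonholonomicVelocity L η x)

/-- The nonholonomic system without impacts. -/
def nonholonomicSystem : HybridSystem (cotangentModel n) (Cotangent n Q) where
  space := phaseSpace L η
  tangent := phaseTangent L η
  impact := ∅
  field := nonholonomicField L η
  reset := id

/-- The form `σ_𝒞 = dP(W¹) ∧ ⋯ ∧ dP(W^m)`. -/
def constraintForm (x : Cotangent n Q) : TangentSpace (cotangentModel n) x [⋀^Fin m]→ₗ[ℝ] ℝ :=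
  wedgeFamily m fun a => differential (momentum (L.dualField (η a))) x

/-- The nonholonomic volume form `μ_𝒞 = ι^* ε` on `𝓓^*`, where `σ_𝒞 ∧ ε = ωⁿ` and `ι` is the
inclusion of `𝓓^*` in `T^*Q`. Such an `ε` exists at every point of `𝓓^*`, and any two of them have
the same restriction to the tangent space of `𝓓^*`. The degree `k` of `ε` and `μ_𝒞` is the
dimension `2 n - m` of `𝓓^*`. -/
def nonholonomicVolume {k : ℕ} (hk : m + k = 2 * n) (x : Cotangent n Q) :
    phaseTangent L η x [⋀^Fin k]→ₗ[ℝ] ℝ :=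
  (Classical.epsilon fun ε : TangentSpace (cotangentModel n) x [⋀^Fin k]→ₗ[ℝ] ℝ =>
    (wedge (constraintForm L η x) ε).domDomCongr (finCongr hk) =
      wedgePow (symplecticForm x) n).compLinearMap (phaseTangent L η x).subtype

/-- The form `f μ_𝒞` on `𝓓^*` for the density `f = π_Q^* ρ`. -/
def basicVolume {k : ℕ} (hk : m + k = 2 * n) (ρ : Q → ℝ) (x : Cotangent n Q) :
    phaseTangent L η x [⋀^Fin k]→ₗ[ℝ] ℝ :=
  ρ x.proj • nonholonomicVolume L η hk x

/-- The constraint mass matrix `m^{αβ} = η^α(W^β)` at `q`. -/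
def massMatrix (q : Q) : Matrix (Fin m) (Fin m) ℝ :=
  Matrix.of fun a b => η a q (L.dualField (η b) q)

/-- The denominator `dh(∇h) - m_{αβ} dh(W^α) dh(W^β)` of the multipliers of the impact. -/
def impactDenominator (h : Q → ℝ) (q : Q) : ℝ :=
  dfun h q (L.grad h q) - ∑ a, ∑ b, (massMatrix L η q)⁻¹ a b *
    dfun h q (L.dualField (η a) q) * dfun h q (L.dualField (η b) q)

/-- The velocity `δ(q, v) = v + λ_k W^k + ε ∇h` right after an impact at `q` with velocity `v`. -/
def impactVelocity (h : Q → ℝ) (q : Q) (v : TangentSpace (𝓡 n) q) : TangentSpace (𝓡 n) q :=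
  v + (∑ a, (2 * (∑ b, (massMatrix L η q)⁻¹ a b * dfun h q (L.dualField (η b) q)) * dfun h q v /
      impactDenominator L η h q) • L.dualField (η a) q)
    + (-2 * dfun h q v / impactDenominator L η h q) • L.grad h q

/-- The nonholonomic impact system `(𝓓^*, S_𝓓^*, X_H^𝓓, Δ^𝓓)` for the impact surface
`S = h⁻¹(0)`, where `S_𝓓^* = {(q, p) ∈ 𝓓^* : h(q) = 0, P(∇h)(q, p) < 0}` and `Δ^𝓓` is the
nonholonomic impact map, transported to `T^*Q` by means of `FL`. -/
def nonholonomicImpactSystem (h : Q → ℝ) : HybridSystem (cotangentModel n) (Cotangent n Q) where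
  space := phaseSpace L η
  tangent := phaseTangent L η
  impact := {x | x ∈ phaseSpace L η ∧ h x.proj = 0 ∧ momentum (L.grad h) x < 0}
  field := nonholonomicField L η
  reset := fun x =>
    ⟨x.proj, L.fiberDeriv x.proj (impactVelocity L η h x.proj (L.sharp x.proj x.snd))⟩

/-- The standing assumptions on an impact surface `S = h⁻¹(0)`: `h` is smooth and, at every point
of `S`, the differential `dh` does not annihilate `𝓓` (in particular `dh ≠ 0` along `S`). -/
structure IsImpactFunction (h : Q → ℝ) : Prop where
  smooth : ContMDiff (𝓡 n) 𝓘(ℝ) ∞ h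
  nontrivial : ∀ q, h q = 0 → ∃ v ∈ distribution η q, dfun h q v ≠ 0

end Mechanics

end ImpactMechanics
end

open Manifold Bundle ContDiff

noncomputable section

namespace ImpactMechanics

/-! ### Smooth dependence of local flows on time and initial data -/

/-! ### Superposition operators on spaces of continuous curves -/

section Superposition

open Set Filter Topology

set_option synthInstance.maxHeartbeats 200000

universe u
variable {K : Type*} [TopologicalSpace K] [CompactSpace K]
  {E F : Type u} [NormedAddCommGroup E] [NormedSpace ℝ E] [NormedAddCommGroup F] [NormedSpace ℝ F]

/-! On `𝓓^*` the form `μ_𝒞` is the quotient of the Liouville form `ωⁿ` by the covectors `dP(W^α)`.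
If a linear map `K` between two tangent spaces of `T^*Q` intertwines these covectors, then on the
tangent spaces of `𝓓^*` it multiplies `μ_𝒞` by `det K` (`quotientForm_map`). The determinant may be
computed in any natural coordinates, since their changes have determinant one
(`det_chartChange_cotangent`). Invariance of `f μ_𝒞` thus becomes a scalar identity: the density at
the image, times the determinant, is the density at the source.

For a motion with an impact, the derivative of the flow is not that of `Δ` placed between two flow
derivatives, because the time of impact depends on the initial state. Differentiating the condition
`h = 0` shows that the middle factor is the saltation operator `DΔ + dh ⊗ (X(Δ w) - DΔ X(w)) / dh(X
w)`. The heart of the matter is that it has determinant one (`det_saltation_resetMap`). The impact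
acts on the velocities at `q` by the reflection `R v = v - 2 (dh(v) / dh(ξ)) ξ`, where `ξ` is the
orthogonal projection of `∇h` to `𝓓`. With respect to the vertical subspace the saltation operator
is block triangular. Its vertical block is `FL R FL⁻¹`. The horizontal block of `DΔ` is the
identity, because `Δ` fixes base points, but the correction turns it into `R`. The determinant is
`(det R)² = 1`, as `R` is an involution. The density depends on `q` only, so `Δ` does not change it
either, and the scalar identity passes to all finite compositions of flows and impacts.

What remains is a matter of regularity. The flow may be smooth near a point although nearby states
have different impact histories, so the chain rule is not directly available there. Countably many
local families, built from flow boxes and from impact times given by the implicit function theorem,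
describe all hybrid trajectories (`exists_countable_families`). By Baire's theorem some family
agrees with the flow along an open piece of `𝓓^*` near any given point. The scalar identity holds on
that piece and extends by continuity (`IsTranslation.exists_linear_extension`). To have determinants
at all, the flow is first extended off `𝓓^*` by a map that preserves the constraint momenta. -/

/-- Pointwise application of a family of operators to a family of vectors. -/
def pointwiseApply : C(K, E →L[ℝ] F) →L[ℝ] C(K, E) →L[ℝ] C(K, F) :=
  LinearMap.mkContinuous₂
    (LinearMap.mk₂ ℝ (fun (A : C(K, E →L[ℝ] F)) (h : C(K, E)) => (⟨fun u => A u (h u), by fun_prop⟩ : C(K, F)))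
      (fun _ _ _ => by ext; simp) (fun _ _ _ => by ext; simp)
      (fun _ _ _ => by ext; simp) (fun _ _ _ => by ext; simp)) 1 fun A h => by
    rw [one_mul, ContinuousMap.norm_le _ (by positivity)]
    exact fun u => (A u).le_opNorm_of_le (h.norm_coe_le_norm u) |>.trans
      (mul_le_mul_of_nonneg_right (A.norm_coe_le_norm u) (norm_nonneg _))

theorem pointwiseApply_apply (A : C(K, E →L[ℝ] F)) (h : C(K, E)) (u : K) :
    pointwiseApply A h u = A u (h u) := rfl

/-- The mean value inequality bounds the remainder at `u` by `c ‖h u‖`, as soon as `fderiv ℝ f`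
varies by at most `c` on a ball about `γ u` whose radius does not depend on `u`. Such a radius comes
from the continuity of `γ ↦ fderiv ℝ f ∘ γ` in the sup norm, so `E` may have infinite dimension. -/
theorem hasFDerivAt_superposition {f : E → F} (hf : ContDiff ℝ 1 f) (γ : C(K, E)) :
    HasFDerivAt (fun γ : C(K, E) => (⟨f, hf.continuous⟩ : C(E, F)).comp γ)
      (pointwiseApply ((⟨fderiv ℝ f, hf.continuous_fderiv one_ne_zero⟩ : C(E, E →L[ℝ] F)).comp γ))
      γ := by
  rw [hasFDerivAt_iff_isLittleO_nhds_zero, Asymptotics.isLittleO_iff]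
  intro c hc
  have hcont := ((ContinuousMap.continuous_postcomp (X := K)
    (⟨fderiv ℝ f, hf.continuous_fderiv one_ne_zero⟩ : C(E, E →L[ℝ] F))).continuousAt (x := γ))
  obtain ⟨δ, hδ, hball⟩ := (Metric.continuousAt_iff (α := C(K, E)) (β := C(K, E →L[ℝ] F))).1 hcont c hc
  filter_upwards [Metric.ball_mem_nhds (0 : C(K, E)) hδ] with h hh
  rw [mem_ball_zero_iff] at hh
  rw [ContinuousMap.norm_le _ (by positivity)]
  intro u
  have hu : ‖h u‖ < δ := (h.norm_coe_le_norm u).trans_lt hh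
  have key := (convex_ball (γ u) δ).norm_image_sub_le_of_norm_fderiv_le' (𝕜 := ℝ) (f := f)
    (φ := fderiv ℝ f (γ u)) (C := c)
    (fun z _ => hf.differentiable one_ne_zero z) (x := γ u) (y := γ u + h u) (fun z hz => ?_)
    (Metric.mem_ball_self hδ) (by simpa using hu)
  · have := key.trans (mul_le_mul_of_nonneg_left (by simpa using h.norm_coe_le_norm u) hc.le)
    simpa [pointwiseApply_apply] using this
  -- The translate of `γ` that passes through `z` at `u` is uniformly close to `γ`; the sup norm
  -- estimate for it is read at `u`.
  · have h1 : dist (γ + ContinuousMap.const K (z - γ u)) γ < δ := by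
      rw [dist_eq_norm, add_sub_cancel_left]
      refine (ContinuousMap.norm_lt_iff _ hδ).2 fun _ => ?_
      simpa [dist_eq_norm] using hz
    have h2 := (ContinuousMap.dist_apply_le_dist (u)).trans (hball h1).le
    simpa [dist_eq_norm] using h2

/-- The derivative is the superposition by `fderiv ℝ f`, followed by a bounded operator, which
allows induction on the order. The target changes to `E →L[ℝ] F` in each step; hence the generality
in `F` and the common universe of `E` and `F`. -/
theorem contDiff_superposition_nat (n : ℕ) : ∀ {F : Type u} [NormedAddCommGroup F]
    [NormedSpace ℝ F] {f : E → F} (hf : ContDiff ℝ ∞ f),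
    ContDiff ℝ n fun γ : C(K, E) => (⟨f, hf.continuous⟩ : C(E, F)).comp γ := by
  induction n with
  | zero =>
    intro F _ _ f hf
    exact contDiff_zero.2 (ContinuousMap.continuous_postcomp _)
  | succ n ih =>
    intro F _ _ f hf
    have h1 : ContDiff ℝ 1 f := hf.of_le (by exact_mod_cast le_top)
    exact contDiff_succ_iff_hasFDerivAt.2 ⟨fun γ => pointwiseApply _, pointwiseApply.contDiff.comp
      (ih (hf.fderiv_right (m := ∞) le_rfl)), fun γ => hasFDerivAt_superposition h1 γ⟩

/-- The superposition operator `γ ↦ f ∘ γ` of a smooth map is smooth. -/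
theorem contDiff_superposition {f : E → F} (hf : ContDiff ℝ ∞ f) :
    ContDiff ℝ ∞ fun γ : C(K, E) => (⟨f, hf.continuous⟩ : C(E, F)).comp γ :=
  contDiff_infty.2 fun n => contDiff_superposition_nat n hf

end Superposition

/-! ### The flow as solution of an integral equation on a fixed interval -/

section Primitive

open Set Filter Topology

variable {E : Type*} [NormedAddCommGroup E] [NormedSpace ℝ E]

theorem neg_one_le_one : (-1 : ℝ) ≤ 1 := by norm_num

/-- The primitive on `[-1, 1]` that vanishes at `0`. -/
def primitive : C(Icc (-1 : ℝ) 1, E) →L[ℝ] C(Icc (-1 : ℝ) 1, E) :=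
  LinearMap.mkContinuous
    { toFun := fun g => ⟨fun u => ∫ v in (0 : ℝ)..u, IccExtend neg_one_le_one g v,
        (intervalIntegral.continuous_primitive
          (fun _ _ => (g.continuous.Icc_extend').intervalIntegrable _ _) 0).comp
          continuous_subtype_val⟩
      map_add' := fun g h => by
        ext u
        exact intervalIntegral.integral_add (g.continuous.Icc_extend'.intervalIntegrable _ _)
          (h.continuous.Icc_extend'.intervalIntegrable _ _)
      map_smul' := fun c g => by
        ext u
        exact intervalIntegral.integral_smul c _ } 1 fun g => by
    rw [one_mul, ContinuousMap.norm_le _ (norm_nonneg _)]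
    intro u
    have h := intervalIntegral.norm_integral_le_of_norm_le_const (a := 0) (b := (u : ℝ))
      (f := IccExtend neg_one_le_one g) (C := ‖g‖) fun x _ => g.norm_coe_le_norm _
    refine h.trans (mul_le_of_le_one_right (norm_nonneg _) ?_)
    rw [sub_zero, abs_le]
    exact ⟨u.2.1, u.2.2⟩

theorem primitive_apply (g : C(Icc (-1 : ℝ) 1, E)) (u : Icc (-1 : ℝ) 1) :
    primitive g u = ∫ v in (0 : ℝ)..u, IccExtend neg_one_le_one g v := rfl

end Primitive

section LocalFlow

open Set Filter Topology

set_option synthInstance.maxHeartbeats 200000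

variable {E : Type*} [NormedAddCommGroup E] [NormedSpace ℝ E]

/-- The constant curves on `[-1, 1]`. -/
def constCurve : E →L[ℝ] C(Icc (-1 : ℝ) 1, E) :=
  LinearMap.mkContinuous
    { toFun := fun x => ContinuousMap.const _ x
      map_add' := fun _ _ => rfl
      map_smul' := fun _ _ => rfl } 1 fun x => by
    rw [one_mul, ContinuousMap.norm_le _ (norm_nonneg _)]
    exact fun _ => le_rfl

theorem constCurve_apply (x : E) (u : Icc (-1 : ℝ) 1) : constCurve x u = x := rfl

theorem contDiff_constCurve :
    ContDiff ℝ ∞ (constCurve : E → C(Icc (-1 : ℝ) 1, E)) :=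
  ContinuousLinearMap.contDiff (𝕜 := ℝ) (E := E) (F := C(Icc (-1 : ℝ) 1, E)) constCurve

theorem contDiff_primitive :
    ContDiff ℝ ∞ (primitive : C(Icc (-1 : ℝ) 1, E) → C(Icc (-1 : ℝ) 1, E)) :=
  ContinuousLinearMap.contDiff (𝕜 := ℝ) (E := C(Icc (-1 : ℝ) 1, E)) (F := C(Icc (-1 : ℝ) 1, E))
    primitive

/-- A curve `γ` on `[-1, 1]` solves `γ' = T f(γ)`, `γ(0) = x` iff the second component of
`flowEquation f ((T, x), γ)` vanishes. -/
def flowEquation {f : E → E} (hf : ContDiff ℝ ∞ f) (z : (ℝ × E) × C(Icc (-1 : ℝ) 1, E)) :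
    (ℝ × E) × C(Icc (-1 : ℝ) 1, E) :=
  (z.1, z.2 - (constCurve z.1.2 +
    z.1.1 • primitive ((⟨f, hf.continuous⟩ : C(E, E)).comp z.2)))

theorem contDiff_flowEquation {f : E → E} (hf : ContDiff ℝ ∞ f) :
    ContDiff ℝ ∞ (flowEquation hf) := by
  refine contDiff_fst.prodMk (contDiff_snd.sub ?_)
  refine (contDiff_constCurve.comp (contDiff_snd.comp contDiff_fst)).add ?_
  exact (contDiff_fst.comp contDiff_fst).smul
    (contDiff_primitive.comp ((contDiff_superposition hf).comp contDiff_snd))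

/-- The dependence of the integral term on the curve carries the factor `T`, so it drops out of the
derivative at `T = 0`. What is left is triangular with identities on the diagonal. -/
theorem hasFDerivAt_flowEquation {f : E → E} (hf : ContDiff ℝ ∞ f) (x₀ : E)
    (γ₀ : C(Icc (-1 : ℝ) 1, E)) :
    ∃ A : ((ℝ × E) × C(Icc (-1 : ℝ) 1, E)) ≃L[ℝ] ((ℝ × E) × C(Icc (-1 : ℝ) 1, E)),
      HasFDerivAt (flowEquation hf) (A : _ →L[ℝ] _) ((0, x₀), γ₀) := by
  set N := fun γ : C(Icc (-1 : ℝ) 1, E) => (⟨f, hf.continuous⟩ : C(E, E)).comp γ with hN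
  have hNd : HasFDerivAt N (fderiv ℝ N γ₀) γ₀ :=
    ((contDiff_superposition hf).differentiable (by simp) γ₀).hasFDerivAt
  set z : (ℝ × E) × C(Icc (-1 : ℝ) 1, E) := ((0, x₀), γ₀)
  have h1 : HasFDerivAt (fun z : (ℝ × E) × C(Icc (-1 : ℝ) 1, E) => z.1)
    (ContinuousLinearMap.fst ℝ _ _) z := hasFDerivAt_fst
  have h2 : HasFDerivAt (fun z : (ℝ × E) × C(Icc (-1 : ℝ) 1, E) => z.2)
    (ContinuousLinearMap.snd ℝ _ _) z := hasFDerivAt_snd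
  have h11 : HasFDerivAt (fun z : (ℝ × E) × C(Icc (-1 : ℝ) 1, E) => z.1.1)
    (ContinuousLinearMap.fst ℝ ℝ E ∘L ContinuousLinearMap.fst ℝ _ _) z := hasFDerivAt_fst.comp z h1
  have h12 : HasFDerivAt (fun z : (ℝ × E) × C(Icc (-1 : ℝ) 1, E) => constCurve z.1.2)
    (constCurve ∘L ContinuousLinearMap.snd ℝ ℝ E ∘L ContinuousLinearMap.fst ℝ _ _) z :=
    HasFDerivAt.comp z (ContinuousLinearMap.hasFDerivAt (𝕜 := ℝ) (E := E)
      (F := C(Icc (-1 : ℝ) 1, E)) constCurve) (hasFDerivAt_snd.comp z h1)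
  have h3 : HasFDerivAt (fun z : (ℝ × E) × C(Icc (-1 : ℝ) 1, E) => primitive (N z.2))
    (primitive ∘L fderiv ℝ N γ₀ ∘L ContinuousLinearMap.snd ℝ _ _) z :=
    HasFDerivAt.comp z (ContinuousLinearMap.hasFDerivAt (𝕜 := ℝ) (E := C(Icc (-1 : ℝ) 1, E))
      (F := C(Icc (-1 : ℝ) 1, E)) primitive) (HasFDerivAt.comp (g := N) z hNd h2)
  refine ⟨ContinuousLinearEquiv.skewProd (.refl ℝ _) (.refl ℝ _)
    (-(constCurve ∘L ContinuousLinearMap.snd ℝ ℝ E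
      + (ContinuousLinearMap.fst ℝ ℝ E).smulRight (primitive (N γ₀)))), ?_⟩
  refine (h1.prodMk (h2.sub (h12.add (h11.smul h3)))).congr_fderiv ?_
  ext z' <;> simp [z, sub_eq_add_neg]

/-- With the interval fixed and the duration `T` as a parameter, the inverse function theorem in the
space of curves gives smoothness in time and initial value at once. The flow is the value at `1` of
the solution `ψ (T, x)`. -/
theorem exists_flow_of_contDiff [CompleteSpace E] {f : E → E} (hf : ContDiff ℝ ∞ f) (x₀ : E) :
    ∃ ε > 0, ∃ W : Set E, IsOpen W ∧ x₀ ∈ W ∧ ∃ φ : ℝ × E → E,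
      ContDiffOn ℝ ∞ φ (Ioo (-ε) ε ×ˢ W) ∧ (∀ x ∈ W, φ (0, x) = x) ∧
      ∀ s ∈ Ioo (-ε) ε, ∀ x ∈ W, HasDerivAt (fun r => φ (r, x)) (f (φ (s, x))) s := by
  set γ₀ : C(Icc (-1 : ℝ) 1, E) := constCurve x₀ with hγ₀
  set z₀ : (ℝ × E) × C(Icc (-1 : ℝ) 1, E) := ((0, x₀), γ₀) with hz₀
  obtain ⟨A, hA⟩ := hasFDerivAt_flowEquation hf x₀ γ₀
  have hΘ := contDiff_flowEquation hf
  have h_top : (∞ : WithTop ℕ∞) ≠ 0 := by simp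
  set e := hΘ.contDiffAt.toOpenPartialHomeomorph (flowEquation hf) hA h_top with he
  have hez : ∀ z, e z = flowEquation hf z := fun _ => rfl
  have hz₀s : z₀ ∈ e.source := hΘ.contDiffAt.mem_toOpenPartialHomeomorph_source hA h_top
  have hez₀ : e z₀ = ((0, x₀), 0) := by simp [hez, flowEquation, hz₀, hγ₀]
  -- The local inverse is smooth wherever the derivative is invertible, not only at the centre, and
  -- this is an open condition.
  set O := {z | fderiv ℝ (flowEquation hf) z ∈ range
    ((↑) : (((ℝ × E) × C(Icc (-1 : ℝ) 1, E)) ≃L[ℝ] ((ℝ × E) × C(Icc (-1 : ℝ) 1, E))) → _)} with hO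
  have hOo : IsOpen O :=
    (ContinuousLinearEquiv.isOpen).preimage (hΘ.continuous_fderiv h_top)
  have hz₀O : z₀ ∈ O := ⟨A, hA.fderiv.symm⟩
  obtain ⟨r, hr, hball⟩ := Metric.isOpen_iff.1 (e.open_source.inter hOo) z₀ ⟨hz₀s, hz₀O⟩
  set D := {p : ℝ × E | (p, (0 : C(Icc (-1 : ℝ) 1, E))) ∈ e.target ∩ e.symm ⁻¹' Metric.ball z₀ r}
    with hD
  have hDo : IsOpen D := (e.isOpen_inter_preimage_symm Metric.isOpen_ball).preimage
    (continuous_id.prodMk continuous_const)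
  have hsymm : e.symm ((0, x₀), 0) = z₀ := by rw [← hez₀, e.left_inv hz₀s]
  have hpD : ((0 : ℝ), x₀) ∈ D := by
    refine ⟨?_, ?_⟩
    · rw [← hez₀]; exact e.map_source hz₀s
    · rw [mem_preimage, hsymm]; exact Metric.mem_ball_self hr
  obtain ⟨δ, hδ, hδD⟩ := Metric.isOpen_iff.1 hDo _ hpD
  set ψ : ℝ × E → C(Icc (-1 : ℝ) 1, E) := fun p => (e.symm (p, 0)).2 with hψ
  have hψeq : ∀ p ∈ D, e.symm (p, 0) = (p, ψ p) := by
    intro p hp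
    have h1 := e.right_inv hp.1
    rw [hez] at h1
    have h2 : (e.symm (p, 0)).1 = p := congrArg Prod.fst h1
    exact Prod.ext h2 rfl
  have hψsol : ∀ p ∈ D, ψ p = constCurve p.2 +
      p.1 • primitive ((⟨f, hf.continuous⟩ : C(E, E)).comp (ψ p)) := by
    intro p hp
    have h1 := e.right_inv hp.1
    rw [hψeq p hp, hez] at h1
    exact sub_eq_zero.1 (congrArg Prod.snd h1)
  have hψball : ∀ p ∈ D, dist (ψ p) γ₀ < r ∧ dist p (0, x₀) < r := by
    intro p hp
    have h1 := hp.2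
    rw [mem_preimage, hψeq p hp, Metric.mem_ball, Prod.dist_eq] at h1
    exact ⟨(le_max_right _ _).trans_lt h1, (le_max_left _ _).trans_lt h1⟩
  have hψuniq : ∀ p ∈ D, ∀ γ : C(Icc (-1 : ℝ) 1, E), dist γ γ₀ < r →
      γ = constCurve p.2 + p.1 • primitive ((⟨f, hf.continuous⟩ : C(E, E)).comp γ) → γ = ψ p := by
    intro p hp γ hγ hsol
    have h1 : (p, γ) ∈ e.source := (hball (by
      rw [Metric.mem_ball, Prod.dist_eq]; exact max_lt (hψball p hp).2 hγ)).1
    have h2 : e (p, γ) = (p, 0) := Prod.ext rfl (sub_eq_zero.2 hsol)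
    rw [hψ]
    simp only
    rw [← h2, e.left_inv h1]
  have hψsmooth : ∀ p ∈ D, ContDiffAt ℝ ∞ ψ p := by
    intro p hp
    obtain ⟨A', hA'⟩ := (hball hp.2).2
    have h1 : ContDiffAt ℝ ∞ e.symm (p, 0) := e.contDiffAt_symm hp.1
      (f₀' := A') (by rw [hA']; exact (hΘ.differentiable h_top _).hasFDerivAt) hΘ.contDiffAt
    exact contDiffAt_snd.comp p (h1.comp p (contDiffAt_id.prodMk contDiffAt_const))
  have hbox : ∀ {s : ℝ} {x : E}, s ∈ Ioo (-δ) δ → x ∈ Metric.ball x₀ δ → (s, x) ∈ D := by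
    intro s x hs hx
    refine hδD ?_
    rw [Metric.mem_ball, Prod.dist_eq]
    refine max_lt ?_ hx
    rw [Real.dist_eq, sub_zero]
    exact abs_lt.2 hs
  have hone : (1 : ℝ) ∈ Icc (-1 : ℝ) 1 := by simp
  -- The curve `v ↦ ψ (T, x) (u v)` solves the equation for the duration `T u`. By local uniqueness
  -- it is `ψ (T u, x)`; then evaluate at `1`.
  have hscale : ∀ T ∈ Ioo (-δ) δ, ∀ x ∈ Metric.ball x₀ δ, ∀ u : Icc (-1 : ℝ) 1,
      ψ (T * u, x) ⟨1, hone⟩ = ψ (T, x) u := by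
    intro T hT x hx u
    have hu : |(u : ℝ)| ≤ 1 := abs_le.2 u.2
    have huv : ∀ v : Icc (-1 : ℝ) 1, (u : ℝ) * v ∈ Icc (-1 : ℝ) 1 := fun v => by
      rw [mem_Icc, ← abs_le, abs_mul]
      exact mul_le_one₀ hu (abs_nonneg _) (abs_le.2 v.2)
    set σ : C(Icc (-1 : ℝ) 1, Icc (-1 : ℝ) 1) := ⟨fun v => ⟨u * v, huv v⟩, by fun_prop⟩ with hσ
    have hTu : T * u ∈ Ioo (-δ) δ := by
      rw [mem_Ioo, ← abs_lt, abs_mul]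
      exact (mul_le_of_le_one_right (abs_nonneg _) hu).trans_lt (abs_lt.2 hT)
    have hD1 := hbox hT hx
    have hD2 := hbox hTu hx
    have key : (ψ (T, x)).comp σ = ψ (T * u, x) := by
      refine hψuniq _ hD2 _ ?_ ?_
      · have h1 := (hψball _ hD1).1
        refine lt_of_le_of_lt ((ContinuousMap.dist_le dist_nonneg).2 fun v => ?_) h1
        exact ContinuousMap.dist_apply_le_dist (f := ψ (T, x)) (g := γ₀) (σ v)
      · ext v
        have h1 := congrArg (fun γ : C(Icc (-1 : ℝ) 1, E) => γ (σ v)) (hψsol _ hD1)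
        simp only [ContinuousMap.add_apply, ContinuousMap.smul_apply, constCurve_apply,
          primitive_apply] at h1
        simp only [ContinuousMap.comp_apply, ContinuousMap.add_apply, ContinuousMap.smul_apply,
          constCurve_apply, primitive_apply]
        rw [h1, mul_smul]
        congr 2
        have h2 := intervalIntegral.smul_integral_comp_mul_left (a := 0) (b := (v : ℝ))
          (IccExtend neg_one_le_one (((⟨f, hf.continuous⟩ : C(E, E)).comp (ψ (T, x))))) (u : ℝ)
        rw [mul_zero] at h2
        change _ = (u : ℝ) • _
        rw [show ((σ v : Icc (-1 : ℝ) 1) : ℝ) = u * v from rfl, ← h2]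
        congr 1
        refine intervalIntegral.integral_congr fun w hw => ?_
        have hw' : w ∈ Icc (-1 : ℝ) 1 := by
          have h01 : (0 : ℝ) ∈ Icc (-1 : ℝ) 1 := by simp
          exact (ordConnected_Icc.uIcc_subset h01 v.2) hw
        rw [IccExtend_of_mem _ _ (huv ⟨w, hw'⟩), IccExtend_of_mem _ _ hw']
        rfl
    rw [← key]
    simp [hσ]
  refine ⟨δ, hδ, Metric.ball x₀ δ, Metric.isOpen_ball, Metric.mem_ball_self hδ,
    fun p => ψ p ⟨1, hone⟩, ?_, ?_, ?_⟩
  · intro p hp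
    exact (((ContinuousMap.evalCLM ℝ (⟨1, hone⟩ : Icc (-1 : ℝ) 1)).contDiff.contDiffAt).comp p
      (hψsmooth p (hbox hp.1 hp.2))).contDiffWithinAt
  · intro x hx
    have h1 := congrArg (fun γ : C(Icc (-1 : ℝ) 1, E) => γ ⟨1, hone⟩)
      (hψsol (0, x) (hbox ⟨neg_lt_zero.2 hδ, hδ⟩ hx))
    simpa [constCurve_apply] using h1
  · intro s hs x hx
    -- For all times `r` near `s` the flow is read off the single curve `ψ (T, x)` at the parameter
    -- `r / T`, so the fundamental theorem of calculus applies.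
    obtain ⟨T, hsT, hTδ⟩ := exists_between (abs_lt.2 hs)
    have hT0 : 0 < T := (abs_nonneg s).trans_lt hsT
    have hT : T ∈ Ioo (-δ) δ := ⟨by linarith, hTδ⟩
    have hmem : ∀ r, |r| < T → r / T ∈ Icc (-1 : ℝ) 1 := fun r hr => by
      rw [mem_Icc, ← abs_le, abs_div, abs_of_pos hT0]
      exact (div_le_one hT0).2 hr.le
    set g : ℝ → E := IccExtend neg_one_le_one
      (((⟨f, hf.continuous⟩ : C(E, E)).comp (ψ (T, x)))) with hg
    have hgc : Continuous g := ((⟨f, hf.continuous⟩ : C(E, E)).comp (ψ (T, x))).continuous.Icc_extend'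
    have hloc : (fun r => ψ (r, x) ⟨1, hone⟩) =ᶠ[𝓝 s] fun r => x + T • ∫ v in (0 : ℝ)..r / T, g v := by
      have hop : {r : ℝ | |r| < T} ∈ 𝓝 s := (isOpen_lt continuous_abs continuous_const).mem_nhds hsT
      filter_upwards [hop] with r hr
      have h1 := hscale T hT x hx ⟨r / T, hmem r hr⟩
      simp only [mul_div_cancel₀ r hT0.ne'] at h1
      rw [h1]
      have h2 := congrArg (fun γ : C(Icc (-1 : ℝ) 1, E) => γ ⟨r / T, hmem r hr⟩)
        (hψsol _ (hbox hT hx))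
      simpa only [ContinuousMap.add_apply, ContinuousMap.smul_apply, constCurve_apply,
          primitive_apply] using h2
    have hval : f (ψ (s, x) ⟨1, hone⟩) = g (s / T) := by
      have h1 := hscale T hT x hx ⟨s / T, hmem s hsT⟩
      simp only [mul_div_cancel₀ s hT0.ne'] at h1
      rw [h1, hg, IccExtend_of_mem _ _ (hmem s hsT)]
      rfl
    refine HasDerivAt.congr_of_eventuallyEq ?_ hloc
    rw [hval]
    have h3 : HasDerivAt (fun u => ∫ v in (0 : ℝ)..u, g v) (g (s / T)) (s / T) :=
      intervalIntegral.integral_hasDerivAt_right (hgc.intervalIntegrable _ _)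
        (hgc.stronglyMeasurableAtFilter _ _) hgc.continuousAt
    have h4 : HasDerivAt (fun r : ℝ => r / T) (1 / T) s := (hasDerivAt_id s).div_const T
    have h5 := ((h3.scomp s h4).const_smul T).const_add x
    rw [smul_smul, mul_one_div_cancel hT0.ne', one_smul] at h5
    exact h5

end LocalFlow

/-! ### Local flows of fields on an open set -/

section LocalFlow

open Set Filter Topology

variable {E : Type*} [NormedAddCommGroup E] [NormedSpace ℝ E]

theorem exists_contDiff_eqOn_ball [FiniteDimensional ℝ E] {f : E → E} {B : Set E} {x₀ : E}
    (hB : IsOpen B) (hx₀ : x₀ ∈ B) (hf : ContDiffOn ℝ ∞ f B) :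
    ∃ g : E → E, ContDiff ℝ ∞ g ∧ ∃ r > 0, Metric.ball x₀ r ⊆ B ∧
      EqOn f g (Metric.ball x₀ r) := by
  obtain ⟨R, hR, hRB⟩ := Metric.isOpen_iff.1 hB x₀ hx₀
  let χ : ContDiffBump x₀ := ⟨R / 3, R / 2, by positivity, by linarith⟩
  refine ⟨fun x => χ x • f x, contDiff_iff_contDiffAt.2 fun x => ?_, R / 3, by positivity,
    (Metric.ball_subset_ball (by linarith)).trans hRB, fun x hx => ?_⟩
  · by_cases hx : x ∈ Metric.ball x₀ R
    · exact χ.contDiffAt.smul (hf.contDiffAt (hB.mem_nhds (hRB hx)))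
    · have h1 : x ∉ tsupport χ := fun h => hx (by
        rw [χ.tsupport_eq] at h
        exact Metric.closedBall_subset_ball (by change R / 2 < R; linarith) h)
      refine (contDiffAt_const (c := (0 : E))).congr_of_eventuallyEq ?_
      filter_upwards [notMem_tsupport_iff_eventuallyEq.1 h1] with y hy
      simp [hy]
  · have : χ x = 1 := χ.one_of_mem_closedBall (Metric.ball_subset_closedBall hx)
    simp [this]

/-- Cut the field off, take the flow, and shrink until orbits stay where the cut-off is invisible
and the field is Lipschitz. Uniqueness of solutions in that region gives the invariance of the field
under the flow and the last claim. -/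
theorem exists_flowBox_of_contDiffOn [FiniteDimensional ℝ E] {f : E → E} {B : Set E} {x₀ : E}
    (hB : IsOpen B) (hx₀ : x₀ ∈ B) (hf : ContDiffOn ℝ ∞ f B) :
    ∃ ε > 0, ∃ W ⊆ B, IsOpen W ∧ x₀ ∈ W ∧ ∃ φ : ℝ × E → E,
      ContDiffOn ℝ ∞ φ (Ioo (-ε) ε ×ˢ W) ∧ (∀ x ∈ W, φ (0, x) = x) ∧
      (∀ s ∈ Ioo (-ε) ε, ∀ x ∈ W, φ (s, x) ∈ B ∧
        HasDerivAt (fun r => φ (r, x)) (f (φ (s, x))) s) ∧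
      (∀ s ∈ Ioo (-ε) ε, ∀ x ∈ W,
        HasDerivAt (fun r => φ (s, φ (r, x))) (f (φ (s, x))) 0) ∧
      ∀ (γ : ℝ → E) (a b : ℝ), a ≤ b → b - a < ε → (∀ s ∈ Icc a b, γ s ∈ W) →
        (∀ s ∈ Icc a b, HasDerivWithinAt γ (f (γ s)) (Icc a b) s) →
        γ b = φ (b - a, γ a) := by
  have : CompleteSpace E := FiniteDimensional.complete ℝ E
  obtain ⟨g, hg, r₁, hr₁, hr₁B, hfg⟩ := exists_contDiff_eqOn_ball hB hx₀ hf
  obtain ⟨K, s₀, hs₀, hlip⟩ :=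
    (hg.contDiffAt (x := x₀)).of_le (show (1 : WithTop ℕ∞) ≤ ∞ by exact_mod_cast le_top)
      |>.exists_lipschitzOnWith
  obtain ⟨r₂, hr₂, hr₂s⟩ := Metric.mem_nhds_iff.1 hs₀
  set U := Metric.ball x₀ (min r₁ r₂) with hU
  have hU1 : U ⊆ Metric.ball x₀ r₁ := Metric.ball_subset_ball (min_le_left _ _)
  have hUlip : LipschitzOnWith K g U :=
    hlip.mono ((Metric.ball_subset_ball (min_le_right _ _)).trans hr₂s)
  have hUx : x₀ ∈ U := Metric.mem_ball_self (lt_min hr₁ hr₂)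
  obtain ⟨ε₀, hε₀, W₀, hW₀, hxW₀, φ, hφ, hφ0, hφd⟩ := exists_flow_of_contDiff hg x₀
  have hzero : (0 : ℝ) ∈ Ioo (-ε₀) ε₀ := ⟨neg_lt_zero.2 hε₀, hε₀⟩
  have hopen := hφ.continuousOn.isOpen_inter_preimage (isOpen_Ioo.prod hW₀)
    (Metric.isOpen_ball (x := x₀) (ε := min r₁ r₂))
  obtain ⟨δ, hδ, hδb⟩ := Metric.isOpen_iff.1 hopen (0, x₀) ⟨⟨hzero, hxW₀⟩, by
    rw [mem_preimage, hφ0 _ hxW₀]; exact hUx⟩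
  have hbox : ∀ {s : ℝ} {x : E}, s ∈ Ioo (-δ) δ → x ∈ Metric.ball x₀ δ →
      (s ∈ Ioo (-ε₀) ε₀ ∧ x ∈ W₀) ∧ φ (s, x) ∈ U := by
    intro s x hs hx
    have h1 : (s, x) ∈ Metric.ball ((0 : ℝ), x₀) δ := by
      rw [Metric.mem_ball, Prod.dist_eq]
      refine max_lt ?_ hx
      rw [Real.dist_eq, sub_zero]
      exact abs_lt.2 hs
    exact hδb h1
  have h0δ : (0 : ℝ) ∈ Ioo (-δ) δ := ⟨neg_lt_zero.2 hδ, hδ⟩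
  have hWU : Metric.ball x₀ δ ⊆ U := fun x hx => by
    have h1 := hbox h0δ hx
    rw [hφ0 _ h1.1.2] at h1
    exact h1.2
  have hder : ∀ s ∈ Ioo (-δ) δ, ∀ x ∈ Metric.ball x₀ δ,
      HasDerivAt (fun r => φ (r, x)) (g (φ (s, x))) s := fun s hs x hx =>
    hφd s (hbox hs hx).1.1 x (hbox hs hx).1.2
  refine ⟨δ, hδ, Metric.ball x₀ δ, hWU.trans (hU1.trans hr₁B), Metric.isOpen_ball,
    Metric.mem_ball_self hδ, φ, hφ.mono fun p hp => (hbox hp.1 hp.2).1,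
    fun x hx => hφ0 x (hbox h0δ hx).1.2, fun s hs x hx => ⟨hr₁B (hU1 (hbox hs hx).2), ?_⟩, ?_, ?_⟩
  · rw [hfg (hU1 (hbox hs hx).2)]
    exact hder s hs x hx
  · intro s hs x hx
    have hx1 : Tendsto (fun r => φ (r, x)) (𝓝 0) (𝓝 x) := by
      have := (hder 0 h0δ x hx).continuousAt
      rwa [ContinuousAt, hφ0 x (hbox h0δ hx).1.2] at this
    -- The local group law: both sides, as functions of the outer time, solve the equation with the
    -- same initial value. Its derivative in `r` says that the flow carries the field to itself.
    have hloc : (fun r => φ (s, φ (r, x))) =ᶠ[𝓝 0] fun r => φ (s + r, x) := by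
      obtain ⟨d, hd1, hd2⟩ := exists_between (abs_lt.2 hs)
      have hI : Ioo (-(δ - d)) (δ - d) ∈ 𝓝 (0 : ℝ) :=
        Ioo_mem_nhds (by linarith) (by linarith)
      filter_upwards [hx1 (Metric.isOpen_ball.mem_nhds hx), hI] with r hr hrd
      have hd0 : 0 < d := (abs_nonneg s).trans_lt hd1
      have hsub : ∀ t ∈ Ioo (-d) d, t ∈ Ioo (-δ) δ ∧ t + r ∈ Ioo (-δ) δ := fun t ht =>
        ⟨⟨by linarith [ht.1], by linarith [ht.2]⟩,
          ⟨by linarith [ht.1, hrd.1], by linarith [ht.2, hrd.2]⟩⟩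
      refine ODE_solution_unique_of_mem_Ioo (v := fun _ => g) (s := fun _ => U) (K := K)
        (f := fun t => φ (t, φ (r, x))) (g := fun t => φ (t + r, x)) (a := -d) (b := d) (t₀ := 0)
        (fun _ _ => hUlip) ⟨by linarith, hd0⟩ (fun t ht => ?_) (fun t ht => ?_) ?_
        (abs_lt.1 hd1)
      · exact ⟨hder t (hsub t ht).1 _ hr, (hbox (hsub t ht).1 hr).2⟩
      · exact ⟨(hder (t + r) (hsub t ht).2 x hx).comp_add_const t r,
          (hbox (hsub t ht).2 hx).2⟩
      · simp only [zero_add]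
        exact hφ0 _ (hbox h0δ hr).1.2
    refine HasDerivAt.congr_of_eventuallyEq ?_ hloc
    rw [hfg (hU1 (hbox hs hx).2)]
    have h1 : HasDerivAt (fun r => φ (r, x)) (g (φ (s, x))) (s + 0) := by
      rw [add_zero]; exact hder s hs x hx
    exact h1.comp_const_add s 0
  · intro γ a b hab hba hγW hγ
    have hts : ∀ t ∈ Ico a b, t - a ∈ Ioo (-δ) δ := fun t ht =>
      ⟨by linarith [ht.1], by linarith [ht.2]⟩
    have hγa : γ a ∈ Metric.ball x₀ δ := hγW a (left_mem_Icc.2 hab)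
    have hd2 : ∀ t ∈ Icc a b, HasDerivAt (fun t => φ (t - a, γ a)) (g (φ (t - a, γ a))) t :=
      fun t ht => (hder (t - a) ⟨by linarith [ht.1], by linarith [ht.2]⟩ _ hγa).comp_sub_const t a
    refine ODE_solution_unique_of_mem_Icc_right (v := fun _ => g) (s := fun _ => U) (K := K)
      (f := γ) (g := fun t => φ (t - a, γ a)) (a := a) (b := b) (fun _ _ => hUlip)
      (fun t ht => (hγ t ht).continuousWithinAt) (fun t ht => ?_)
      (fun t ht => hWU (hγW t (Ico_subset_Icc_self ht)))
      (fun t ht => (hd2 t ht).continuousAt.continuousWithinAt)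
      (fun t ht => (hd2 t (Ico_subset_Icc_self ht)).hasDerivWithinAt)
      (fun t ht => (hbox (hts t ht) hγa).2) ?_ (right_mem_Icc.2 hab)
    · have h1 := hγ t (Ico_subset_Icc_self ht)
      rw [hfg (hU1 (hWU (hγW t (Ico_subset_Icc_self ht))))] at h1
      exact h1.mono_of_mem_nhdsWithin (mem_of_superset (Icc_mem_nhdsGE ht.2)
        (Icc_subset_Icc_left ht.1))
    · simp only [sub_self]
      exact (hφ0 _ (hbox h0δ hγa).1.2).symm

end LocalFlow

/-! ### Flow boxes of vector fields on manifolds -/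

section FlowBox

open Set Filter Topology

variable {E H : Type*} [NormedAddCommGroup E] [NormedSpace ℝ E] [TopologicalSpace H]
  {I : ModelWithCorners ℝ E H} {M : Type*} [TopologicalSpace M] [ChartedSpace H M]

variable (I) in
/-- The differential of a map `M → M`, in the preferred charts. -/
def endDeriv (f : M → M) (x : M) : E →L[ℝ] E := mfderiv I I f x

variable (I) in
/-- The differential of a function on `M`, in the preferred chart. -/
def scalarDeriv (f : M → ℝ) (x : M) : E →L[ℝ] ℝ := mfderiv I 𝓘(ℝ, ℝ) f x

variable (I) in
/-- A local flow of the vector field `X`, which is smooth in time and initial value. -/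
structure FlowBox (X : M → E) where
  time : ℝ
  time_pos : 0 < time
  dom : Set M
  isOpen_dom : IsOpen dom
  flow : ℝ × M → M
  smooth : ContMDiffOn (𝓘(ℝ, ℝ).prod I) I ∞ flow (Ioo (-time) time ×ˢ dom)
  flow_zero : ∀ x ∈ dom, flow (0, x) = x
  hasMFDerivAt_time : ∀ s ∈ Ioo (-time) time, ∀ x ∈ dom,
    HasMFDerivAt 𝓘(ℝ, ℝ) I (fun r => flow (r, x)) s
      ((1 : ℝ →L[ℝ] ℝ).smulRight (X (flow (s, x))))
  mfderiv_apply : ∀ s ∈ Ioo (-time) time, ∀ x ∈ dom,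
    endDeriv I (fun y => flow (s, y)) x (X x) = X (flow (s, x))
  unique : ∀ (γ : ℝ → M) (a b : ℝ), a ≤ b → b - a < time → (∀ s ∈ Icc a b, γ s ∈ dom) →
    IsMIntegralCurveOn (I := I) γ X (Icc a b) → γ b = flow (b - a, γ a)

variable [IsManifold I ∞ M] {X : (x : M) → TangentSpace I x}

theorem isManifold_one_of_infty : IsManifold I 1 M := .of_le (n := ∞) (by exact_mod_cast le_top)

/-- The vector field `X` in the chart around `x₀`. -/
def chartField (X : (x : M) → TangentSpace I x) (x₀ : M) (z : E) : E :=
  mfderiv I 𝓘(ℝ, E) (extChartAt I x₀) ((extChartAt I x₀).symm z) (X ((extChartAt I x₀).symm z))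

theorem mfderiv_extChartAt_eq_tangentCoordChange {x₀ x : M}
    (hx : x ∈ (chartAt H x₀).source) :
    haveI : IsManifold I 1 M := isManifold_one_of_infty
    mfderiv I 𝓘(ℝ, E) (extChartAt I x₀) x = tangentCoordChange I x x₀ x := by
  have := isManifold_one_of_infty (I := I) (M := M)
  rw [(hasMFDerivAt_extChartAt hx).mfderiv, mfderiv_chartAt_eq_tangentCoordChange hx]

theorem contMDiffOn_mfderiv_extChartAt
    (hX : ContMDiff I I.tangent ∞ fun x => (⟨x, X x⟩ : TangentBundle I M)) (x₀ : M) :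
    ContMDiffOn I 𝓘(ℝ, E) ∞ (fun x => (mfderiv I 𝓘(ℝ, E) (extChartAt I x₀) x (X x) : E))
      (chartAt H x₀).source := by
  have := isManifold_one_of_infty (I := I) (M := M)
  have h1 := ((trivializationAt E (TangentSpace I) x₀).contMDiffOn_section_baseSet_iff
    (IB := I) (n := ∞) (s := X)).1 hX.contMDiffOn
  rw [TangentBundle.trivializationAt_baseSet] at h1
  refine h1.congr fun x hx => ?_
  rw [mfderiv_extChartAt_eq_tangentCoordChange hx]
  rfl

theorem contDiffOn_chartField [I.Boundaryless]
    (hX : ContMDiff I I.tangent ∞ fun x => (⟨x, X x⟩ : TangentBundle I M)) (x₀ : M) :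
    ContDiffOn ℝ ∞ (chartField X x₀) (extChartAt I x₀).target := by
  rw [← contMDiffOn_iff_contDiffOn]
  refine (contMDiffOn_mfderiv_extChartAt hX x₀).comp (contMDiffOn_extChartAt_symm x₀) ?_
  intro z hz
  rw [mem_preimage, ← extChartAt_source I]
  exact (extChartAt I x₀).map_target hz

theorem hasMFDerivWithinAt_extChartAt_symm_comp [I.Boundaryless] {x₀ : M} {σ : ℝ → E} {S : Set ℝ}
    {s : ℝ} (hs : σ s ∈ (extChartAt I x₀).target)
    {v : TangentSpace I ((extChartAt I x₀).symm (σ s))}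
    (hσ : HasDerivWithinAt σ
      (mfderiv I 𝓘(ℝ, E) (extChartAt I x₀) ((extChartAt I x₀).symm (σ s)) v) S s) :
    HasMFDerivWithinAt 𝓘(ℝ, ℝ) I (fun r => (extChartAt I x₀).symm (σ r)) S s
      ((1 : ℝ →L[ℝ] ℝ).smulRight v) := by
  have := isManifold_one_of_infty (I := I) (M := M)
  have h1 := (mdifferentiableWithinAt_extChartAt_symm (I := I) hs)
  rw [I.range_eq_univ, mdifferentiableWithinAt_univ] at h1
  have h2 : HasMFDerivWithinAt 𝓘(ℝ, ℝ) 𝓘(ℝ, E) σ S s _ := hσ.hasFDerivWithinAt.hasMFDerivWithinAt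
  refine (h1.hasMFDerivAt.comp_hasMFDerivWithinAt s h2).congr_mfderiv ?_
  have h3 := mfderivWithin_extChartAt_symm_comp_mfderiv_extChartAt (I := I) hs
  rw [I.range_eq_univ, mfderivWithin_univ] at h3
  refine ContinuousLinearMap.ext fun (r : ℝ) => ?_
  exact (map_smul (mfderiv 𝓘(ℝ, E) I (extChartAt I x₀).symm (σ s)) (r : ℝ) _).trans
    (congrArg (fun w => (r : ℝ) • w) (DFunLike.congr_fun h3 v))

theorem hasDerivWithinAt_extChartAt_comp {x₀ : M} {γ : ℝ → M} {S : Set ℝ} {s : ℝ}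
    (hs : γ s ∈ (chartAt H x₀).source) {v : TangentSpace I (γ s)}
    (hγ : HasMFDerivWithinAt 𝓘(ℝ, ℝ) I γ S s ((1 : ℝ →L[ℝ] ℝ).smulRight v)) :
    HasDerivWithinAt (fun r => extChartAt I x₀ (γ r))
      (mfderiv I 𝓘(ℝ, E) (extChartAt I x₀) (γ s) v) S s := by
  have := isManifold_one_of_infty (I := I) (M := M)
  have h1 := (mdifferentiableAt_extChartAt (I := I) hs).hasMFDerivAt
  have h2 := (h1.comp_hasMFDerivWithinAt s hγ).hasFDerivWithinAt
  refine hasDerivWithinAt_iff_hasFDerivWithinAt.2 (h2.congr_fderiv ?_)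
  refine ContinuousLinearMap.ext fun (r : ℝ) => ?_
  exact map_smul (mfderiv I 𝓘(ℝ, E) (extChartAt I x₀) (γ s)) (r : ℝ) v

/-- The local flow of the field in the chart at `x₀`, conjugated by that chart. -/
theorem exists_flowBox [FiniteDimensional ℝ E] [I.Boundaryless] {X : M → E}
    (hX : ContMDiff I I.tangent ∞ fun x => (⟨x, X x⟩ : TangentBundle I M)) (x₀ : M) :
    ∃ B : FlowBox I X, x₀ ∈ B.dom := by
  have := isManifold_one_of_infty (I := I) (M := M)
  set c := extChartAt I x₀ with hc
  obtain ⟨ε, hε, W, hWt, hW, hxW, φ, hφ, hφ0, hφd, hφe, hφu⟩ := exists_flowBox_of_contDiffOn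
    (isOpen_extChartAt_target x₀) (mem_extChartAt_target x₀) (contDiffOn_chartField (I := I) hX x₀)
  have hVo : IsOpen (c.source ∩ c ⁻¹' W) :=
    (continuousOn_extChartAt x₀).isOpen_inter_preimage (isOpen_extChartAt_source x₀) hW
  have h0 : (0 : ℝ) ∈ Ioo (-ε) ε := ⟨neg_lt_zero.2 hε, hε⟩
  have hsm : ContMDiffOn (𝓘(ℝ, ℝ).prod I) I ∞ (fun p : ℝ × M => c.symm (φ (p.1, c p.2)))
      (Ioo (-ε) ε ×ˢ (c.source ∩ c ⁻¹' W)) := by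
    refine (contMDiffOn_extChartAt_symm x₀).comp (t := c.target)
      (f := fun p : ℝ × M => φ (p.1, c p.2)) ?_ fun p hp => (hφd p.1 hp.1 _ hp.2.2).1
    refine hφ.contMDiffOn.comp (f := fun p : ℝ × M => (p.1, c p.2)) ?_ fun p hp => ⟨hp.1, hp.2.2⟩
    refine contMDiffOn_fst.prodMk_space ?_
    refine (contMDiffOn_extChartAt (I := I) (x := x₀)).comp contMDiffOn_snd fun p hp => ?_
    rw [mem_preimage, ← extChartAt_source I]
    exact hp.2.1
  refine ⟨⟨ε, hε, c.source ∩ c ⁻¹' W, hVo, fun p => c.symm (φ (p.1, c p.2)), hsm, ?_, ?_, ?_, ?_⟩,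
    mem_extChartAt_source x₀, hxW⟩
  · intro x hx
    simp only
    rw [hφ0 _ hx.2, c.left_inv hx.1]
  · intro s hs x hx
    have h1 := hφd s hs _ hx.2
    refine hasMFDerivWithinAt_univ.1 ?_
    exact hasMFDerivWithinAt_extChartAt_symm_comp (I := I) h1.1 h1.2.hasDerivWithinAt
  · intro s hs x hx
    have hev : ∀ᶠ r in 𝓝 (0 : ℝ), r ∈ Ioo (-ε) ε := isOpen_Ioo.mem_nhds h0
    have h1 := hφe s hs _ hx.2
    have hval : φ (s, φ (0, c x)) = φ (s, c x) := by rw [hφ0 _ hx.2]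
    have h2 : HasMFDerivWithinAt 𝓘(ℝ, ℝ) I (fun r => c.symm (φ (s, φ (r, c x)))) univ 0
        ((1 : ℝ →L[ℝ] ℝ).smulRight (X (c.symm (φ (s, φ (0, c x)))))) := by
      refine hasMFDerivWithinAt_extChartAt_symm_comp (I := I) (by rw [hval]; exact (hφd s hs _ hx.2).1) ?_
      refine hasDerivWithinAt_univ.2 ?_
      change HasDerivAt _ (chartField (I := I) X x₀ (φ (s, φ (0, c x)))) 0
      rwa [hval]
    replace h2 := hasMFDerivWithinAt_univ.1 h2
    have h3 : HasMFDerivAt 𝓘(ℝ, ℝ) I (fun r => c.symm (φ (r, c x))) 0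
        ((1 : ℝ →L[ℝ] ℝ).smulRight (X (c.symm (φ (0, c x))))) := by
      have h1 := hφd 0 h0 _ hx.2
      refine hasMFDerivWithinAt_univ.1 ?_
      exact hasMFDerivWithinAt_extChartAt_symm_comp (I := I) h1.1 h1.2.hasDerivWithinAt
    have hxx : c.symm (φ (0, c x)) = x := by rw [hφ0 _ hx.2, c.left_inv hx.1]
    have h4 : MDifferentiableAt I I (fun y => c.symm (φ (s, c y))) (c.symm (φ (0, c x))) := by
      rw [hxx]
      have h5 : ContMDiffAt I (𝓘(ℝ, ℝ).prod I) ∞ (fun y : M => (s, y)) x :=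
        contMDiffAt_const.prodMk contMDiffAt_id
      exact ((hsm.contMDiffAt ((isOpen_Ioo.prod hVo).mem_nhds ⟨hs, hx⟩)).comp x h5).mdifferentiableAt
        (by simp)
    have h5 := HasMFDerivAt.comp (0 : ℝ) h4.hasMFDerivAt h3
    have h6 : (fun r => c.symm (φ (s, φ (r, c x)))) =ᶠ[𝓝 0]
        (fun y => c.symm (φ (s, c y))) ∘ fun r => c.symm (φ (r, c x)) := by
      filter_upwards [hev] with r hr
      simp only [Function.comp_apply]
      rw [c.right_inv (hφd r hr _ hx.2).1]
    have h7 := hasMFDerivAt_unique (h5.congr_of_eventuallyEq h6) h2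
    have h8 := ((congrArg (mfderiv I I (fun y => c.symm (φ (s, c y))) _)
      (one_smul ℝ (X (c.symm (φ (0, c x)))))).symm.trans (DFunLike.congr_fun h7 (1 : ℝ))).trans
      (one_smul ℝ (X (c.symm (φ (s, φ (0, c x))))))
    -- The point `c.symm (φ (0, c x))` is only propositionally equal to `x`; it is generalised to
    -- move the identity to the tangent space at `x`.
    have h9 : ∀ y, y = x → mfderiv I I (fun y => c.symm (φ (s, c y))) y (X y) =
        (X (c.symm (φ (s, φ (0, c x)))) : E) →
        (mfderiv I I (fun y => c.symm (φ (s, c y))) x (X x) : E) = X (c.symm (φ (s, c x))) := by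
      rintro y rfl h
      rw [hval] at h
      exact h
    exact h9 _ hxx h8
  · intro γ a b hab hba hγV hγ
    have h1 := hφu (fun t => c (γ t)) a b hab hba (fun t ht => (hγV t ht).2) fun t ht => by
      have h2 := hasDerivWithinAt_extChartAt_comp (x₀ := x₀) (by
        rw [← extChartAt_source I]; exact (hγV t ht).1) (hγ t ht)
      have h3 : c.symm (c (γ t)) = γ t := c.left_inv (hγV t ht).1
      have h4 : chartField (I := I) X x₀ (c (γ t)) = mfderiv I 𝓘(ℝ, E) (extChartAt I x₀) (γ t) (X (γ t)) := by
        unfold chartField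
        rw [h3]
      rw [h4]
      exact h2
    change γ b = c.symm (φ (b - a, c (γ a)))
    rw [← h1, c.left_inv (hγV b (right_mem_Icc.2 hab)).1]

end FlowBox

/-! ### Composing flows with maps that act after a state-dependent delay -/

section LocalFamily

open Set Filter Topology

variable {E H : Type*} [NormedAddCommGroup E] [NormedSpace ℝ E] [TopologicalSpace H]
  {I : ModelWithCorners ℝ E H} {M : Type*} [TopologicalSpace M] [ChartedSpace H M]
  {F : Type*} [Zero F]

theorem hasMFDerivAt_comp_time {X : M → E} {Φ : ℝ × M → M} {a : M → ℝ}
    {Z : M → M} {x : M}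
    (hΦ : MDifferentiableAt (𝓘(ℝ, ℝ).prod I) I Φ (a x, Z x))
    (ht : HasMFDerivAt 𝓘(ℝ, ℝ) I (fun r => Φ (r, Z x)) (a x)
      ((1 : ℝ →L[ℝ] ℝ).smulRight (X (Φ (a x, Z x)))))
    (ha : MDifferentiableAt I 𝓘(ℝ, ℝ) a x) (hZ : MDifferentiableAt I I Z x) :
    HasMFDerivAt I I (fun y => Φ (a y, Z y)) x
      (endDeriv I (fun y => Φ (a x, y)) (Z x) ∘L endDeriv I Z x +
        (scalarDeriv I a x).smulRight (X (Φ (a x, Z x))) : E →L[ℝ] E) := by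
  have h1 := HasMFDerivAt.comp x (f := fun y => (a y, Z y)) hΦ.hasMFDerivAt
    (ha.hasMFDerivAt.prodMk hZ.hasMFDerivAt)
  refine h1.congr_mfderiv (ContinuousLinearMap.ext fun v => ?_)
  refine (mfderiv_prod_eq_add_apply hΦ).trans ?_
  have h3 := DFunLike.congr_fun ht.mfderiv (scalarDeriv I a x v)
  exact (add_comm _ _).trans (congrArg₂ (fun u w : E => u + w) rfl h3)

variable (I) (X : M → E) (P : M → F) (c : M → ℝ)

theorem det_comp (A B : E →L[ℝ] E) : (A ∘L B).det = A.det * B.det :=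
  LinearMap.det_comp _ _

/-- A family of local maps, smooth in time, which is compatible with the local flow of `X`,
preserves `P`, and preserves the density `c` along `P = 0`. -/
structure LocalFamily where
  dom : Set (ℝ × M)
  isOpen_dom : IsOpen dom
  map : ℝ × M → M
  smooth : ContMDiffOn (𝓘(ℝ, ℝ).prod I) I 1 map dom
  hasMFDerivAt_time : ∀ p ∈ dom, HasMFDerivAt 𝓘(ℝ, ℝ) I (fun r => map (r, p.2)) p.1
      ((1 : ℝ →L[ℝ] ℝ).smulRight (X (map p)))
  mfderiv_apply : ∀ p ∈ dom, endDeriv I (fun y => map (p.1, y)) p.2 (X p.2) = X (map p)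
  conserve : ∀ p ∈ dom, P (map p) = P p.2
  weight : ∀ p ∈ dom, P p.2 = 0 →
    c (map p) * (endDeriv I (fun y => map (p.1, y)) p.2).det = c p.2

/-- The derivative of `x ↦ φ (s - τ x) (Z x)` is that of the flow `φ` composed with this map. -/
def delayedDeriv (τ : M → ℝ) (Z : M → M) (x : M) : E →L[ℝ] E :=
  endDeriv I Z x - (scalarDeriv I τ x).smulRight (X (Z x))

/-- A local map `jump`, reached after the time `delay`, by which local families can be
precomposed. -/
structure DelayedMap where
  dom : Set M
  isOpen_dom : IsOpen dom
  delay : M → ℝ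
  jump : M → M
  smooth_delay : ContMDiffOn I 𝓘(ℝ, ℝ) 1 delay dom
  smooth_jump : ContMDiffOn I I 1 jump dom
  deriv_apply : ∀ x ∈ dom, delayedDeriv I X delay jump x (X x) = X (jump x)
  conserve : ∀ x ∈ dom, P (jump x) = P x
  weight : ∀ x ∈ dom, P x = 0 → c (jump x) * (delayedDeriv I X delay jump x).det = c x

variable {I X P c}

theorem LocalFamily.mdifferentiableAt (G : LocalFamily I X P c) {p : ℝ × M} (hp : p ∈ G.dom) :
    MDifferentiableAt (𝓘(ℝ, ℝ).prod I) I G.map p :=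
  (G.smooth.contMDiffAt (G.isOpen_dom.mem_nhds hp)).mdifferentiableAt one_ne_zero

/-- The delay contributes `-dτ ⊗ X` at the end point. As the family carries `X` to `X`, this is the
image of `-dτ ⊗ X` at the jump, and the derivative factors through `delayedDeriv`. This is why
determinants multiply under precomposition. -/
theorem LocalFamily.mfderiv_comp_delayedMap (G : LocalFamily I X P c) (S : DelayedMap I X P c)
    {s : ℝ} {x : M} (hx : x ∈ S.dom) (hp : (s - S.delay x, S.jump x) ∈ G.dom) :
    HasMFDerivAt I I (fun y => G.map (s - S.delay y, S.jump y)) x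
      (endDeriv I (fun y => G.map (s - S.delay x, y)) (S.jump x) ∘L
        delayedDeriv I X S.delay S.jump x : E →L[ℝ] E) := by
  have hτ := (S.smooth_delay.contMDiffAt (S.isOpen_dom.mem_nhds hx)).mdifferentiableAt one_ne_zero
  have hZ := (S.smooth_jump.contMDiffAt (S.isOpen_dom.mem_nhds hx)).mdifferentiableAt one_ne_zero
  have ha : HasMFDerivAt I 𝓘(ℝ, ℝ) (fun y => s - S.delay y) x (-scalarDeriv I S.delay x) :=
    ((hasMFDerivAt_const s x).sub hτ.hasMFDerivAt).congr_mfderiv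
      (zero_sub (scalarDeriv I S.delay x))
  have h1 := hasMFDerivAt_comp_time (X := X) (Φ := G.map) (a := fun y => s - S.delay y)
    (G.mdifferentiableAt hp) (G.hasMFDerivAt_time _ hp) ha.mdifferentiableAt hZ
  refine h1.congr_mfderiv (ContinuousLinearMap.ext fun (v : E) => ?_)
  have h2 : scalarDeriv I (fun y => s - S.delay y) x = -scalarDeriv I S.delay x := ha.mfderiv
  set A : E →L[ℝ] E := endDeriv I (fun y => G.map (s - S.delay x, y)) (S.jump x) with hA
  have h3 : A (X (S.jump x)) = X (G.map (s - S.delay x, S.jump x)) :=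
    G.mfderiv_apply _ hp
  change A (endDeriv I S.jump x v) + scalarDeriv I (fun y => s - S.delay y) x v •
      X (G.map (s - S.delay x, S.jump x)) =
    A (endDeriv I S.jump x v - scalarDeriv I S.delay x v • X (S.jump x))
  have h4 : A (scalarDeriv I S.delay x v • X (S.jump x)) =
      scalarDeriv I S.delay x v • X (G.map (s - S.delay x, S.jump x)) :=
    (map_smul A _ _).trans (congrArg _ h3)
  rw [h2, map_sub, h4]
  exact (congrArg _ (neg_smul _ _)).trans (sub_eq_add_neg _ _).symm

/-- Precomposition of a local family by a delayed map. -/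
def LocalFamily.precomp (G : LocalFamily I X P c) (S : DelayedMap I X P c) : LocalFamily I X P c where
  dom := (univ ×ˢ S.dom) ∩ (fun p : ℝ × M => (p.1 - S.delay p.2, S.jump p.2)) ⁻¹' G.dom
  isOpen_dom := by
    refine ContinuousOn.isOpen_inter_preimage ?_ (isOpen_univ.prod S.isOpen_dom) G.isOpen_dom
    have h1 : MapsTo Prod.snd (univ ×ˢ S.dom : Set (ℝ × M)) S.dom := fun p hp => hp.2
    exact (continuousOn_fst.sub (S.smooth_delay.continuousOn.comp continuousOn_snd h1)).prodMk
      (S.smooth_jump.continuousOn.comp continuousOn_snd h1)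
  map := fun p => G.map (p.1 - S.delay p.2, S.jump p.2)
  smooth := by
    have h1 : MapsTo Prod.snd ((univ ×ˢ S.dom) ∩
      (fun p : ℝ × M => (p.1 - S.delay p.2, S.jump p.2)) ⁻¹' G.dom) S.dom := fun p hp => hp.1.2
    refine G.smooth.comp (f := fun p : ℝ × M => (p.1 - S.delay p.2, S.jump p.2)) ?_
      fun p hp => hp.2
    exact (contMDiffOn_fst.sub (S.smooth_delay.comp contMDiffOn_snd h1)).prodMk
      (S.smooth_jump.comp contMDiffOn_snd h1)
  hasMFDerivAt_time := by
    rintro ⟨s, x⟩ hp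
    have h1 := G.hasMFDerivAt_time _ hp.2
    have h2 : HasMFDerivAt 𝓘(ℝ, ℝ) 𝓘(ℝ, ℝ) (fun r : ℝ => r - S.delay x) s
        (ContinuousLinearMap.id ℝ ℝ) := ((hasFDerivAt_id s).sub_const _).hasMFDerivAt
    exact HasMFDerivAt.comp (g := fun r => G.map (r, S.jump x)) s h1 h2
  mfderiv_apply := by
    rintro ⟨s, x⟩ hp
    refine (DFunLike.congr_fun (G.mfderiv_comp_delayedMap S hp.1.2 hp.2).mfderiv (X x)).trans ?_
    exact (congrArg (endDeriv I (fun y => G.map (s - S.delay x, y)) (S.jump x))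
      (S.deriv_apply x hp.1.2)).trans (G.mfderiv_apply _ hp.2)
  conserve := fun p hp => (G.conserve _ hp.2).trans (S.conserve _ hp.1.2)
  weight := by
    rintro ⟨s, x⟩ hp hN
    have h1 : endDeriv I (fun y => G.map (s - S.delay y, S.jump y)) x = _ :=
      (G.mfderiv_comp_delayedMap S hp.1.2 hp.2).mfderiv
    have h2 := G.weight _ hp.2 ((S.conserve x hp.1.2).trans hN)
    have h3 := S.weight x hp.1.2 hN
    simp only at h2 h3 ⊢
    rw [h1, det_comp, ← h3, ← h2]
    exact (mul_assoc _ _ _).symm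

end LocalFamily

/-! ### Saltation at a transversal impact -/

section Impact

open Set Filter Topology

variable {E H : Type*} [NormedAddCommGroup E] [NormedSpace ℝ E] [TopologicalSpace H]
  {I : ModelWithCorners ℝ E H} {M : Type*} [TopologicalSpace M] [ChartedSpace H M]
  {F : Type*} [Zero F] {X : M → E} {P : M → F} {c : M → ℝ}

theorem FlowBox.hasDerivAt_comp (B : FlowBox I X) {f : M → ℝ} {s : ℝ}
    (hs : s ∈ Ioo (-B.time) B.time) {x : M} (hx : x ∈ B.dom)
    (hf : MDifferentiableAt I 𝓘(ℝ, ℝ) f (B.flow (s, x))) :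
    HasDerivAt (fun r => f (B.flow (r, x)))
      (scalarDeriv I f (B.flow (s, x)) (X (B.flow (s, x)))) s := by
  have h1 := hf.hasMFDerivAt.comp s (B.hasMFDerivAt_time s hs x hx)
  refine hasDerivAt_iff_hasFDerivAt.2 (h1.hasFDerivAt.congr_fderiv ?_)
  refine ContinuousLinearMap.ext fun (a : ℝ) => ?_
  exact map_smul (scalarDeriv I f (B.flow (s, x))) a (X (B.flow (s, x)))

theorem FlowBox.conserve_of_scalarDeriv_eq_zero (B : FlowBox I X) {f : M → ℝ}
    (hf : ContMDiff I 𝓘(ℝ, ℝ) ∞ f) (hX : ∀ x, scalarDeriv I f x (X x) = 0) {s : ℝ}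
    (hs : s ∈ Ioo (-B.time) B.time) {x : M} (hx : x ∈ B.dom) : f (B.flow (s, x)) = f x := by
  have hd : ∀ r ∈ Ioo (-B.time) B.time, HasDerivAt (fun r => f (B.flow (r, x))) 0 r :=
    fun r hr => hX (B.flow (r, x)) ▸
      B.hasDerivAt_comp hr hx (hf.contMDiffAt.mdifferentiableAt (by simp))
  have h0 : (0 : ℝ) ∈ Ioo (-B.time) B.time := ⟨neg_lt_zero.2 B.time_pos, B.time_pos⟩
  have h1 := isOpen_Ioo.is_const_of_deriv_eq_zero (s := Ioo (-B.time) B.time)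
    (f := fun r => f (B.flow (r, x))) isPreconnected_Ioo
    (fun r hr => (hd r hr).differentiableAt.differentiableWithinAt) (fun r hr => (hd r hr).deriv)
    hs h0
  exact h1.trans (congrArg f (B.flow_zero x hx))

/-- The local flow preserves `P`, and the density `c` along `P = 0`. -/
structure FlowBox.Preserves (B : FlowBox I X) (P : M → F) (c : M → ℝ) : Prop where
  conserve : ∀ s ∈ Ioo (-B.time) B.time, ∀ x ∈ B.dom, P (B.flow (s, x)) = P x
  weight : ∀ s ∈ Ioo (-B.time) B.time, ∀ x ∈ B.dom, P x = 0 →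
    c (B.flow (s, x)) * (endDeriv I (fun y => B.flow (s, y)) x).det = c x

theorem FlowBox.contMDiffAt (B : FlowBox I X) {s : ℝ} (hs : s ∈ Ioo (-B.time) B.time)
    {x : M} (hx : x ∈ B.dom) : ContMDiffAt (𝓘(ℝ, ℝ).prod I) I ∞ B.flow (s, x) :=
  B.smooth.contMDiffAt ((isOpen_Ioo.prod B.isOpen_dom).mem_nhds ⟨hs, hx⟩)

/-- A flow box, as a local family. -/
def FlowBox.toLocalFamily (B : FlowBox I X) (hB : B.Preserves P c) :
    LocalFamily I X P c where
  dom := Ioo (-B.time) B.time ×ˢ B.dom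
  isOpen_dom := isOpen_Ioo.prod B.isOpen_dom
  map := B.flow
  smooth := B.smooth.of_le (by exact_mod_cast le_top)
  hasMFDerivAt_time := fun p hp => B.hasMFDerivAt_time p.1 hp.1 p.2 hp.2
  mfderiv_apply := fun p hp => B.mfderiv_apply p.1 hp.1 p.2 hp.2
  conserve := fun p hp => hB.conserve p.1 hp.1 p.2 hp.2
  weight := fun p hp => hB.weight p.1 hp.1 p.2 hp.2

/-- The flow for a fixed time, as a delayed map. -/
def FlowBox.toDelayedMap (B : FlowBox I X) (hB : B.Preserves P c) (s : ℝ)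
    (hs : s ∈ Ioo (-B.time) B.time) : DelayedMap I X P c where
  dom := B.dom
  isOpen_dom := B.isOpen_dom
  delay := fun _ => s
  jump := fun x => B.flow (s, x)
  smooth_delay := contMDiffOn_const
  smooth_jump := fun x hx => ((B.contMDiffAt hs hx).comp x
    (contMDiffAt_const.prodMk contMDiffAt_id)).of_le (by exact_mod_cast le_top)
      |>.contMDiffWithinAt
  deriv_apply := fun x hx => by
    have h1 : scalarDeriv I (fun _ : M => s) x = 0 := mfderiv_const
    have h2 : endDeriv I (fun y => B.flow (s, y)) x (X x) = X (B.flow (s, x)) :=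
      B.mfderiv_apply s hs x hx
    simp [delayedDeriv, h1, h2]
  conserve := fun x hx => hB.conserve s hs x hx
  weight := fun x hx hN => by
    have h1 : scalarDeriv I (fun _ : M => s) x = 0 := mfderiv_const
    have h2 : delayedDeriv I X (fun _ => s) (fun y => B.flow (s, y)) x =
        endDeriv I (fun y => B.flow (s, y)) x := by
      ext v
      simp [delayedDeriv, h1]
    rw [h2]
    exact hB.weight s hs x hx hN

variable (I X) in
/-- The differential at an impact point of a flow which is interrupted by the reset map `Δ` when it
crosses `h = 0`. -/
def saltation (h : M → ℝ) (Δ : M → M) (w : M) : E →L[ℝ] E :=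
  endDeriv I Δ w + (scalarDeriv I h w).smulRight
    ((scalarDeriv I h w (X w))⁻¹ • (X (Δ w) - endDeriv I Δ w (X w)))

variable (I X P c) in
/-- An impact surface `h = 0`, together with a reset map that preserves `P` and the density. -/
structure ImpactData where
  dom : Set M
  isOpen_dom : IsOpen dom
  surface : M → ℝ
  reset : M → M
  smooth_surface : ContMDiff I 𝓘(ℝ, ℝ) ∞ surface
  smooth_reset : ContMDiffOn I I ∞ reset dom
  continuous_speed : Continuous fun w => scalarDeriv I surface w (X w)
  conserve : ∀ w ∈ dom, P (reset w) = P w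
  weight : ∀ w ∈ dom, surface w = 0 → scalarDeriv I surface w (X w) ≠ 0 →
    c (reset w) * (saltation I X surface reset w).det = c w

theorem saltation_apply {h : M → ℝ} {Δ : M → M} {w : M} (hw : scalarDeriv I h w (X w) ≠ 0) :
    saltation I X h Δ w (X w) = X (Δ w) := by
  simp [saltation, smul_smul, mul_inv_cancel₀ hw]

-- Let `A` be the derivative of the flow at the fixed time `τ y`. Differentiating `surface (flow (τ
-- x, x)) = 0` gives `dτ = -(dh ∘ A) / dh(X)`, where `h` is the surface function. Inserted both in
-- the chain rule for the reset and in the delay correction, this leaves the saltation operator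
-- composed with `A`.
omit [Zero F] in
theorem delayedDeriv_impact (D : ImpactData I X P c) (B : FlowBox I X) {τ : M → ℝ} {y : M}
    (hy : y ∈ B.dom) (hτ : ContMDiffAt I 𝓘(ℝ, ℝ) 1 τ y)
    (hτy : τ y ∈ Ioo (-B.time) B.time) (hw : B.flow (τ y, y) ∈ D.dom)
    (hspeed : scalarDeriv I D.surface (B.flow (τ y, y)) (X (B.flow (τ y, y))) ≠ 0)
    (hzero : ∀ᶠ x in 𝓝 y, D.surface (B.flow (τ x, x)) = 0) :
    ContMDiffAt I I 1 (fun x => D.reset (B.flow (τ x, x))) y ∧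
    delayedDeriv I X τ (fun x => D.reset (B.flow (τ x, x))) y =
      saltation I X D.surface D.reset (B.flow (τ y, y)) ∘L
        endDeriv I (fun x => B.flow (τ y, x)) y := by
  set w := B.flow (τ y, y) with hw_def
  have hone : (1 : WithTop ℕ∞) ≤ ∞ := by exact_mod_cast le_top
  have hflow : ContMDiffAt I I 1 (fun x => B.flow (τ x, x)) y :=
    ((B.contMDiffAt hτy hy).of_le hone).comp (f := fun x => (τ x, x)) y (hτ.prodMk contMDiffAt_id)
  have hreset : ContMDiffAt I I 1 D.reset w :=
    (D.smooth_reset.contMDiffAt (D.isOpen_dom.mem_nhds hw)).of_le hone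
  refine ⟨hreset.comp (f := fun x => B.flow (τ x, x)) y hflow, ?_⟩
  have h1 := hasMFDerivAt_comp_time (I := I) (X := X) (Φ := B.flow) (a := τ) (Z := id) (x := y)
    ((B.contMDiffAt hτy hy).mdifferentiableAt (by simp)) (B.hasMFDerivAt_time _ hτy _ hy)
    (hτ.mdifferentiableAt one_ne_zero) mdifferentiableAt_id
  set A : E →L[ℝ] E := endDeriv I (fun x => B.flow (τ y, x)) y with hA
  have hid : endDeriv I (id : M → M) y = ContinuousLinearMap.id ℝ E := mfderiv_id
  have h2 : endDeriv I (fun x => B.flow (τ x, x)) y =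
      A + (scalarDeriv I τ y).smulRight (X w) := by
    refine Eq.trans (b := A ∘L endDeriv I (id : M → M) y + (scalarDeriv I τ y).smulRight (X w))
      h1.mfderiv ?_
    rw [hid, ContinuousLinearMap.comp_id]
  have h3 : endDeriv I (fun x => D.reset (B.flow (τ x, x))) y = endDeriv I D.reset w ∘L
      endDeriv I (fun x => B.flow (τ x, x)) y :=
    mfderiv_comp y (hreset.mdifferentiableAt one_ne_zero) (hflow.mdifferentiableAt one_ne_zero)
  have h4 : scalarDeriv I D.surface w ∘L endDeriv I (fun x => B.flow (τ x, x)) y = 0 := by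
    have h5 : scalarDeriv I (fun x => D.surface (B.flow (τ x, x))) y =
      scalarDeriv I D.surface w ∘L endDeriv I (fun x => B.flow (τ x, x)) y :=
      mfderiv_comp y (D.smooth_surface.contMDiffAt.mdifferentiableAt (by simp))
        (hflow.mdifferentiableAt one_ne_zero)
    rw [← h5]
    have h6 : (fun x => D.surface (B.flow (τ x, x))) =ᶠ[𝓝 y] fun _ => 0 := hzero
    exact h6.mfderiv_eq.trans mfderiv_const
  ext v
  have h7 := DFunLike.congr_fun h4 v
  simp only [h2, ContinuousLinearMap.comp_apply, add_apply,
    ContinuousLinearMap.smulRight_apply, map_add, map_smul, smul_eq_mul,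
    zero_apply] at h7
  have h8 : scalarDeriv I D.surface w (A v) * (scalarDeriv I D.surface w (X w))⁻¹ =
      -scalarDeriv I τ y v := by
    field_simp
    linarith
  simp only [delayedDeriv, h3, h2, saltation, sub_apply,
    ContinuousLinearMap.comp_apply, add_apply,
    ContinuousLinearMap.smulRight_apply, map_add, map_smul, smul_smul, h8]
  rw [neg_smul, smul_sub, hw_def]
  abel

/-- Transversality is the nonvanishing time derivative that the implicit function theorem needs to
define the time of impact near `w₀`. Its uniqueness part, with `δ` uniform over the domain,
identifies that time with the time at which an actual trajectory meets the surface. -/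
theorem exists_delayedMap_of_impact [CompleteSpace E] [IsManifold I ∞ M] [I.Boundaryless]
    (D : ImpactData I X P c) (B : FlowBox I X) (hB : B.Preserves P c) {w₀ : M}
    (hw₀ : w₀ ∈ B.dom) (hD : w₀ ∈ D.dom) (h0 : D.surface w₀ = 0)
    (hspeed : scalarDeriv I D.surface w₀ (X w₀) ≠ 0) :
    ∃ (S : DelayedMap I X P c) (δ : ℝ), 0 < δ ∧ w₀ ∈ S.dom ∧ S.dom ⊆ B.dom ∧ ∀ x ∈ S.dom, ∀ s, |s| < δ →
      D.surface (B.flow (s, x)) = 0 →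
      S.delay x = s ∧ S.jump x = D.reset (B.flow (s, x)) := by
  have := isManifold_one_of_infty (I := I) (M := M)
  have hone : (1 : WithTop ℕ∞) ≤ ∞ := by exact_mod_cast le_top
  set e := extChartAt I w₀ with he
  have hz : (0 : ℝ) ∈ Ioo (-B.time) B.time := ⟨neg_lt_zero.2 B.time_pos, B.time_pos⟩
  have hew : e.symm (e w₀) = w₀ := extChartAt_to_inv w₀
  set u : E × ℝ → ℝ := fun p => D.surface (B.flow (p.2, e.symm p.1)) with hu
  have hsymm : ContMDiffAt 𝓘(ℝ, E) I 1 e.symm (e w₀) :=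
    (contMDiffOn_extChartAt_symm (n := 1) w₀).contMDiffAt
      ((isOpen_extChartAt_target w₀).mem_nhds (mem_extChartAt_target w₀))
  have hBflow : ContMDiffAt (𝓘(ℝ, ℝ).prod I) I 1 B.flow (0, e.symm (e w₀)) := by
    rw [hew]; exact (B.contMDiffAt hz hw₀).of_le hone
  have hcd : ContDiffAt ℝ 1 u (e w₀, 0) := by
    rw [← contMDiffAt_iff_contDiffAt]
    have h1 : ContMDiffAt 𝓘(ℝ, E × ℝ) (𝓘(ℝ, ℝ).prod I) 1 (fun p : E × ℝ => (p.2, e.symm p.1))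
        (e w₀, 0) :=
      (contDiffAt_snd.contMDiffAt).prodMk
        (hsymm.comp (e w₀, (0 : ℝ)) (contDiffAt_fst.contMDiffAt))
    exact ((D.smooth_surface.contMDiffAt).of_le hone).comp (e w₀, (0 : ℝ))
      (hBflow.comp (e w₀, (0 : ℝ)) h1)
  have hinr : fderiv ℝ u (e w₀, 0) ∘L ContinuousLinearMap.inr ℝ E ℝ =
      ((ContinuousLinearEquiv.unitsEquivAut ℝ (Units.mk0 _ hspeed) : ℝ ≃L[ℝ] ℝ) : ℝ →L[ℝ] ℝ) := by
    have h1 : HasFDerivAt (fun s : ℝ => u (e w₀, s))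
        (fderiv ℝ u (e w₀, 0) ∘L ContinuousLinearMap.inr ℝ E ℝ) 0 :=
      (hcd.differentiableAt one_ne_zero).hasFDerivAt.comp (0 : ℝ) (hasFDerivAt_prodMk_right (e w₀) 0)
    have h2 := B.hasDerivAt_comp hz hw₀ (f := D.surface)
      (D.smooth_surface.contMDiffAt.mdifferentiableAt (by simp))
    rw [B.flow_zero w₀ hw₀] at h2
    have h5 : (fun s : ℝ => u (e w₀, s)) = fun s : ℝ => D.surface (B.flow (s, w₀)) := by
      funext s
      simp only [hu, hew]
    rw [h5] at h1
    rw [h1.unique h2]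
    ext
    simp
  have hinv : (fderiv ℝ u (e w₀, 0) ∘L ContinuousLinearMap.inr ℝ E ℝ).IsInvertible := ⟨_, hinr.symm⟩
  set ψ := hcd.implicitFunction one_ne_zero hinv with hψ
  have hψ0 : ψ (e w₀) = 0 := hcd.implicitFunction_apply_self one_ne_zero hinv
  have hψd : ContDiffAt ℝ 1 ψ (e w₀) := hcd.contDiffAt_implicitFunction one_ne_zero hinv
  have hu0 : u (e w₀, 0) = 0 := by simp only [hu, hew, B.flow_zero w₀ hw₀, h0]
  have hψz : ∀ᶠ z in 𝓝 (e w₀), u (z, ψ z) = 0 := by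
    have := hcd.eventually_apply_implicitFunction one_ne_zero hinv
    rwa [hu0] at this
  have hψu : ∀ᶠ p in 𝓝 (e w₀, (0 : ℝ)), u p = 0 ↔ ψ p.1 = p.2 := by
    have := hcd.eventually_apply_eq_iff_implicitFunction one_ne_zero hinv
    rwa [hu0] at this
  have hec : ContinuousAt e w₀ := continuousAt_extChartAt w₀
  have hsrc : ∀ᶠ y in 𝓝 w₀, y ∈ e.source := extChartAt_source_mem_nhds w₀
  set τ : M → ℝ := fun y => ψ (e y) with hτ
  have hτc : ContMDiffAt I 𝓘(ℝ, ℝ) 1 τ w₀ :=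
    hψd.contMDiffAt.comp w₀ (contMDiffAt_extChartAt)
  have hτ0 : τ w₀ = 0 := hψ0
  have hτB : ∀ᶠ y in 𝓝 w₀, τ y ∈ Ioo (-B.time) B.time :=
    hτc.continuousAt.eventually (by rw [hτ0]; exact isOpen_Ioo.mem_nhds hz)
  have hwc : ContinuousAt (fun y => B.flow (τ y, y)) w₀ := by
    refine ContinuousAt.comp (g := B.flow) (f := fun y => (τ y, y)) ?_
      (hτc.continuousAt.prodMk continuousAt_id)
    rw [hτ0]
    exact (B.contMDiffAt hz hw₀).continuousAt
  have hww : B.flow (τ w₀, w₀) = w₀ := by rw [hτ0, B.flow_zero w₀ hw₀]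
  have hwn : ∀ O : Set M, IsOpen O → w₀ ∈ O → ∀ᶠ y in 𝓝 w₀, B.flow (τ y, y) ∈ O := fun O hO hwO =>
    hwc.preimage_mem_nhds (hO.mem_nhds (show B.flow (τ w₀, w₀) ∈ O by rwa [hww]))
  have hdom := hwn D.dom D.isOpen_dom hD
  have hsp := hwn {w | scalarDeriv I D.surface w (X w) ≠ 0}
    (isOpen_ne_fun D.continuous_speed continuous_const) hspeed
  have hzero : ∀ᶠ y in 𝓝 w₀, D.surface (B.flow (τ y, y)) = 0 := by
    filter_upwards [hec.eventually hψz, hsrc] with y hy hys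
    simp only [hu, e.left_inv hys] at hy
    exact hy
  obtain ⟨t, ht, htp⟩ : ∃ t ∈ 𝓝 (e w₀), ∃ δ > 0, ∀ z ∈ t, ∀ s : ℝ, |s| < δ →
      (u (z, s) = 0 ↔ ψ z = s) := by
    obtain ⟨t, ht, t', ht', hsub⟩ := mem_nhds_prod_iff.1 hψu
    obtain ⟨δ, hδ, hδt⟩ := Metric.mem_nhds_iff.1 ht'
    exact ⟨t, ht, δ, hδ, fun z hz s hs => hsub (mk_mem_prod hz (hδt (by simpa using hs)))⟩
  obtain ⟨δ, hδ, hloc⟩ := htp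
  have hBd : ∀ᶠ y in 𝓝 w₀, y ∈ B.dom := B.isOpen_dom.mem_nhds hw₀
  -- Differentiability of finite order at a point spreads to a neighbourhood, which is why order one
  -- is used here instead of `∞`.
  have hτn : ∀ᶠ y in 𝓝 w₀, ContMDiffAt I 𝓘(ℝ, ℝ) 1 τ y :=
    (contMDiffAt_iff_contMDiffAt_nhds (by simp)).1 hτc
  obtain ⟨V, hV, hVo, hwV⟩ := eventually_nhds_iff.1 (hBd.and (hsrc.and (hτn.and (hτB.and (hdom.and
      (hsp.and (hzero.and (hec.eventually ht))))))))
  have key := fun y (hy : y ∈ V) => delayedDeriv_impact D B (hV y hy).1 (hV y hy).2.2.1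
    (hV y hy).2.2.2.1 (hV y hy).2.2.2.2.1 (hV y hy).2.2.2.2.2.1
    (by filter_upwards [hVo.mem_nhds hy] with x hx using (hV x hx).2.2.2.2.2.2.1)
  refine ⟨{ dom := V
            isOpen_dom := hVo
            delay := τ
            jump := fun y => D.reset (B.flow (τ y, y))
            smooth_delay := fun y hy => (hV y hy).2.2.1.contMDiffWithinAt
            smooth_jump := fun y hy => (key y hy).1.contMDiffWithinAt
            deriv_apply := fun y hy => ?_
            conserve := fun y hy => ?_
            weight := fun y hy hN => ?_ }, δ, hδ, hwV,
    fun y hy => (hV y hy).1, fun x hx s hs hzs => ?_⟩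
  · obtain ⟨h1, h2, h3, h4, h5, h6, h7, h8⟩ := hV y hy
    rw [(key y hy).2, ContinuousLinearMap.comp_apply]
    have h9 : endDeriv I (fun x => B.flow (τ y, x)) y (X y) = X (B.flow (τ y, y)) :=
      B.mfderiv_apply _ h4 y h1
    rw [h9, saltation_apply h6]
  · obtain ⟨h1, h2, h3, h4, h5, h6, h7, h8⟩ := hV y hy
    rw [D.conserve _ h5, hB.conserve _ h4 y h1]
  · obtain ⟨h1, h2, h3, h4, h5, h6, h7, h8⟩ := hV y hy
    rw [(key y hy).2, det_comp, ← mul_assoc, D.weight _ h5 h7 h6, hB.weight _ h4 y h1 hN]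
  · obtain ⟨h1, h2, h3, h4, h5, h6, h7, h8⟩ := hV x hx
    have h9 : τ x = s := (hloc (e x) h8 s hs).1 (by simpa only [hu, e.left_inv h2] using hzs)
    exact ⟨h9, by simp only [h9]⟩

end Impact

/-! ### Hybrid trajectories from countably many local families -/

section Cover

universe u

open Set Filter Topology

variable {E H : Type*} [NormedAddCommGroup E] [NormedSpace ℝ E] [TopologicalSpace H]
  {I : ModelWithCorners ℝ E H} {M : Type u} [TopologicalSpace M] [ChartedSpace H M]
  {F : Type*} [Zero F] {X : M → E} {P : M → F} {c : M → ℝ}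

section Reaches

variable {J K : Type*} (S : J → DelayedMap I X P c) (G : K → LocalFamily I X P c)

/-- The local families obtained from those of `G` by finitely many precompositions. -/
def iteratedFamily (i : List J × K) : LocalFamily I X P c :=
  i.1.foldr (fun j G' => G'.precomp (S j)) (G i.2)

/-- Some iterated family maps `(t, x)` to `y`. -/
def Reaches (t : ℝ) (x y : M) : Prop :=
  ∃ i, (t, x) ∈ (iteratedFamily S G i).dom ∧ (iteratedFamily S G i).map (t, x) = y

variable {S G}

theorem Reaches.prepend (j : J) {t : ℝ} {x y : M} (hx : x ∈ (S j).dom)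
    (h : Reaches S G (t - (S j).delay x) ((S j).jump x) y) : Reaches S G t x y := by
  obtain ⟨⟨l, k⟩, h1, h2⟩ := h
  exact ⟨(j :: l, k), ⟨⟨mem_univ _, hx⟩, h1⟩, h2⟩

theorem Reaches.of_family (k : K) {t : ℝ} {x : M} (hx : (t, x) ∈ (G k).dom) :
    Reaches S G t x ((G k).map (t, x)) :=
  ⟨([], k), hx, rfl⟩

end Reaches

/-- A Lebesgue number for the cover of the time interval by preimages of flow boxes. Both ends of a
short arc lie within `δ` of a centre, hence the requirement `2 * δ < time`. -/
theorem exists_pos_maps_to_dom {K : Type*} (B : K → FlowBox I X) (hcov : ∀ x, ∃ k, x ∈ (B k).dom)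
    {γ : ℝ → M} {a b : ℝ} (hγ : ContinuousOn γ (Icc a b)) :
    ∃ ε > 0, ∀ r s, a ≤ r → r ≤ s → s ≤ b → s - r < ε →
      ∃ k, s - r < (B k).time ∧ ∀ u ∈ Icc r s, γ u ∈ (B k).dom := by
  have h1 : ∀ s : Icc a b, ∃ k, ∃ δ > 0, 2 * δ < (B k).time ∧
      ∀ u ∈ Icc a b, dist u s < δ → γ u ∈ (B k).dom := by
    intro s
    obtain ⟨k, hk⟩ := hcov (γ s)
    obtain ⟨δ, hδ, hsub⟩ := Metric.mem_nhdsWithin_iff.1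
      (hγ s s.2 ((B k).isOpen_dom.mem_nhds hk))
    have ht := (B k).time_pos
    refine ⟨k, min δ ((B k).time / 4), by positivity, ?_, fun u hu hus => ?_⟩
    · linarith [min_le_right δ ((B k).time / 4)]
    · exact hsub ⟨hus.trans_le (min_le_left _ _), hu⟩
  choose k δ hδ hδt hδd using h1
  obtain ⟨ε, hε, hleb⟩ := lebesgue_number_lemma_of_metric (s := Icc a b)
    (c := fun s : Icc a b => Metric.ball (s : ℝ) (δ s)) isCompact_Icc (fun s => Metric.isOpen_ball)
    (fun s hs => mem_iUnion.2 ⟨⟨s, hs⟩, Metric.mem_ball_self (hδ _)⟩)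
  refine ⟨ε, hε, fun r s har hrs hsb hd => ?_⟩
  obtain ⟨i, hi⟩ := hleb r ⟨har, hrs.trans hsb⟩
  have hball : ∀ u ∈ Icc r s, dist u i < δ i := fun u hu => hi (by
    rw [Metric.mem_ball, Real.dist_eq, abs_of_nonneg (by linarith [hu.1])]
    linarith [hu.2])
  refine ⟨k i, ?_, fun u hu => hδd i u ⟨har.trans hu.1, hu.2.trans hsb⟩ (hball u hu)⟩
  have h2 := hball r (left_mem_Icc.2 hrs)
  have h3 := hball s (right_mem_Icc.2 hrs)
  rw [Real.dist_eq, abs_lt] at h2 h3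
  linarith [hδt i, h2.1, h3.2]

/-- A countable supply of local families, which is sufficient to describe a hybrid flow. -/
theorem exists_countable_families [CompleteSpace E] [IsManifold I ∞ M] [I.Boundaryless]
    [SecondCountableTopology M] (𝓗 : HybridSystem I M) (D : ImpactData I X P c)
    (hfield : ∀ x ∈ 𝓗.space, (𝓗.field x : E) = X x)
    (hbox : ∀ x, ∃ B : FlowBox I X, x ∈ B.dom ∧ B.Preserves P c)
    (himpact : ∀ w ∈ 𝓗.impact, w ∈ D.dom ∧ D.surface w = 0 ∧
      scalarDeriv I D.surface w (X w) ≠ 0 ∧ 𝓗.reset w = D.reset w) :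
    ∃ (ι : Type u) (_ : Countable ι) (G : ι → LocalFamily I X P c), ∀ t x y, 𝓗.Flow t x y →
      ∃ i, (t, x) ∈ (G i).dom ∧ (G i).map (t, x) = y := by
  choose B₀ hB₀ hB₀p using hbox
  obtain ⟨sK, hsK, hsKu⟩ := TopologicalSpace.countable_cover_nhds
    (fun x => (B₀ x).isOpen_dom.mem_nhds (hB₀ x))
  have : Countable sK := hsK.to_subtype
  let B : sK → FlowBox I X := fun k => B₀ k
  have hBp : ∀ k, (B k).Preserves P c := fun k => hB₀p k
  have hcov : ∀ x, ∃ k, x ∈ (B k).dom := fun x => by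
    obtain ⟨k, hk, hx⟩ := mem_iUnion₂.1 (hsKu ▸ mem_univ x : x ∈ ⋃ k ∈ sK, (B₀ k).dom)
    exact ⟨⟨k, hk⟩, hx⟩
  have himp : ∀ w : 𝓗.impact, ∃ (k : sK) (S : DelayedMap I X P c) (δ : ℝ), 0 < δ ∧ (w : M) ∈ S.dom ∧
      S.dom ⊆ (B k).dom ∧ ∀ x ∈ S.dom, ∀ s, |s| < δ →
      D.surface ((B k).flow (s, x)) = 0 →
      S.delay x = s ∧ S.jump x = D.reset ((B k).flow (s, x)) := fun w => by
    obtain ⟨k, hk⟩ := hcov w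
    obtain ⟨h1, h2, h3, -⟩ := himpact w w.2
    exact ⟨k, exists_delayedMap_of_impact D (B k) (hBp k) hk h1 h2 h3⟩
  choose kS S₀ δS hδS hwS hSB hS using himp
  obtain ⟨sJ, hsJ, hsJu⟩ := TopologicalSpace.countable_cover_nhds (α := 𝓗.impact)
    (f := fun w => Subtype.val ⁻¹' (S₀ w).dom)
    (fun w => continuous_subtype_val.continuousAt.preimage_mem_nhds
      ((S₀ w).isOpen_dom.mem_nhds (hwS w)))
  have : Countable sJ := hsJ.to_subtype
  -- Only rational times are used, to keep the index set countable. An irrational remainder is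
  -- absorbed by the free time of the final family or by the delay of an impact map.
  let J := (Σ k : sK, {q : ℚ // (q : ℝ) ∈ Ioo (-(B k).time) (B k).time}) ⊕ sJ
  let S : J → DelayedMap I X P c := Sum.elim
    (fun kq => (B kq.1).toDelayedMap (hBp kq.1) kq.2 kq.2.2) fun w => S₀ w
  let G : sK → LocalFamily I X P c := fun k => (B k).toLocalFamily (hBp k)
  refine ⟨List J × sK, inferInstance, iteratedFamily S G, ?_⟩
  -- The time `q` is cut into `N` equal steps, which are again rational and so short that each stays
  -- in one flow box.
  have rational : ∀ (γ : ℝ → M) (a : ℝ) (q : ℚ) (t : ℝ) (y : M), 0 ≤ q →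
      IsMIntegralCurveOn (I := I) γ X (Icc a (a + q)) →
      Reaches S G (t - q) (γ (a + q)) y → Reaches S G t (γ a) y := by
    intro γ a q t y hq hγ hR
    obtain ⟨ε, hε, hsub⟩ := exists_pos_maps_to_dom B hcov hγ.continuousOn
    obtain ⟨N, hN⟩ := exists_nat_gt ((q : ℝ) / ε)
    have hq' : (0 : ℝ) ≤ q := by exact_mod_cast hq
    have hN0 : (0 : ℝ) < N := (div_nonneg hq' hε.le).trans_lt hN
    have hr0 : (0 : ℝ) ≤ q / N := by positivity
    have hrε : (q : ℝ) / N < ε := by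
      rw [div_lt_iff₀ hε] at hN
      rw [div_lt_iff₀ hN0]; linarith
    have key : ∀ i : ℕ, i ≤ N → Reaches S G (t - i * (q / N)) (γ (a + i * (q / N))) y →
        Reaches S G t (γ a) y := by
      intro i
      induction i with
      | zero => simp
      | succ i ih =>
        intro hi hR
        refine ih (by omega) ?_
        have hle : ((i + 1 : ℕ) : ℝ) * (q / N) ≤ q := by
          have : ((i + 1 : ℕ) : ℝ) ≤ N := by exact_mod_cast hi
          calc ((i + 1 : ℕ) : ℝ) * (q / N) ≤ N * (q / N) := by gcongr
            _ = q := by field_simp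
        push_cast at hle hR
        have hnn : (0 : ℝ) ≤ i * (q / N) := by positivity
        have hd : a + (i + 1) * (q / N) - (a + i * (q / N)) = (q : ℝ) / N := by ring
        obtain ⟨k, hk, hkd⟩ := hsub (a + i * (q / N)) (a + (i + 1) * (q / N)) (by linarith)
          (by linarith) (by linarith) (by rwa [hd])
        have hu := (B k).unique γ _ _ (by linarith) hk hkd
          (hγ.mono (Icc_subset_Icc (by linarith) (by linarith)))
        rw [hd] at hu hk
        have hmem : ((q / N : ℚ) : ℝ) ∈ Ioo (-(B k).time) (B k).time := by
          push_cast
          exact ⟨by linarith, hk⟩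
        refine Reaches.prepend (S := S) (Sum.inl ⟨k, ⟨q / N, hmem⟩⟩)
          (hkd _ (left_mem_Icc.2 (by linarith))) ?_
        change Reaches S G (t - i * (q / N) - ((q / N : ℚ) : ℝ))
          ((B k).flow (((q / N : ℚ) : ℝ), γ (a + i * (q / N)))) y
        push_cast
        rw [← hu]
        convert hR using 1
        ring
    refine key N le_rfl ?_
    have : (N : ℝ) * (q / N) = q := by field_simp
    rwa [this]
  -- A rational time shortly before `t`, after which the curve remains in a given neighbourhood of
  -- its end point.
  have approx : ∀ (γ : ℝ → M) (t δ : ℝ) (U : Set M), 0 ≤ t → 0 < δ → IsOpen U → γ t ∈ U →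
      ContinuousOn γ (Icc 0 t) → ∃ q : ℚ, 0 ≤ q ∧ (q : ℝ) ≤ t ∧ t - q < δ ∧
        ∀ u ∈ Icc (q : ℝ) t, γ u ∈ U := by
    intro γ t δ U ht hδ hU hγU hγ
    obtain ⟨δ', hδ', hsub⟩ := Metric.mem_nhdsWithin_iff.1
      (hγ t (right_mem_Icc.2 ht) (hU.mem_nhds hγU))
    obtain rfl | ht' := ht.eq_or_lt
    · refine ⟨0, le_rfl, by simp, by simpa using hδ, fun u hu => ?_⟩
      have : u = 0 := le_antisymm hu.2 (by simpa using hu.1)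
      rwa [this]
    · obtain ⟨q, hq, hqt⟩ := exists_rat_btwn (show max 0 (t - min δ δ') < t by
        simp [ht', hδ, hδ'])
      have h0 : (0 : ℝ) < q := (le_max_left _ _).trans_lt hq
      have h1 : t - min δ δ' < q := (le_max_right _ _).trans_lt hq
      have h2 := min_le_left δ δ'
      have h3 := min_le_right δ δ'
      refine ⟨q, by exact_mod_cast h0.le, hqt.le, by linarith, fun u hu => hsub ⟨?_, ?_, hu.2⟩⟩
      · rw [Metric.mem_ball, Real.dist_eq, abs_sub_comm, abs_of_nonneg (by linarith [hu.2])]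
        linarith [hu.1]
      · linarith [hu.1]
  have hsol : ∀ γ t, 𝓗.IsSolution γ t → IsMIntegralCurveOn (I := I) γ X (Icc 0 t) := by
    intro γ t hγ s hs
    have h1 := hγ.1 s hs
    refine h1.congr_mfderiv ?_
    exact congrArg (fun v : E => (1 : ℝ →L[ℝ] ℝ).smulRight v) (hfield _ (hγ.2 s hs))
  intro t x y h
  change Reaches S G t x y
  induction h with
  | @smooth t γ ht hγ havoid =>
    have hγX := hsol γ t hγ
    obtain ⟨k, hk⟩ := hcov (γ t)
    obtain ⟨q, hq0, hqt, hqd, hqU⟩ := approx γ t (B k).time (B k).dom ht (B k).time_pos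
      (B k).isOpen_dom hk hγX.continuousOn
    have hq0' : (0 : ℝ) ≤ q := by exact_mod_cast hq0
    refine rational γ 0 q t _ hq0 (hγX.mono (Icc_subset_Icc le_rfl (by simpa using hqt))) ?_
    rw [zero_add]
    have hu := (B k).unique γ q t hqt hqd hqU (hγX.mono (Icc_subset_Icc hq0' le_rfl))
    rw [hu]
    exact Reaches.of_family (G := G) k
      ⟨⟨by linarith [(B k).time_pos], hqd⟩, hqU _ (left_mem_Icc.2 hqt)⟩
  | @impact t₁ t₂ γ y ht₁ ht₂ hγ havoid hhit hrest ih =>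
    have hγX := hsol γ t₁ hγ
    obtain ⟨w, hw, hwd⟩ := mem_iUnion₂.1
      (hsJu ▸ mem_univ _ : (⟨γ t₁, hhit⟩ : 𝓗.impact) ∈
        ⋃ w ∈ sJ, (Subtype.val ⁻¹' (S₀ w).dom : Set 𝓗.impact))
    obtain ⟨-, hz, -, hr⟩ := himpact _ hhit
    obtain ⟨q, hq0, hqt, hqd, hqU⟩ := approx γ t₁ (min (δS w) (B (kS w)).time) (S₀ w).dom ht₁
      (lt_min (hδS w) (B (kS w)).time_pos) (S₀ w).isOpen_dom hwd hγX.continuousOn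
    have hq0' : (0 : ℝ) ≤ q := by exact_mod_cast hq0
    refine rational γ 0 q _ _ hq0 (hγX.mono (Icc_subset_Icc le_rfl (by simpa using hqt))) ?_
    rw [zero_add]
    have hu := (B (kS w)).unique γ q t₁ hqt (hqd.trans_le (min_le_right _ _))
      (fun u hu => hSB w (hqU u hu)) (hγX.mono (Icc_subset_Icc hq0' le_rfl))
    have hqm := hqU _ (left_mem_Icc.2 hqt)
    -- The trajectory from `γ q` meets the surface after the time `t₁ - q`, which is shorter than
    -- `δS w`. This is therefore the delay, rational or not.
    obtain ⟨h1, h2⟩ := hS w _ hqm (t₁ - q)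
      (by rw [abs_of_nonneg (by linarith)]; exact hqd.trans_le (min_le_left _ _)) (by rwa [← hu])
    refine Reaches.prepend (S := S) (Sum.inr ⟨w, hw⟩) hqm ?_
    change Reaches S G (t₁ + t₂ - q - (S₀ w).delay (γ q)) ((S₀ w).jump (γ q)) y
    rw [h1, h2, ← hu, ← hr]
    convert ih using 1
    ring

end Cover

/-! ### Determinants off the constraint set, and the Baire argument -/

section Extension

open Set Filter Topology

/-- Both maps preserve the kernel of `θ` and induce the identity on the quotient, so each
determinant is that of the restriction to the kernel. -/
theorem det_eq_of_eqOn_ker {E F : Type*} [AddCommGroup E] [Module ℝ E]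
    [FiniteDimensional ℝ E] [AddCommGroup F] [Module ℝ F] (θ : E →ₗ[ℝ] F) {A B : E →ₗ[ℝ] E}
    (hA : θ ∘ₗ A = θ) (hB : θ ∘ₗ B = θ) (hAB : ∀ v, θ v = 0 → A v = B v) : A.det = B.det := by
  have hle : ∀ {C : E →ₗ[ℝ] E}, θ ∘ₗ C = θ → LinearMap.ker θ ≤ (LinearMap.ker θ).comap C := by
    intro C hC v hv
    have := DFunLike.congr_fun hC v
    simp only [LinearMap.comp_apply] at this
    simpa [this] using hv
  have hquot : ∀ {C : E →ₗ[ℝ] E} (hC : θ ∘ₗ C = θ),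
      (LinearMap.ker θ).mapQ (LinearMap.ker θ) C (hle hC) = LinearMap.id := by
    intro C hC
    refine Submodule.linearMap_qext _ (LinearMap.ext fun v => ?_)
    have := DFunLike.congr_fun hC v
    simp only [LinearMap.comp_apply] at this
    simp only [LinearMap.comp_apply, Submodule.mkQ_apply, Submodule.mapQ_apply, LinearMap.id_apply]
    rw [Submodule.Quotient.eq, LinearMap.mem_ker, map_sub, this, sub_self]
  rw [LinearMap.det_eq_det_mul_det (LinearMap.ker θ) A (hle hA),
    LinearMap.det_eq_det_mul_det (LinearMap.ker θ) B (hle hB), hquot hA, hquot hB]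
  congr 2
  exact LinearMap.ext fun v => Subtype.ext (hAB v v.2)

/-- If `A` is invertible, then `B ∘ A⁻¹` preserves `θ'` and is the identity on its kernel, so it has
determinant one. If neither map is invertible, both determinants vanish. -/
theorem det_eq_of_comp_eq {E F : Type*} [AddCommGroup E] [Module ℝ E]
    [FiniteDimensional ℝ E] [AddCommGroup F] [Module ℝ F] {θ θ' : E →ₗ[ℝ] F} {A B : E →ₗ[ℝ] E}
    (hA : θ' ∘ₗ A = θ) (hB : θ' ∘ₗ B = θ) (hAB : ∀ v, θ v = 0 → A v = B v) : A.det = B.det := by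
  have main : ∀ {A B : E →ₗ[ℝ] E}, θ' ∘ₗ A = θ → θ' ∘ₗ B = θ → (∀ v, θ v = 0 → A v = B v) →
      A.det ≠ 0 → A.det = B.det := by
    intro A B hA hB hAB h
    let e : E ≃ₗ[ℝ] E := A.equivOfDetNeZero h
    have he : ∀ v, A (e.symm v) = v := fun v => e.apply_symm_apply v
    have hθ : ∀ v, θ (e.symm v) = θ' v := fun v => by
      rw [← hA, LinearMap.comp_apply, he]
    have h1 : (B ∘ₗ e.symm.toLinearMap).det = (LinearMap.id : E →ₗ[ℝ] E).det := by
      refine det_eq_of_eqOn_ker θ' (LinearMap.ext fun v => ?_) rfl fun v hv => ?_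
      · exact (DFunLike.congr_fun hB (e.symm v)).trans (hθ v)
      · exact (hAB _ ((hθ v).trans hv)).symm.trans (he v)
    have h2 : B = (B ∘ₗ e.symm.toLinearMap) ∘ₗ A := LinearMap.ext fun v =>
      congrArg B (e.symm_apply_apply v).symm
    rw [h2, LinearMap.det_comp, h1, LinearMap.det_id, one_mul]
  by_cases hA0 : A.det = 0
  · by_cases hB0 : B.det = 0
    · rw [hA0, hB0]
    · exact (main hB hA (fun v hv => (hAB v hv).symm) hB0).symm
  · exact main hA hB hAB hA0

/-- If countably many continuous maps agree with `f` on a Baire space at some points each, so that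
all points are covered, then one of them agrees with `f` near some point. -/
theorem exists_eventuallyEq_of_countable_cover {Y Z ι : Type*} [TopologicalSpace Y]
    [TopologicalSpace Z] [T2Space Z] [BaireSpace Y] [Nonempty Y] [Countable ι] {f : Y → Z}
    (hf : Continuous f) {g : ι → Y → Z} {O : ι → Set Y} (hO : ∀ i, IsOpen (O i))
    (hg : ∀ i, ContinuousOn (g i) (O i)) (hcov : ∀ y, ∃ i, y ∈ O i ∧ g i y = f y) :
    ∃ i y, y ∈ O i ∧ f =ᶠ[𝓝 y] g i := by
  obtain ⟨i, hi⟩ := nonempty_interior_of_iUnion_of_closed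
    (f := fun i => closure {y | y ∈ O i ∧ g i y = f y}) (fun i => isClosed_closure)
    (eq_univ_of_forall fun y => mem_iUnion.2 ((hcov y).imp fun i h => subset_closure h))
  -- A coincidence point inside the interior lies in `O i`, and within `O i` the coincidence set is
  -- relatively closed. So it contains a neighbourhood of that point.
  obtain ⟨y, hyA, hyi⟩ := mem_closure_iff.1 (interior_subset hi.some_mem) _ isOpen_interior
    hi.some_mem
  refine ⟨i, y, hyi.1, ?_⟩
  filter_upwards [isOpen_interior.mem_nhds hyA, (hO i).mem_nhds hyi.1] with z hz hzO
  by_contra hne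
  have h1 : ∀ᶠ u in 𝓝 z, f u ≠ g i u :=
    (hf.continuousAt.ne_iff_eventually_ne ((hg i).continuousAt ((hO i).mem_nhds hzO))).1 hne
  obtain ⟨u, hu1, hu2⟩ := mem_closure_iff_frequently.1 (interior_subset hz) |>.and_eventually h1
    |>.exists
  exact hu2 hu1.2.symm

variable {E H : Type*} [NormedAddCommGroup E] [NormedSpace ℝ E] [TopologicalSpace H]
  {I : ModelWithCorners ℝ E H} {M : Type*} [TopologicalSpace M] [ChartedSpace H M]

/-- `mfderiv` refers to the preferred charts, which may jump from point to point. Its determinant is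
nevertheless continuous because chart changes have determinant one, so that it agrees with the
determinant in fixed charts. -/
theorem continuousAt_det_endDeriv [IsManifold I 1 M] [FiniteDimensional ℝ E]
    (hdet : ∀ x y z : M, z ∈ (chartAt H x).source → z ∈ (chartAt H y).source →
      (tangentCoordChange I x y z).det = 1) {f : M → M} {x₀ : M} (hf : ContMDiffAt I I 1 f x₀) :
    ContinuousAt (fun x => (endDeriv I f x).det) x₀ := by
  have h1 := (hf.mfderiv_const (m := 0) (by simp)).continuousAt
  have h2 : ContinuousAt (fun x => (inTangentCoordinates I I id f (mfderiv I I f) x₀ x).det) x₀ :=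
    ContinuousLinearMap.continuous_det.continuousAt.comp h1
  refine h2.congr ?_
  have hs : ∀ᶠ x in 𝓝 x₀, x ∈ (chartAt H x₀).source := chart_source_mem_nhds H x₀
  have ht : ∀ᶠ x in 𝓝 x₀, f x ∈ (chartAt H (f x₀)).source :=
    hf.continuousAt.preimage_mem_nhds (chart_source_mem_nhds H (f x₀))
  filter_upwards [hs, ht] with x hx hfx
  have h3 := inTangentCoordinates_eq (I := I) (I' := I) id f (mfderiv I I f) hx hfx
  refine (congrArg ContinuousLinearMap.det h3).trans ?_
  refine (det_comp (tangentCoordChange I (f x) (f x₀) (f x))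
    (endDeriv I f x ∘L tangentCoordChange I x₀ x x)).trans ?_
  rw [det_comp, hdet _ _ _ (mem_chart_source H (f x)) hfx, hdet _ _ _ hx (mem_chart_source H x),
    one_mul, mul_one]

variable {F : Type*} [NormedAddCommGroup F] [NormedSpace ℝ F] {X : M → E} {P : M → F} {c : M → ℝ}

variable (I) in
/-- The differential of a vector-valued function on `M`, in the preferred chart. -/
def vectorDeriv (f : M → F) (x : M) : E →L[ℝ] F := mfderiv I 𝓘(ℝ, F) f x

theorem vectorDeriv_comp {f : M → F} {g : M → M} {x : M}
    (hf : MDifferentiableAt I 𝓘(ℝ, F) f (g x)) (hg : MDifferentiableAt I I g x) :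
    vectorDeriv I (fun y => f (g y)) x = vectorDeriv I f (g x) ∘L endDeriv I g x :=
  mfderiv_comp x hf hg

/-- A map `T (y, c)`, thought of as a translation of `y` by `c`, which moves the value of `P` by
`c`. -/
structure IsTranslation (I : ModelWithCorners ℝ E H) (P : M → F) (T : M × F → M) : Prop where
  smooth : ContMDiff (I.prod 𝓘(ℝ, F)) I ∞ T
  apply_zero : ∀ y, T (y, 0) = y
  shift : ∀ y c, P (T (y, c)) = P y + c

namespace IsTranslation

variable {T : M × F → M} (hT : IsTranslation I P T)
include hT

/-- To first order along `v` the translation parameter stays zero, and translation by zero is the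
identity. -/
theorem endDeriv_apply {f : M → M} {p : M → F} {x : M} {v : E} (hf : MDifferentiableAt I I f x)
    (hp : MDifferentiableAt I 𝓘(ℝ, F) p x) (hpx : p x = 0) (hv : vectorDeriv I p x v = 0) :
    endDeriv I (fun y => T (f y, p y)) x v = endDeriv I f x v := by
  have hTd : MDifferentiableAt (I.prod 𝓘(ℝ, F)) I T (f x, p x) :=
    hT.smooth.contMDiffAt.mdifferentiableAt (by simp)
  have h1 := HasMFDerivAt.comp x (f := fun y => (f y, p y)) hTd.hasMFDerivAt
    (hf.hasMFDerivAt.prodMk hp.hasMFDerivAt)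
  have h2 : endDeriv I (fun y => T (f y, p y)) x v = _ := DFunLike.congr_fun h1.mfderiv v
  refine h2.trans ((mfderiv_prod_eq_add_apply hTd).trans ?_)
  have h3 : (fun z => T (z, p x)) = id := funext fun z => by rw [hpx, hT.apply_zero]; rfl
  have h4 : endDeriv I (fun z => T (z, p x)) (f x) = ContinuousLinearMap.id ℝ E := by
    rw [h3]; exact mfderiv_id
  refine (congrArg₂ (fun a b : E => a + b) (DFunLike.congr_fun h4 (endDeriv I f x v))
    ((congrArg (mfderiv 𝓘(ℝ, F) I (fun z => T (f x, z)) (p x)) hv).trans (map_zero _))).trans ?_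
  exact add_zero (endDeriv I f x v)

/-- Only the values of `f` on `P = 0` matter, so the ambient determinant of `f` itself carries no
information. With the retraction `r` onto `P = 0`, the map `g = T (f ∘ r, P)` extends `f`, preserves
`P`, and on `ker dP` has a derivative that depends only on `f` along `P = 0`. Where `f` agrees along
`P = 0` with a single local family, `det_eq_of_comp_eq` equates the two determinants. Baire's
theorem supplies such points arbitrarily close to `x`, and the identity at `x` follows by
continuity. -/
theorem exists_linear_extension [IsManifold I ∞ M] [FiniteDimensional ℝ E] [T2Space M]
    [LocallyCompactSpace M]
    (hdet : haveI : IsManifold I 1 M := isManifold_one_of_infty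
      ∀ x y z : M, z ∈ (chartAt H x).source → z ∈ (chartAt H y).source →
      (tangentCoordChange I x y z).det = 1)
    (hP : ContMDiff I 𝓘(ℝ, F) ∞ P) (hc : Continuous c) {ι : Type*} [Countable ι]
    (G : ι → LocalFamily I X P c) (t : ℝ) {U : Set M} (hU : IsOpen U) {f : M → M}
    (hf : ContMDiffOn I I ∞ f U)
    (hcov : ∀ x ∈ U, P x = 0 → ∃ i, (t, x) ∈ (G i).dom ∧ (G i).map (t, x) = f x)
    {x : M} (hx : x ∈ U) (hPx : P x = 0) :
    ∃ K : E →L[ℝ] E, (∀ v, vectorDeriv I P x v = 0 → K v = endDeriv I f x v) ∧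
      (∀ v, vectorDeriv I P (f x) (K v) = vectorDeriv I P x v) ∧ c (f x) * K.det = c x := by
  have := isManifold_one_of_infty (I := I) (M := M)
  have hone : (1 : WithTop ℕ∞) ≤ ∞ := by exact_mod_cast le_top
  have hPd : ∀ y, MDifferentiableAt I 𝓘(ℝ, F) P y := fun y =>
    hP.contMDiffAt.mdifferentiableAt (by simp)
  have hPf : ∀ y ∈ U, P y = 0 → P (f y) = 0 := fun y hy hPy => by
    obtain ⟨i, h1, h2⟩ := hcov y hy hPy
    rw [← h2, (G i).conserve _ h1, hPy]
  -- the retraction to `P = 0` and the extension of `f`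
  set r : M → M := fun y => T (y, -P y) with hr
  have hrs : ContMDiff I I ∞ r := hT.smooth.comp (contMDiff_id.prodMk hP.neg)
  have hrP : ∀ y, P (r y) = 0 := fun y => by rw [hr, hT.shift, add_neg_cancel]
  have hrN : ∀ y, P y = 0 → r y = y := fun y hy => by simp only [hr, hy, neg_zero, hT.apply_zero]
  have hrv : ∀ y v, P y = 0 → vectorDeriv I P y v = 0 → endDeriv I r y v = v := by
    intro y v hy hv
    have h1 : vectorDeriv I (fun z => -P z) y = -vectorDeriv I P y := (hPd y).hasMFDerivAt.neg.mfderiv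
    have h2 := hT.endDeriv_apply (f := id) (p := fun z => -P z) (v := v) mdifferentiableAt_id
      (hPd y).neg (by simp [hy]) (by rw [h1]; simp [hv])
    have h3 : endDeriv I (id : M → M) y = ContinuousLinearMap.id ℝ E := mfderiv_id
    rw [h3] at h2
    exact h2
  set V := r ⁻¹' U with hV
  have hVo : IsOpen V := hU.preimage hrs.continuous
  have hNV : ∀ y ∈ U, P y = 0 → y ∈ V := fun y hy hPy => by rwa [hV, mem_preimage, hrN y hPy]
  set g : M → M := fun y => T (f (r y), P y) with hg
  have hfr : ContMDiffOn I I ∞ (fun y => f (r y)) V := hf.comp hrs.contMDiffOn fun y hy => hy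
  have hgs : ContMDiffOn I I ∞ g V := hT.smooth.comp_contMDiffOn (hfr.prodMk hP.contMDiffOn)
  have hgN : ∀ y ∈ U, P y = 0 → g y = f y := fun y hy hPy => by
    simp only [hg, hrN y hPy, hPy, hT.apply_zero]
  have hgP : ∀ y ∈ V, P (g y) = P y := fun y hy => by
    simp only [hg, hT.shift, hPf _ hy (hrP y), zero_add]
  have hgθ : ∀ y ∈ V, vectorDeriv I P (g y) ∘L endDeriv I g y = vectorDeriv I P y := by
    intro y hy
    rw [← vectorDeriv_comp (hPd _) ((hgs.contMDiffAt (hVo.mem_nhds hy)).mdifferentiableAt (by simp))]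
    have h1 : (fun z => P (g z)) =ᶠ[𝓝 y] P := by
      filter_upwards [hVo.mem_nhds hy] with z hz using hgP z hz
    exact h1.mfderiv_eq
  -- a map `u` which agrees with `f` on `P = 0` has the same derivative as the extension
  have key : ∀ u : M → M, ∀ y ∈ U, P y = 0 → MDifferentiableAt I I u y →
      (∀ᶠ z in 𝓝 y, P z = 0 → f z = u z) → ∀ v, vectorDeriv I P y v = 0 →
      endDeriv I g y v = endDeriv I u y v := by
    intro u y hy hPy hu hfu v hv
    have h1 : g =ᶠ[𝓝 y] fun z => T (u (r z), P z) := by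
      have h2 : ∀ᶠ z in 𝓝 y, P (r z) = 0 → f (r z) = u (r z) :=
        hrs.continuous.continuousAt.eventually (by rwa [hrN y hPy])
      filter_upwards [h2] with z hz
      simp only [hg, hz (hrP z)]
    have hrd : MDifferentiableAt I I r y := hrs.contMDiffAt.mdifferentiableAt (by simp)
    have hu' : MDifferentiableAt I I u (r y) := by rwa [hrN y hPy]
    have h3 : endDeriv I (fun z => u (r z)) y v = endDeriv I u y v := by
      have h4 : endDeriv I (fun z => u (r z)) y = endDeriv I u (r y) ∘L endDeriv I r y :=
        mfderiv_comp y hu' hrd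
      rw [h4, ContinuousLinearMap.comp_apply, hrv y v hPy hv, hrN y hPy]
    have h5 : endDeriv I g y = endDeriv I (fun z => T (u (r z), P z)) y := h1.mfderiv_eq
    rw [h5]
    exact (hT.endDeriv_apply (f := fun z => u (r z)) (hu'.comp y hrd) (hPd y) hPy hv).trans h3
  refine ⟨endDeriv I g x, ?_, ?_, ?_⟩
  · exact key f x hx hPx ((hf.contMDiffAt (hU.mem_nhds hx)).mdifferentiableAt (by simp))
      (Eventually.of_forall fun z _ => rfl)
  · intro v
    have h1 := DFunLike.congr_fun (hgθ x (hNV x hx hPx)) v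
    rwa [hgN x hx hPx] at h1
  -- the identity for the density holds at the points where `f` is a local family
  · have hcont : ContinuousAt (fun y => c (g y) * (endDeriv I g y).det - c y) x := by
      have h1 := hgs.contMDiffAt (hVo.mem_nhds (hNV x hx hPx))
      exact ((hc.continuousAt.comp h1.continuousAt).mul
        (continuousAt_det_endDeriv hdet (h1.of_le hone))).sub hc.continuousAt
    have hfreq : ∃ᶠ y in 𝓝 x, c (g y) * (endDeriv I g y).det - c y = 0 := by
      refine frequently_nhds_iff.2 fun O hxO hO => ?_
      -- Locally closed in a locally compact Hausdorff space, hence locally compact and a Baire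
      -- space.
      let Y : Set M := (O ∩ U) ∩ {y | P y = 0}
      have hYc : IsLocallyClosed Y := (hO.inter hU).isLocallyClosed.inter
        (isClosed_eq hP.continuous continuous_const).isLocallyClosed
      have : LocallyCompactSpace Y := hYc.locallyCompactSpace
      have : Nonempty Y := ⟨⟨x, ⟨hxO, hx⟩, hPx⟩⟩
      obtain ⟨i, y, hy1, hy2⟩ := exists_eventuallyEq_of_countable_cover (Y := Y)
        (f := fun y => f y) (g := fun i y => (G i).map (t, y))
        (O := fun i => {y | (t, (y : M)) ∈ (G i).dom})
        (hf.continuousOn.comp_continuous continuous_subtype_val fun y => y.2.1.2)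
        (fun i => (G i).isOpen_dom.preimage (by fun_prop))
        (fun i => (G i).smooth.continuousOn.comp (by fun_prop) fun y hy => hy)
        (fun y => hcov y y.2.1.2 y.2.2)
      obtain ⟨⟨hyO, hyU⟩, hPy⟩ := y.2
      have hPy' : P y = 0 := hPy
      refine ⟨y, hyO, ?_⟩
      have hdn : ∀ᶠ z in 𝓝 (y : M), (t, z) ∈ (G i).dom :=
        (by fun_prop : Continuous fun z : M => (t, z)).continuousAt.preimage_mem_nhds
          ((G i).isOpen_dom.mem_nhds hy1)
      have hud : MDifferentiableAt I I (fun z => (G i).map (t, z)) y :=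
        MDifferentiableAt.comp (y : M) (g := (G i).map) (f := fun z => (t, z))
          ((G i).mdifferentiableAt hy1)
          (mdifferentiableAt_const.prodMk mdifferentiableAt_id)
      have hev : ∀ᶠ z in 𝓝 (y : M), P z = 0 → f z = (G i).map (t, z) := by
        have h1 := eventually_nhds_subtype_iff Y y (fun z => f z = (G i).map (t, z)) |>.1 hy2
        rw [eventually_nhdsWithin_iff] at h1
        filter_upwards [h1, hO.mem_nhds hyO, hU.mem_nhds hyU] with z hz hzO hzU hPz
        exact hz ⟨⟨hzO, hzU⟩, hPz⟩
      have hfy : f y = (G i).map (t, (y : M)) := hev.self_of_nhds hPy'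
      have hker := key (fun z => (G i).map (t, z)) y hyU hPy' hud hev
      have hGθ : vectorDeriv I P ((G i).map (t, (y : M))) ∘L
          endDeriv I (fun z => (G i).map (t, z)) y = vectorDeriv I P y := by
        rw [← vectorDeriv_comp (hPd _) hud]
        have h1 : (fun z => P ((G i).map (t, z))) =ᶠ[𝓝 (y : M)] P := by
          filter_upwards [hdn] with z hz using (G i).conserve _ hz
        exact h1.mfderiv_eq
      have h2 := hgθ y (hNV y hyU hPy')
      have hgy : g y = (G i).map (t, (y : M)) := (hgN y hyU hPy').trans hfy
      rw [hgy] at h2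
      have hdets : (endDeriv I g y).det = (endDeriv I (fun z => (G i).map (t, z)) y).det := by
        refine det_eq_of_comp_eq (θ := (vectorDeriv I P y).toLinearMap)
          (θ' := (vectorDeriv I P ((G i).map (t, (y : M)))).toLinearMap)
          (LinearMap.ext fun v => DFunLike.congr_fun h2 v)
          (LinearMap.ext fun v => DFunLike.congr_fun hGθ v) hker
      rw [hdets, hgy]
      exact sub_eq_zero.2 ((G i).weight _ hy1 hPy')
    have h1 : c (g x) * (endDeriv I g x).det - c x = 0 := by
      by_contra hne
      exact hfreq (hcont.eventually_ne hne)
    rw [hgN x hx hPx] at h1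
    exact sub_eq_zero.1 h1

end IsTranslation

end Extension

/-! ### The quotient of a volume form by a family of covectors -/

section RelativeVolume

variable {W : Type*} [AddCommGroup W] [Module ℝ W]

theorem wedge_apply {a b : ℕ} (φ : W [⋀^Fin a]→ₗ[ℝ] ℝ) (ψ : W [⋀^Fin b]→ₗ[ℝ] ℝ)
    (w : Fin a ⊕ Fin b → W) :
    wedge φ ψ (w ∘ finSumFinEquiv.symm) =
      ∑ σ : Equiv.Perm.ModSumCongr (Fin a) (Fin b),
        LinearMap.mul' ℝ ℝ (AlternatingMap.domCoprod.summand φ ψ σ w) := by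
  have h1 : (w ∘ finSumFinEquiv.symm) ∘ finSumFinEquiv = w := by
    funext i; simp
  change LinearMap.mul' ℝ ℝ (φ.domCoprod ψ ((w ∘ finSumFinEquiv.symm) ∘ finSumFinEquiv)) = _
  rw [h1]
  change LinearMap.mul' ℝ ℝ ((∑ σ, AlternatingMap.domCoprod.summand φ ψ σ :
    MultilinearMap ℝ (fun _ => W) _) w) = _
  rw [sum_apply, map_sum]

theorem mul'_summand_mk {a b : ℕ} (φ : W [⋀^Fin a]→ₗ[ℝ] ℝ) (ψ : W [⋀^Fin b]→ₗ[ℝ] ℝ)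
    (w : Fin a ⊕ Fin b → W) (σ : Equiv.Perm (Fin a ⊕ Fin b)) :
    LinearMap.mul' ℝ ℝ (AlternatingMap.domCoprod.summand φ ψ (Quotient.mk'' σ) w) =
      Equiv.Perm.sign σ • (φ (fun i => w (σ (Sum.inl i))) * ψ fun i => w (σ (Sum.inr i))) := by
  rw [AlternatingMap.domCoprod.summand_mk'']
  rw [smul_apply, Units.smul_def, map_zsmul]
  rfl

theorem wedge_eq_zero {a b : ℕ} {φ : W [⋀^Fin a]→ₗ[ℝ] ℝ} {ψ : W [⋀^Fin b]→ₗ[ℝ] ℝ} {x : W}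
    (hφ : ∀ w : Fin a → W, (∃ i, w i = x) → φ w = 0)
    (hψ : ∀ w : Fin b → W, (∃ i, w i = x) → ψ w = 0) (w : Fin (a + b) → W) (hw : ∃ i, w i = x) :
    wedge φ ψ w = 0 := by
  obtain ⟨i, hi⟩ := hw
  have h1 : w = (w ∘ finSumFinEquiv) ∘ finSumFinEquiv.symm := by funext i; simp
  rw [h1, wedge_apply]
  refine Finset.sum_eq_zero fun σ _ => ?_
  induction σ using Quotient.inductionOn' with | _ σ
  rw [mul'_summand_mk]
  obtain ⟨j, hj⟩ := σ.surjective (finSumFinEquiv.symm i)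
  have hx : (w ∘ finSumFinEquiv) (σ j) = x := by rw [hj]; simpa using hi
  obtain j | j := j
  · rw [hφ _ ⟨j, hx⟩, zero_mul, smul_zero]
  · rw [hψ _ ⟨j, hx⟩, mul_zero, smul_zero]

/-- Every shuffle but the trivial one feeds some `u j` to `φ`, which kills it. -/
theorem wedge_apply_sumElim {a b : ℕ} {φ : W [⋀^Fin a]→ₗ[ℝ] ℝ} (ψ : W [⋀^Fin b]→ₗ[ℝ] ℝ)
    (v : Fin a → W) {u : Fin b → W} (h : ∀ (w : Fin a → W) (i j), w i = u j → φ w = 0) :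
    wedge φ ψ (Sum.elim v u ∘ finSumFinEquiv.symm) = φ v * ψ u := by
  rw [wedge_apply]
  refine (Finset.sum_eq_single (Quotient.mk'' 1 : Equiv.Perm.ModSumCongr (Fin a) (Fin b))
    ?_ ?_).trans ?_
  · intro σ _ hσ
    induction σ using Quotient.inductionOn' with | _ σ
    rw [mul'_summand_mk]
    by_cases hm : ∃ i j, σ (Sum.inl i) = Sum.inr j
    · obtain ⟨i, j, hij⟩ := hm
      rw [h _ i j (by simp [hij]), zero_mul, smul_zero]
    · refine absurd (Quotient.sound' (QuotientGroup.leftRel_apply.2 ?_)) hσ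
      rw [mul_one, inv_mem_iff]
      refine Equiv.Perm.mem_sumCongrHom_range_of_perm_mapsTo_inl ?_
      rintro _ ⟨i, rfl⟩
      rcases hs : σ (Sum.inl i) with j | j
      · exact ⟨j, rfl⟩
      · exact absurd ⟨i, j, hs⟩ hm
  · simp
  · rw [mul'_summand_mk]
    simp

theorem wedgeFamily_eq_zero {m : ℕ} {θ : Fin m → (W →ₗ[ℝ] ℝ)} {x : W} (hx : ∀ i, θ i x = 0)
    (w : Fin m → W) (hw : ∃ i, w i = x) : wedgeFamily m θ w = 0 := by
  induction m with
  | zero => exact hw.choose.elim0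
  | succ m ih =>
    refine wedge_eq_zero (fun w hw => ih (fun i => hx i.castSucc) w hw) ?_ w hw
    rintro w ⟨i, hi⟩
    rw [Subsingleton.elim i 0] at hi
    exact (congrArg (θ (Fin.last m)) hi).trans (hx _)

theorem wedgeFamily_dual {m : ℕ} {θ : Fin m → (W →ₗ[ℝ] ℝ)} {v : Fin m → W}
    (hv : ∀ i j, θ i (v j) = if i = j then 1 else 0) : wedgeFamily m θ v = 1 := by
  induction m with
  | zero => rfl
  | succ m ih =>
    have h1 : v = Sum.elim (fun i : Fin m => v i.castSucc) (fun _ : Fin 1 => v (Fin.last m)) ∘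
        finSumFinEquiv.symm := by
      funext i
      refine Fin.lastCases ?_ (fun i => ?_) i
      · have : (finSumFinEquiv (Sum.inr (0 : Fin 1)) : Fin (m + 1)) = Fin.last m := rfl
        rw [← this, Function.comp_apply, Equiv.symm_apply_apply]
        rfl
      · have : (finSumFinEquiv (Sum.inl i) : Fin (m + 1)) = i.castSucc := rfl
        rw [← this, Function.comp_apply, Equiv.symm_apply_apply]
        rfl
    rw [h1]
    refine (wedge_apply_sumElim (oneForm (θ (Fin.last m))) _ fun w i j hw =>
      wedgeFamily_eq_zero (x := v (Fin.last m)) (fun i => ?_) w ⟨i, hw⟩).trans ?_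
    · rw [hv, if_neg (Fin.castSucc_lt_last i).ne]
    · rw [ih fun i j => by rw [hv]; simp]
      exact (one_mul _).trans ((hv _ _).trans (if_pos rfl))

theorem exists_adapted_basis [FiniteDimensional ℝ W] {m k : ℕ} (hW : Module.finrank ℝ W = m + k)
    {θ : Fin m → (W →ₗ[ℝ] ℝ)} {v : Fin m → W}
    (hv : ∀ i j, θ i (v j) = if i = j then 1 else 0) :
    ∃ b : Module.Basis (Fin m ⊕ Fin k) ℝ W, (∀ i, b (Sum.inl i) = v i) ∧
      ∀ i j, θ i (b (Sum.inr j)) = 0 := by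
  let Θ : W →ₗ[ℝ] (Fin m → ℝ) := LinearMap.pi θ
  have hΘ : ∀ c : Fin m → ℝ, Θ (∑ j, c j • v j) = c := by
    intro c
    funext i
    simp [Θ, hv]
  have hker : Module.finrank ℝ (LinearMap.ker Θ) = k := by
    have h1 := Θ.finrank_range_add_finrank_ker
    rw [LinearMap.range_eq_top.2 fun c => ⟨_, hΘ c⟩, finrank_top, hW] at h1
    simpa using h1
  let u := Module.finBasisOfFinrankEq ℝ (LinearMap.ker Θ) hker
  have hli : LinearIndependent ℝ (Sum.elim v fun j => (u j : W)) := by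
    rw [Fintype.linearIndependent_iff]
    intro g hg
    simp only [Fintype.sum_sum_type, Sum.elim_inl, Sum.elim_inr] at hg
    have h1 : (fun i => g (Sum.inl i)) = 0 := by
      have h2 := congrArg Θ hg
      rw [map_add, hΘ, map_zero, map_sum] at h2
      simpa using h2
    have h1' : ∀ i, g (Sum.inl i) = 0 := fun i => congrFun h1 i
    have h3 : ∑ j, g (Sum.inr j) • u j = 0 := by
      apply Subtype.ext
      simpa [h1'] using hg
    have h4 := Fintype.linearIndependent_iff.1 u.linearIndependent _ h3
    rintro (i | j)
    · exact h1' i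
    · exact h4 j
  refine ⟨Module.Basis.mk hli (hli.span_eq_top_of_card_eq_finrank' (by simp [hW])).ge,
    fun i => by simp, fun i j => ?_⟩
  have h5 : Θ (u j) = 0 := (u j).2
  have h6 : θ i (u j) = 0 := congrFun h5 i
  simpa using h6

theorem map_comp_eq_det_smul [FiniteDimensional ℝ W] {ι : Type*} [Fintype ι] [DecidableEq ι]
    (b : Module.Basis ι ℝ W) (Ω : W [⋀^ι]→ₗ[ℝ] ℝ) (K : W →ₗ[ℝ] W) (w : ι → W) :
    Ω (K ∘ w) = K.det * Ω w := by
  rw [Ω.eq_smul_basis_det b]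
  simp only [AlternatingMap.smul_apply, smul_eq_mul, b.det_comp]
  ring

/-- The vectors `v` followed by the vectors `u`. -/
def joinVectors {m k N : ℕ} (hk : m + k = N) (v : Fin m → W) (u : Fin k → W) : Fin N → W :=
  (Sum.elim v u ∘ finSumFinEquiv.symm) ∘ (finCongr hk).symm

/-- A form `ε` such that `θ₀ ∧ ⋯ ∧ θ_{m-1} ∧ ε = Ω`. -/
def quotientForm {m k N : ℕ} (hk : m + k = N) (θ : Fin m → (W →ₗ[ℝ] ℝ))
    (Ω : W [⋀^Fin N]→ₗ[ℝ] ℝ) : W [⋀^Fin k]→ₗ[ℝ] ℝ :=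
  Classical.epsilon fun ε => (wedge (wedgeFamily m θ) ε).domDomCongr (finCongr hk) = Ω

variable [FiniteDimensional ℝ W] {m k N : ℕ} (hk : m + k = N) (hW : Module.finrank ℝ W = N)
  {θ : Fin m → (W →ₗ[ℝ] ℝ)} {v : Fin m → W}
include hW

/-- Evaluating `θ ∧ ε = Ω` on `(v, u)` returns `ε u`, so all solutions `ε` agree on the joint kernel
of `θ` and the choice made by `Classical.epsilon` is immaterial there. A solution exists: in a basis
adapted to `v`, rescale the determinant of the remaining coordinates. -/
theorem quotientForm_apply (Ω : W [⋀^Fin N]→ₗ[ℝ] ℝ)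
    (hv : ∀ i j, θ i (v j) = if i = j then 1 else 0)
    {u : Fin k → W} (hu : ∀ i j, θ i (u j) = 0) :
    quotientForm hk θ Ω u = Ω (joinVectors hk v u) := by
  subst hk
  have hval : ∀ (ε : W [⋀^Fin k]→ₗ[ℝ] ℝ) (u : Fin k → W), (∀ i j, θ i (u j) = 0) →
      (wedge (wedgeFamily m θ) ε).domDomCongr (finCongr rfl) (joinVectors rfl v u) = ε u := by
    intro ε u hu
    refine (wedge_apply_sumElim ε v fun w i j hw =>
      wedgeFamily_eq_zero (x := u j) (fun i => hu i j) w ⟨i, hw⟩).trans ?_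
    rw [wedgeFamily_dual hv, one_mul]
  have hex : ∃ ε : W [⋀^Fin k]→ₗ[ℝ] ℝ,
      (wedge (wedgeFamily m θ) ε).domDomCongr (finCongr rfl) = Ω := by
    obtain ⟨b, hb1, hb2⟩ := exists_adapted_basis hW hv
    let pr : W →ₗ[ℝ] (Fin k → ℝ) := LinearMap.pi fun j => b.coord (Sum.inr j)
    let ε₀ : W [⋀^Fin k]→ₗ[ℝ] ℝ := (Pi.basisFun ℝ (Fin k)).det.compLinearMap pr
    have h1 : ε₀ (fun j => b (Sum.inr j)) = 1 := by
      have h2 : (fun j => pr (b (Sum.inr j))) = Pi.basisFun ℝ (Fin k) := by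
        funext j i
        simp [pr, Finsupp.single_apply, Pi.single_apply, eq_comm]
      change (Pi.basisFun ℝ (Fin k)).det (fun j => pr (b (Sum.inr j))) = 1
      rw [h2, Module.Basis.det_self]
    let b' : Module.Basis (Fin (m + k)) ℝ W := b.reindex finSumFinEquiv
    have hb' : (b' : Fin (m + k) → W) = joinVectors rfl v fun j => b (Sum.inr j) := by
      funext i
      have h3 : (b : Fin m ⊕ Fin k → W) = Sum.elim v fun j => b (Sum.inr j) := by
        funext s
        obtain s | s := s
        · exact hb1 s
        · rfl
      change b' i = Sum.elim v (fun j => b (Sum.inr j)) (finSumFinEquiv.symm i)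
      rw [← h3]
      simp [b']
    refine ⟨Ω b' • ε₀, ?_⟩
    refine Module.Basis.ext_alternating b' fun i hi => ?_
    have h4 : ∀ f g : W [⋀^Fin (m + k)]→ₗ[ℝ] ℝ, f b' = g b' → f = g := fun f g hfg => by
      rw [f.eq_smul_basis_det b', g.eq_smul_basis_det b', hfg]
    refine congrArg (fun f : W [⋀^Fin (m + k)]→ₗ[ℝ] ℝ => f fun j => b' (i j)) (h4 _ _ ?_)
    conv_lhs => rw [hb']
    rw [hval _ _ hb2, AlternatingMap.smul_apply, h1, smul_eq_mul, mul_one, hb']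
  have h := Classical.epsilon_spec hex
  rw [← hval _ u hu]
  exact congrArg (fun f : W [⋀^Fin (m + k)]→ₗ[ℝ] ℝ => f (joinVectors rfl v u)) h

/-- The vectors `K v` are dual to `θ'` and the `K u` are killed by it. The left side is therefore
`Ω` on `(K v, K u)`, which is `det K` times `Ω` on `(v, u)`. -/
theorem quotientForm_map (Ω : W [⋀^Fin N]→ₗ[ℝ] ℝ)
    (hv : ∀ i j, θ i (v j) = if i = j then 1 else 0) {θ' : Fin m → (W →ₗ[ℝ] ℝ)}
    {K : W →ₗ[ℝ] W} (hK : ∀ i w, θ' i (K w) = θ i w) {u : Fin k → W}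
    (hu : ∀ i j, θ i (u j) = 0) :
    quotientForm hk θ' Ω (fun j => K (u j)) = K.det * quotientForm hk θ Ω u := by
  rw [quotientForm_apply hk hW (θ := θ') (v := fun j => K (v j)) Ω
    (fun i j => by rw [hK, hv]) (fun i j => by rw [hK, hu]), quotientForm_apply hk hW Ω hv hu,
    ← map_comp_eq_det_smul (Module.finBasisOfFinrankEq ℝ W hW)]
  congr 1
  funext i
  simp only [joinVectors, Function.comp_apply]
  rcases finSumFinEquiv.symm ((finCongr hk).symm i) with j | j <;> rfl

/-- Test vectors that turn an equality of multiples of the quotient form into an equality of the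
factors. -/
theorem exists_quotientForm_ne_zero {Ω : W [⋀^Fin N]→ₗ[ℝ] ℝ} (hΩ : Ω ≠ 0)
    (hv : ∀ i j, θ i (v j) = if i = j then 1 else 0) :
    ∃ u : Fin k → W, (∀ i j, θ i (u j) = 0) ∧ quotientForm hk θ Ω u ≠ 0 := by
  obtain ⟨b, hb1, hb2⟩ := exists_adapted_basis (hW.trans hk.symm) hv
  refine ⟨fun j => b (Sum.inr j), hb2, ?_⟩
  rw [quotientForm_apply hk hW Ω hv hb2]
  let b' : Module.Basis (Fin N) ℝ W := b.reindex (finSumFinEquiv.trans (finCongr hk))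
  have hb' : (b' : Fin N → W) = joinVectors hk v fun j => b (Sum.inr j) := by
    funext i
    have h3 : (b : Fin m ⊕ Fin k → W) = Sum.elim v fun j => b (Sum.inr j) := by
      funext s
      obtain s | s := s
      · exact hb1 s
      · rfl
    change b' i = Sum.elim v (fun j => b (Sum.inr j)) (finSumFinEquiv.symm ((finCongr hk).symm i))
    rw [← h3]
    simp [b']
  rw [← hb']
  exact (AlternatingMap.map_basis_ne_zero_iff b' Ω).2 hΩ

end RelativeVolume

/-! ### Smoothness of tensor fields along maps -/

section FieldsAlongMaps

open Set Filter Topology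

variable {E H : Type*} [NormedAddCommGroup E] [NormedSpace ℝ E] [TopologicalSpace H]
  {I : ModelWithCorners ℝ E H} {M : Type*} [TopologicalSpace M] [ChartedSpace H M]
  [IsManifold I ∞ M]
  {E' H' : Type*} [NormedAddCommGroup E'] [NormedSpace ℝ E'] [TopologicalSpace H']
  {J : ModelWithCorners ℝ E' H'} {N : Type*} [TopologicalSpace N] [ChartedSpace H' N]
  {E'' H'' : Type*} [NormedAddCommGroup E''] [NormedSpace ℝ E''] [TopologicalSpace H'']
  {J' : ModelWithCorners ℝ E'' H''} {N' : Type*} [TopologicalSpace N'] [ChartedSpace H'' N']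

variable (I) in
/-- The change of coordinates from the chart at `x` to the chart at `y`, on the tangent space
at `z`. -/
def chartChange (x y z : M) : E →L[ℝ] E :=
  haveI : IsManifold I 1 M := isManifold_one_of_infty
  tangentCoordChange I x y z

theorem chartChange_self {x z : M} (h : z ∈ (chartAt H x).source) :
    chartChange I x x z = ContinuousLinearMap.id ℝ E := by
  have := isManifold_one_of_infty (I := I) (M := M)
  exact ContinuousLinearMap.ext fun v =>
    tangentCoordChange_self (by rwa [extChartAt_source I])

theorem chartChange_comp {w x y z : M} (hw : z ∈ (chartAt H w).source)
    (hx : z ∈ (chartAt H x).source) (hy : z ∈ (chartAt H y).source) :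
    chartChange I x y z ∘L chartChange I w x z = chartChange I w y z := by
  have := isManifold_one_of_infty (I := I) (M := M)
  refine ContinuousLinearMap.ext fun v => tangentCoordChange_comp ⟨⟨?_, ?_⟩, ?_⟩ <;>
    rwa [extChartAt_source I]

theorem chartChange_apply_apply {x z : M} (hx : z ∈ (chartAt H x).source) (v : E) :
    chartChange I x z z (chartChange I z x z v) = v := by
  rw [← ContinuousLinearMap.comp_apply, chartChange_comp (mem_chart_source H z) hx
    (mem_chart_source H z), chartChange_self (mem_chart_source H z)]
  rfl

theorem chartChange_apply_apply' {x z : M} (hx : z ∈ (chartAt H x).source) (v : E) :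
    chartChange I z x z (chartChange I x z z v) = v := by
  rw [← ContinuousLinearMap.comp_apply, chartChange_comp hx (mem_chart_source H z) hx,
    chartChange_self hx]
  rfl

variable (I J) in
/-- The vector field `v` along the map `b` is smooth at `x₀`. -/
def SmoothVecAt (b : N → M) (v : N → E) (x₀ : N) : Prop :=
  ContMDiffAt J 𝓘(ℝ, E) ∞ (fun x => chartChange I (b x) (b x₀) (b x) (v x)) x₀

variable (I J) in
/-- The field `p` of covectors along the map `b` is smooth at `x₀`. -/
def SmoothCovAt (b : N → M) (p : N → E →L[ℝ] ℝ) (x₀ : N) : Prop :=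
  ContMDiffAt J 𝓘(ℝ, E →L[ℝ] ℝ) ∞ (fun x => p x ∘L chartChange I (b x₀) (b x) (b x)) x₀

/-- The bilinear form `G`, pulled back by `A`. -/
def pullBilin (A : E →L[ℝ] E) (G : E →L[ℝ] E →L[ℝ] ℝ) : E →L[ℝ] E →L[ℝ] ℝ :=
  (ContinuousLinearMap.compL ℝ E E ℝ).flip A ∘L G ∘L A

theorem pullBilin_apply (A : E →L[ℝ] E) (G : E →L[ℝ] E →L[ℝ] ℝ) (u : E) :
    pullBilin A G u = G (A u) ∘L A := rfl

variable (I J) in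
/-- The field `G` of bilinear forms along the map `b` is smooth at `x₀`. -/
def SmoothBilinAt (b : N → M) (G : N → E →L[ℝ] E →L[ℝ] ℝ) (x₀ : N) : Prop :=
  ContMDiffAt J 𝓘(ℝ, E →L[ℝ] E →L[ℝ] ℝ) ∞
    (fun x => pullBilin (chartChange I (b x₀) (b x) (b x)) (G x)) x₀

theorem eventually_mem_chart_source {b : N → M} {x₀ : N} (hb : ContinuousAt b x₀) :
    ∀ᶠ x in 𝓝 x₀, b x ∈ (chartAt H (b x₀)).source :=
  hb.preimage_mem_nhds (chart_source_mem_nhds H (b x₀))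

theorem SmoothVecAt.comp {b : N → M} {v : N → E} {g : N' → N} {x₀ : N'}
    (hv : SmoothVecAt I J b v (g x₀)) (hg : ContMDiffAt J' J ∞ g x₀) :
    SmoothVecAt I J' (fun x => b (g x)) (fun x => v (g x)) x₀ :=
  ContMDiffAt.comp x₀ hv hg

theorem SmoothCovAt.comp {b : N → M} {p : N → E →L[ℝ] ℝ} {g : N' → N} {x₀ : N'}
    (hp : SmoothCovAt I J b p (g x₀)) (hg : ContMDiffAt J' J ∞ g x₀) :
    SmoothCovAt I J' (fun x => b (g x)) (fun x => p (g x)) x₀ :=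
  ContMDiffAt.comp x₀ hp hg

theorem SmoothBilinAt.comp {b : N → M} {G : N → E →L[ℝ] E →L[ℝ] ℝ} {g : N' → N} {x₀ : N'}
    (hG : SmoothBilinAt I J b G (g x₀)) (hg : ContMDiffAt J' J ∞ g x₀) :
    SmoothBilinAt I J' (fun x => b (g x)) (fun x => G (g x)) x₀ :=
  ContMDiffAt.comp x₀ hG hg

theorem SmoothVecAt.add {b : N → M} {v w : N → E} {x₀ : N} (hv : SmoothVecAt I J b v x₀)
    (hw : SmoothVecAt I J b w x₀) : SmoothVecAt I J b (fun x => v x + w x) x₀ := by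
  refine (ContMDiffAt.add hv hw).congr_of_eventuallyEq (Eventually.of_forall fun x => ?_)
  exact map_add _ _ _

theorem SmoothVecAt.smul {b : N → M} {v : N → E} {f : N → ℝ} {x₀ : N}
    (hf : ContMDiffAt J 𝓘(ℝ, ℝ) ∞ f x₀) (hv : SmoothVecAt I J b v x₀) :
    SmoothVecAt I J b (fun x => f x • v x) x₀ := by
  refine (ContMDiffAt.smul hf hv).congr_of_eventuallyEq (Eventually.of_forall fun x => ?_)
  exact map_smul _ _ _

theorem SmoothVecAt.sum {ι : Type*} {s : Finset ι} {b : N → M} {v : ι → N → E} {x₀ : N}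
    (hv : ∀ i ∈ s, SmoothVecAt I J b (v i) x₀) :
    SmoothVecAt I J b (fun x => ∑ i ∈ s, v i x) x₀ := by
  refine (contMDiffAt_finsetSum hv).congr_of_eventuallyEq (Eventually.of_forall fun x => ?_)
  exact map_sum _ _ _

theorem SmoothCovAt.add {b : N → M} {p q : N → E →L[ℝ] ℝ} {x₀ : N} (hp : SmoothCovAt I J b p x₀)
    (hq : SmoothCovAt I J b q x₀) : SmoothCovAt I J b (fun x => p x + q x) x₀ :=
  (ContMDiffAt.add hp hq).congr_of_eventuallyEq (Eventually.of_forall fun _ => rfl)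

theorem SmoothCovAt.smul {b : N → M} {p : N → E →L[ℝ] ℝ} {f : N → ℝ} {x₀ : N}
    (hf : ContMDiffAt J 𝓘(ℝ, ℝ) ∞ f x₀) (hp : SmoothCovAt I J b p x₀) :
    SmoothCovAt I J b (fun x => f x • p x) x₀ :=
  (ContMDiffAt.smul hf hp).congr_of_eventuallyEq (Eventually.of_forall fun _ => rfl)

theorem SmoothCovAt.sum {ι : Type*} {s : Finset ι} {b : N → M} {p : ι → N → E →L[ℝ] ℝ} {x₀ : N}
    (hp : ∀ i ∈ s, SmoothCovAt I J b (p i) x₀) :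
    SmoothCovAt I J b (fun x => ∑ i ∈ s, p i x) x₀ := by
  refine (contMDiffAt_finsetSum hp).congr_of_eventuallyEq (Eventually.of_forall fun x => ?_)
  ext v
  simp [sum_apply]

theorem SmoothCovAt.apply {b : N → M} {p : N → E →L[ℝ] ℝ} {v : N → E} {x₀ : N}
    (hb : ContinuousAt b x₀) (hp : SmoothCovAt I J b p x₀) (hv : SmoothVecAt I J b v x₀) :
    ContMDiffAt J 𝓘(ℝ, ℝ) ∞ (fun x => p x (v x)) x₀ := by
  refine (ContMDiffAt.clm_apply hp hv).congr_of_eventuallyEq ?_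
  filter_upwards [eventually_mem_chart_source (H := H) hb] with x hx
  rw [ContinuousLinearMap.comp_apply, chartChange_apply_apply (I := I) hx]

theorem SmoothBilinAt.apply {b : N → M} {G : N → E →L[ℝ] E →L[ℝ] ℝ} {v : N → E} {x₀ : N}
    (hb : ContinuousAt b x₀) (hG : SmoothBilinAt I J b G x₀) (hv : SmoothVecAt I J b v x₀) :
    SmoothCovAt I J b (fun x => G x (v x)) x₀ := by
  refine (ContMDiffAt.clm_apply hG hv).congr_of_eventuallyEq ?_
  filter_upwards [eventually_mem_chart_source (H := H) hb] with x hx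
  rw [pullBilin_apply, chartChange_apply_apply (I := I) hx]

/-- In fixed coordinates `v` is the inverse of a smooth family of operators applied to a smooth
covector, and inversion is smooth at invertible operators. It yields the smoothness of raising an
index. -/
theorem SmoothBilinAt.solve [FiniteDimensional ℝ E] {b : N → M} {G : N → E →L[ℝ] E →L[ℝ] ℝ}
    {v : N → E} {x₀ : N} (hb : ContinuousAt b x₀) (hG : SmoothBilinAt I J b G x₀)
    (hinj : ∀ x, Function.Injective (G x)) (hv : SmoothCovAt I J b (fun x => G x (v x)) x₀) :
    SmoothVecAt I J b v x₀ := by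
  have := FiniteDimensional.complete ℝ E
  have hinv : ∀ x, b x ∈ (chartAt H (b x₀)).source →
      (pullBilin (chartChange I (b x₀) (b x) (b x)) (G x)).IsInvertible := by
    intro x hx
    refine isInvertible_of_injective _ ((injective_iff_map_eq_zero _).2 fun u hu => ?_)
    have h1 : G x (chartChange I (b x₀) (b x) (b x) u) = 0 := by
      ext w
      have h2 := DFunLike.congr_fun hu (chartChange I (b x) (b x₀) (b x) w)
      rw [pullBilin_apply, ContinuousLinearMap.comp_apply, chartChange_apply_apply (I := I) hx] at h2
      exact h2
    have h3 := (injective_iff_map_eq_zero _).1 (hinj x) _ h1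
    rw [← chartChange_apply_apply' (I := I) hx u, h3, map_zero]
  obtain ⟨e, he⟩ := hinv x₀ (mem_chart_source H (b x₀))
  have h1 : ContMDiffAt J 𝓘(ℝ, (E →L[ℝ] ℝ) →L[ℝ] E) ∞ (fun x =>
      (pullBilin (chartChange I (b x₀) (b x) (b x)) (G x)).inverse) x₀ := by
    have h2 : ContDiffAt ℝ ∞ (ContinuousLinearMap.inverse : (E →L[ℝ] E →L[ℝ] ℝ) → _)
      (pullBilin (chartChange I (b x₀) (b x₀) (b x₀)) (G x₀)) := he ▸ contDiffAt_map_inverse e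
    exact h2.contMDiffAt.comp x₀ hG
  refine (ContMDiffAt.clm_apply h1 hv).congr_of_eventuallyEq ?_
  filter_upwards [eventually_mem_chart_source (H := H) hb] with x hx
  have h2 : (G x (v x)) ∘L chartChange I (b x₀) (b x) (b x) =
      pullBilin (chartChange I (b x₀) (b x) (b x)) (G x) (chartChange I (b x) (b x₀) (b x) (v x)) := by
    rw [pullBilin_apply, chartChange_apply_apply (I := I) hx]
  rw [h2, (hinv x hx).inverse_apply_self]

theorem smoothVecAt_id_iff {X : M → E} {x₀ : M} :
    SmoothVecAt I I id X x₀ ↔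
      ContMDiffAt I I.tangent ∞ (fun x => (⟨x, X x⟩ : TangentBundle I M)) x₀ := by
  have := isManifold_one_of_infty (I := I) (M := M)
  exact (contMDiffAt_section (IB := I) (n := ∞) (F := E)
    (E := (TangentSpace I : M → Type _)) (s := fun x => (X x : TangentSpace I x)) x₀).symm

theorem smoothCovAt_scalarDeriv {f : M → ℝ} {x₀ : M} (hf : ContMDiffAt I 𝓘(ℝ, ℝ) ∞ f x₀) :
    SmoothCovAt I I id (scalarDeriv I f) x₀ := by
  have := isManifold_one_of_infty (I := I) (M := M)
  refine (hf.mfderiv_const (m := ∞) (by simp)).congr_of_eventuallyEq ?_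
  filter_upwards [chart_source_mem_nhds H x₀] with x hx
  have h3 := inTangentCoordinates_eq (I := I) (I' := 𝓘(ℝ, ℝ)) id f (mfderiv I 𝓘(ℝ, ℝ) f) hx
    (mem_chart_source ℝ (f x₀))
  rw [h3, tangentBundleCore_coordChange_model_space]
  rfl

end FieldsAlongMaps

/-! ### Natural coordinates of the cotangent bundle -/

section CotangentCoordinates

open Set Filter Topology

variable {n : ℕ} {Q : Type*} [TopologicalSpace Q] [ChartedSpace (EuclideanSpace ℝ (Fin n)) Q]
  [IsManifold (𝓡 n) ∞ Q]
  {E' H' : Type*} [NormedAddCommGroup E'] [NormedSpace ℝ E'] [TopologicalSpace H']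
  {J : ModelWithCorners ℝ E' H'} {N : Type*} [TopologicalSpace N] [ChartedSpace H' N]

/-- The point `(q, p)` of the cotangent bundle. -/
def cotangentMk (q : Q) (p : Covector n) : Cotangent n Q := ⟨q, p⟩

/-- The momentum of a point of the cotangent bundle, as a covector of the model space. -/
def fiberPart (x : Cotangent n Q) : Covector n := x.snd

theorem inCoordinates_covector {q₀ q : Q} (hq : q ∈ (chartAt (EuclideanSpace ℝ (Fin n)) q₀).source)
    (p : TangentSpace (𝓡 n) q →L[ℝ] Bundle.Trivial Q ℝ q) :
    ContinuousLinearMap.inCoordinates (EuclideanSpace ℝ (Fin n)) (TangentSpace (𝓡 n)) ℝ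
      (Bundle.Trivial Q ℝ) q₀ q q₀ q p = (p : Covector n) ∘L chartChange (𝓡 n) q₀ q q := by
  unfold ContinuousLinearMap.inCoordinates
  rw [TangentBundle.symmL_trivializationAt_eq_core hq]
  have h1 : (trivializationAt ℝ (Bundle.Trivial Q ℝ) q₀).continuousLinearMapAt ℝ q =
      ContinuousLinearMap.id ℝ ℝ := Bundle.Trivial.continuousLinearMapAt_trivialization ℝ Q ℝ q
  exact ContinuousLinearMap.ext fun v => DFunLike.congr_fun h1 _

theorem mem_cotangent_chart_source {x y : Cotangent n Q} :
    y ∈ (chartAt (ModelProd (EuclideanSpace ℝ (Fin n)) (Covector n)) x).source ↔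
      y.proj ∈ (chartAt (EuclideanSpace ℝ (Fin n)) x.proj).source := by
  simp only [FiberBundle.chartedSpace_chartAt, mfld_simps]
  exact ⟨fun h => h.1.1, fun h => ⟨⟨h, mem_univ _⟩, h⟩⟩

theorem extChartAt_cotangent {x y : Cotangent n Q}
    (h : y.proj ∈ (chartAt (EuclideanSpace ℝ (Fin n)) x.proj).source) :
    extChartAt (cotangentModel n) x y =
      (extChartAt (𝓡 n) x.proj y.proj, fiberPart y ∘L chartChange (𝓡 n) x.proj y.proj y.proj) := by
  rw [FiberBundle.extChartAt]
  refine Prod.ext ?_ ?_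
  · rfl
  · exact inCoordinates_covector h y.snd

theorem contMDiffAt_cotangent_iff {f : N → Cotangent n Q} {x₀ : N} :
    ContMDiffAt J (cotangentModel n) ∞ f x₀ ↔
      ContMDiffAt J (𝓡 n) ∞ (fun x => (f x).proj) x₀ ∧
        SmoothCovAt (𝓡 n) J (fun x => (f x).proj) (fun x => fiberPart (f x)) x₀ := by
  rw [contMDiffAt_hom_bundle]
  refine and_congr_right fun hf => ?_
  refine Filter.EventuallyEq.contMDiffAt_iff ?_
  filter_upwards [eventually_mem_chart_source (H := EuclideanSpace ℝ (Fin n)) hf.continuousAt]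
    with x hx
  exact inCoordinates_covector hx _

/-- The curve `t ↦ (q, p + t β)` in a fibre of the cotangent bundle. -/
theorem hasMFDerivAt_fiberCurve (q : Q) (p β : Covector n) (t : ℝ) :
    HasMFDerivAt 𝓘(ℝ, ℝ) (cotangentModel n) (fun s : ℝ => cotangentMk q (p + s • β)) t
      ((1 : ℝ →L[ℝ] ℝ).smulRight ((0, β) : EuclideanSpace ℝ (Fin n) × Covector n)) := by
  have hc : ContMDiffAt 𝓘(ℝ, ℝ) (cotangentModel n) ∞ (fun s : ℝ => cotangentMk q (p + s • β)) t := by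
    refine contMDiffAt_cotangent_iff.2 ⟨contMDiffAt_const, ?_⟩
    refine ContMDiffAt.clm_comp (𝕜 := ℝ) (F₂ := EuclideanSpace ℝ (Fin n)) (F₃ := ℝ) ?_
      (contMDiffAt_const (c := chartChange (𝓡 n) q q q))
    exact (contDiffAt_const.add (contDiffAt_id.smul contDiffAt_const)).contMDiffAt
  refine ⟨hc.continuousAt, ?_⟩
  have h1 : writtenInExtChartAt 𝓘(ℝ, ℝ) (cotangentModel n) t
      (fun s : ℝ => cotangentMk q (p + s • β)) =
      fun s : ℝ => (extChartAt (𝓡 n) q q, p + s • β) := by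
    funext s
    refine (extChartAt_cotangent (x := cotangentMk q (p + t • β)) (y := cotangentMk q (p + s • β))
      (mem_chart_source _ q)).trans (Prod.ext rfl ?_)
    exact (congrArg (fun A => (p + s • β) ∘L A)
      (chartChange_self (I := 𝓡 n) (mem_chart_source _ q))).trans (ContinuousLinearMap.comp_id _)
  rw [h1]
  refine HasFDerivAt.hasFDerivWithinAt ?_
  have h2 : HasDerivAt (fun s : ℝ => (extChartAt (𝓡 n) q q, p + s • β)) (0, β) t := by
    refine (hasDerivAt_const t _).prodMk ?_
    simpa using ((hasDerivAt_id t).smul_const β).const_add p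
  exact h2.hasFDerivAt

theorem hasMFDerivAt_cotangent_proj (x : Cotangent n Q) :
    HasMFDerivAt (cotangentModel n) (𝓡 n) (TotalSpace.proj : Cotangent n Q → Q) x
      (ContinuousLinearMap.fst ℝ (EuclideanSpace ℝ (Fin n)) (Covector n)) := by
  refine ⟨(contMDiff_proj (n := ∞) (IB := 𝓡 n) (F := Covector n) _).continuous.continuousAt, ?_⟩
  have key : ∀ z ∈ (extChartAt (cotangentModel n) x).target,
      writtenInExtChartAt (cotangentModel n) (𝓡 n) x TotalSpace.proj z = z.1 := fun z hz => by
    have h2 := (extChartAt (cotangentModel n) x).map_target hz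
    rw [extChartAt_source, mem_cotangent_chart_source] at h2
    exact congrArg Prod.fst ((extChartAt_cotangent h2).symm.trans
      ((extChartAt (cotangentModel n) x).right_inv hz))
  refine (ContinuousLinearMap.hasFDerivAt (ContinuousLinearMap.fst ℝ (EuclideanSpace ℝ (Fin n))
    (Covector n))).hasFDerivWithinAt.congr_of_eventuallyEq ?_ (key _ (mem_extChartAt_target x))
  filter_upwards [extChartAt_target_mem_nhdsWithin (I := cotangentModel n) x] with z hz
  exact key z hz

instance [T2Space Q] : T2Space (Cotangent n Q) := by
  have hpc : Continuous (TotalSpace.proj : Cotangent n Q → Q) :=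
    (contMDiff_proj (n := ∞) (IB := 𝓡 n) (F := Covector n) _).continuous
  refine ⟨fun x y hxy => ?_⟩
  by_cases h : x.proj = y.proj
  · have hy : y ∈ (extChartAt (cotangentModel n) x).source := by
      rw [extChartAt_source, mem_cotangent_chart_source, ← h]
      exact mem_chart_source _ _
    have hx := mem_extChartAt_source (I := cotangentModel n) x
    have hne : extChartAt (cotangentModel n) x x ≠ extChartAt (cotangentModel n) x y :=
      fun he => hxy ((extChartAt (cotangentModel n) x).injOn hx hy he)
    obtain ⟨u, v, hu, hv, hxu, hyv, huv⟩ := t2_separation hne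
    have hc := continuousOn_extChartAt (I := cotangentModel n) x
    have ho := isOpen_extChartAt_source (I := cotangentModel n) x
    exact ⟨_, _, hc.isOpen_inter_preimage ho hu, hc.isOpen_inter_preimage ho hv, ⟨hx, hxu⟩,
      ⟨hy, hyv⟩, (huv.preimage _).mono inter_subset_right inter_subset_right⟩
  · obtain ⟨u, v, hu, hv, hxu, hyv, huv⟩ := t2_separation h
    exact ⟨_, _, hu.preimage hpc, hv.preimage hpc, hxu, hyv, huv.preimage _⟩

instance [SecondCountableTopology Q] : SecondCountableTopology (Cotangent n Q) := by
  obtain ⟨s, hs, hsu⟩ := TopologicalSpace.countable_cover_nhds (α := Q)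
    (fun q => chart_source_mem_nhds (EuclideanSpace ℝ (Fin n)) q)
  have : SecondCountableTopology (ModelProd (EuclideanSpace ℝ (Fin n)) (Covector n)) :=
    inferInstanceAs (SecondCountableTopology (EuclideanSpace ℝ (Fin n) × Covector n))
  refine ChartedSpace.secondCountable_of_countable_cover
    (ModelProd (EuclideanSpace ℝ (Fin n)) (Covector n)) (M := Cotangent n Q)
    -- One point in each fibre suffices, because a chart domain of the bundle is the full preimage
    -- of a chart domain of `Q`.
    (s := (fun q => cotangentMk q 0) '' s) ?_ (hs.image _)
  refine eq_univ_of_forall fun x => ?_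
  obtain ⟨q, hq, hx⟩ := mem_iUnion₂.1 (hsu ▸ mem_univ x.proj :
    x.proj ∈ ⋃ q ∈ s, (chartAt (EuclideanSpace ℝ (Fin n)) q).source)
  exact mem_iUnion₂.2 ⟨_, mem_image_of_mem _ hq, mem_cotangent_chart_source.2 hx⟩

end CotangentCoordinates

/-! ### Coordinate changes are symplectic; duality by the symplectic form -/

section Symplectic

open Set Filter Topology

variable {n : ℕ} {Q : Type*} [TopologicalSpace Q] [ChartedSpace (EuclideanSpace ℝ (Fin n)) Q]
  [IsManifold (𝓡 n) ∞ Q]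
  {E' H' : Type*} [NormedAddCommGroup E'] [NormedSpace ℝ E'] [TopologicalSpace H']
  {J : ModelWithCorners ℝ E' H'} {N : Type*} [TopologicalSpace N] [ChartedSpace H' N]

theorem hasFDerivAt_chartChange {E H : Type*} [NormedAddCommGroup E] [NormedSpace ℝ E]
    [TopologicalSpace H] {I : ModelWithCorners ℝ E H} [I.Boundaryless] {M : Type*}
    [TopologicalSpace M] [ChartedSpace H M] [IsManifold I ∞ M] {x y z : M}
    (hx : z ∈ (chartAt H x).source) (hy : z ∈ (chartAt H y).source) :
    HasFDerivAt (extChartAt I y ∘ (extChartAt I x).symm) (chartChange I x y z)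
      (extChartAt I x z) := by
  have := isManifold_one_of_infty (I := I) (M := M)
  have h1 := hasFDerivWithinAt_tangentCoordChange (I := I) (x := x) (y := y) (z := z)
    ⟨by rwa [extChartAt_source], by rwa [extChartAt_source]⟩
  rwa [I.range_eq_univ, hasFDerivWithinAt_univ] at h1

theorem contDiffAt_chartChange {E H : Type*} [NormedAddCommGroup E] [NormedSpace ℝ E]
    [TopologicalSpace H] {I : ModelWithCorners ℝ E H} [I.Boundaryless] {M : Type*}
    [TopologicalSpace M] [ChartedSpace H M] [IsManifold I ∞ M] {x y z : M}
    (hx : z ∈ (chartAt H x).source) (hy : z ∈ (chartAt H y).source) :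
    ContDiffAt ℝ ∞ (extChartAt I y ∘ (extChartAt I x).symm) (extChartAt I x z) := by
  rw [← contMDiffAt_iff_contDiffAt]
  have h1 : z ∈ (extChartAt I x).source := by rwa [extChartAt_source]
  refine ContMDiffAt.comp (I' := I) (extChartAt I x z) ?_
    ((contMDiffOn_extChartAt_symm x).contMDiffAt
      ((isOpen_extChartAt_target x).mem_nhds ((extChartAt I x).map_source h1)))
  rw [(extChartAt I x).left_inv h1]
  exact (contMDiffOn_extChartAt (I := I) (x := y)).contMDiffAt
    ((chartAt H y).open_source.mem_nhds hy)

/-- The differential of the lift of a map to the cotangent bundle. -/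
theorem hasFDerivAt_cotangentLift {E : Type*} [NormedAddCommGroup E] [NormedSpace ℝ E]
    {κ : E → E} {Ψ : E × (E →L[ℝ] ℝ) → E × (E →L[ℝ] ℝ)} {z₀ : E × (E →L[ℝ] ℝ)}
    {C : E × (E →L[ℝ] ℝ) →L[ℝ] E × (E →L[ℝ] ℝ)} (hκ : ContDiffAt ℝ ∞ κ z₀.1)
    (hΨ : HasFDerivAt Ψ C z₀)
    (hev : ∀ᶠ z in 𝓝 z₀, (Ψ z).1 = κ z.1 ∧ (Ψ z).2 ∘L fderiv ℝ κ z.1 = z.2) :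
    (∀ v, (C v).1 = fderiv ℝ κ z₀.1 v.1) ∧ ∃ S : E →L[ℝ] (E →L[ℝ] ℝ), (∀ a b, S a b = S b a) ∧
      ∀ v, S v.1 + (C v).2 ∘L fderiv ℝ κ z₀.1 = v.2 := by
  have hT1 : HasFDerivAt (fun z => (Ψ z).1) (ContinuousLinearMap.fst ℝ E (E →L[ℝ] ℝ) ∘L C) z₀ :=
    hasFDerivAt_fst.comp _ hΨ
  have hT2 : HasFDerivAt (fun z => (Ψ z).2) (ContinuousLinearMap.snd ℝ E (E →L[ℝ] ℝ) ∘L C) z₀ :=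
    hasFDerivAt_snd.comp _ hΨ
  have hκ1 : HasFDerivAt (fun z : E × (E →L[ℝ] ℝ) => κ z.1)
      (fderiv ℝ κ z₀.1 ∘L ContinuousLinearMap.fst ℝ E (E →L[ℝ] ℝ)) z₀ :=
    (hκ.differentiableAt (by simp)).hasFDerivAt.comp _ hasFDerivAt_fst
  have hκ2 : HasFDerivAt (fun z : E × (E →L[ℝ] ℝ) => fderiv ℝ κ z.1)
      (fderiv ℝ (fderiv ℝ κ) z₀.1 ∘L ContinuousLinearMap.fst ℝ E (E →L[ℝ] ℝ)) z₀ :=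
    HasFDerivAt.comp (g := fderiv ℝ κ) z₀
      ((hκ.fderiv_right (m := 1) (by norm_cast)).differentiableAt (by simp)).hasFDerivAt
      hasFDerivAt_fst
  -- The operator `S` is the second derivative of `κ` contracted with the momentum. Its symmetry is
  -- what makes the lift symplectic.
  have hsym : ∀ a b, fderiv ℝ (fderiv ℝ κ) z₀.1 a b = fderiv ℝ (fderiv ℝ κ) z₀.1 b a :=
    hκ.isSymmSndFDerivAt (by simp only [minSmoothness_of_isRCLikeNormedField]; exact WithTop.coe_le_coe.2 le_top)
  refine ⟨fun v => ?_, (ContinuousLinearMap.compL ℝ E E ℝ (Ψ z₀).2) ∘L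
    fderiv ℝ (fderiv ℝ κ) z₀.1, fun a b => congrArg _ (hsym a b), fun v => ?_⟩
  · exact DFunLike.congr_fun ((hT1.congr_of_eventuallyEq (hev.mono fun z hz => hz.1.symm)).unique
      hκ1) v
  · have h3 := (hT2.clm_comp hκ2).congr_of_eventuallyEq (hev.mono fun z hz => hz.2.symm)
    exact DFunLike.congr_fun (h3.unique hasFDerivAt_snd) v

/-- The differential of a change of coordinates of the cotangent bundle. -/
theorem exists_chartChange_cotangent {x y w : Cotangent n Q}
    (hx : w.proj ∈ (chartAt (EuclideanSpace ℝ (Fin n)) x.proj).source)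
    (hy : w.proj ∈ (chartAt (EuclideanSpace ℝ (Fin n)) y.proj).source) :
    (∀ v, (chartChange (cotangentModel n) x y w v).1 =
      chartChange (𝓡 n) x.proj y.proj w.proj v.1) ∧
    ∃ S : EuclideanSpace ℝ (Fin n) →L[ℝ] Covector n, (∀ a b, S a b = S b a) ∧
      ∀ v, S v.1 + (chartChange (cotangentModel n) x y w v).2 ∘L
        chartChange (𝓡 n) x.proj y.proj w.proj = v.2 := by
  set C := chartChange (cotangentModel n) x y w with hC
  set D := chartChange (𝓡 n) x.proj y.proj w.proj with hD
  set φ := extChartAt (cotangentModel n) x with hφ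
  set ψ := extChartAt (cotangentModel n) y with hψ
  set κ : EuclideanSpace ℝ (Fin n) → EuclideanSpace ℝ (Fin n) :=
    extChartAt (𝓡 n) y.proj ∘ (extChartAt (𝓡 n) x.proj).symm with hκ
  have hT : HasFDerivAt (ψ ∘ φ.symm) C (φ w) :=
    hasFDerivAt_chartChange (mem_cotangent_chart_source.2 hx) (mem_cotangent_chart_source.2 hy)
  have hwφ : w ∈ φ.source := by
    rw [hφ, extChartAt_source]; exact mem_cotangent_chart_source.2 hx
  have hφw : (φ w).1 = extChartAt (𝓡 n) x.proj w.proj :=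
    congrArg Prod.fst (extChartAt_cotangent hx)
  have hκd : ContDiffAt ℝ ∞ κ (φ w).1 := hφw ▸ contDiffAt_chartChange hx hy
  have hκ' : fderiv ℝ κ (φ w).1 = D := hφw ▸ (hasFDerivAt_chartChange hx hy).fderiv
  have hev : ∀ᶠ z in 𝓝 (φ w), ((ψ ∘ φ.symm) z).1 = κ z.1 ∧
      ((ψ ∘ φ.symm) z).2 ∘L fderiv ℝ κ z.1 = z.2 := by
    have h1 : ∀ᶠ z in 𝓝 (φ w), z ∈ φ.target :=
      (isOpen_extChartAt_target x).mem_nhds (φ.map_source hwφ)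
    have h2 : ∀ᶠ z in 𝓝 (φ w), φ.symm z ∈ ψ.source := by
      refine ((continuousOn_extChartAt_symm x).continuousAt h1).preimage_mem_nhds
        ((isOpen_extChartAt_source y).mem_nhds ?_)
      rw [← hφ, φ.left_inv hwφ, extChartAt_source]
      exact mem_cotangent_chart_source.2 hy
    filter_upwards [h1, h2] with z hz1 hz2
    have hx' := φ.map_target hz1
    rw [hφ, extChartAt_source, mem_cotangent_chart_source, ← hφ] at hx'
    rw [hψ, extChartAt_source, mem_cotangent_chart_source] at hz2
    have e1 : z = _ := (φ.right_inv hz1).symm.trans (extChartAt_cotangent hx')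
    have e2 : (ψ ∘ φ.symm) z = _ := extChartAt_cotangent hz2
    have hsrc : (φ.symm z).proj ∈ (extChartAt (𝓡 n) x.proj).source := by rwa [extChartAt_source]
    have e3 : z.1 = extChartAt (𝓡 n) x.proj (φ.symm z).proj := congrArg Prod.fst e1
    have e4 : z.2 = _ := congrArg Prod.snd e1
    rw [e2]
    refine ⟨?_, ?_⟩
    · rw [e3, hκ, Function.comp_apply, (extChartAt (𝓡 n) x.proj).left_inv hsrc]
    · have e5 : fderiv ℝ κ z.1 = chartChange (𝓡 n) x.proj y.proj (φ.symm z).proj := by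
        rw [e3]
        exact (hasFDerivAt_chartChange hx' hz2).fderiv
      refine Eq.trans ?_ e4.symm
      rw [e5, ContinuousLinearMap.comp_assoc, chartChange_comp hx' hz2 (mem_chart_source _ _)]
  have key := hasFDerivAt_cotangentLift hκd hT hev
  rwa [hκ'] at key

/-- The shear enters as `S u₁ v₁ - S v₁ u₁`, which vanishes by symmetry; the remaining part
preserves the pairing of vectors and covectors. -/
theorem symplectic_chartChange {x y w : Cotangent n Q}
    (hx : w.proj ∈ (chartAt (EuclideanSpace ℝ (Fin n)) x.proj).source)
    (hy : w.proj ∈ (chartAt (EuclideanSpace ℝ (Fin n)) y.proj).source)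
    (u v : EuclideanSpace ℝ (Fin n) × Covector n) :
    coordinateSymplecticForm n ![chartChange (cotangentModel n) x y w u,
      chartChange (cotangentModel n) x y w v] = coordinateSymplecticForm n ![u, v] := by
  obtain ⟨h1, S, hS, h2⟩ := exists_chartChange_cotangent hx hy
  rw [coordinateSymplecticForm_apply, coordinateSymplecticForm_apply]
  simp only [Matrix.cons_val_zero, Matrix.cons_val_one]
  rw [h1, h1]
  have h3 := DFunLike.congr_fun (h2 v) u.1
  have h4 := DFunLike.congr_fun (h2 u) v.1
  simp only [add_apply, ContinuousLinearMap.comp_apply] at h3 h4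
  rw [← h3, ← h4, hS u.1 v.1]
  ring

/-- The subspace `0 × V'` is preserved, with `B` acting on it and `R` on the quotient. -/
theorem det_eq_of_block {V V' : Type*} [AddCommGroup V] [Module ℝ V] [FiniteDimensional ℝ V]
    [AddCommGroup V'] [Module ℝ V'] [FiniteDimensional ℝ V'] {K : V × V' →ₗ[ℝ] V × V'}
    {R : V →ₗ[ℝ] V} {B : V' →ₗ[ℝ] V'} (hR : ∀ v, (K v).1 = R v.1)
    (hB : ∀ b, K (0, b) = (0, B b)) : K.det = R.det * B.det := by
  let W : Submodule ℝ (V × V') := LinearMap.ker (LinearMap.fst ℝ V V')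
  have hW : W ≤ W.comap K := fun v hv => by
    have hv' : v.1 = 0 := hv
    change (K v).1 = 0
    rw [hR, hv', map_zero]
  rw [LinearMap.det_eq_det_mul_det W K hW, mul_comm]
  congr 1
  · let e : ((V × V') ⧸ W) ≃ₗ[ℝ] V :=
      (LinearMap.fst ℝ V V').quotKerEquivOfSurjective LinearMap.fst_surjective
    rw [← LinearMap.det_conj R e.symm]
    congr 1
    refine Submodule.linearMap_qext _ (LinearMap.ext fun v => ?_)
    apply e.injective
    change (K v).1 = e (e.symm (R (e (Submodule.Quotient.mk v))))
    rw [LinearEquiv.apply_symm_apply, hR]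
    rfl
  · let e : V' ≃ₗ[ℝ] W :=
      { toFun := fun b => ⟨(0, b), rfl⟩
        map_add' := fun a b => Subtype.ext (by simp)
        map_smul' := fun c b => Subtype.ext (by simp)
        invFun := fun w => w.1.2
        left_inv := fun b => rfl
        right_inv := fun w => Subtype.ext (Prod.ext (show (0 : V) = w.1.1 from
          (show w.1.1 = 0 from w.2).symm) rfl) }
    rw [← LinearMap.det_conj B e]
    congr 1
    refine LinearMap.ext fun w => Subtype.ext ?_
    have hw : (w : V × V') = (0, w.1.2) := Prod.ext (show w.1.1 = 0 from w.2) rfl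
    change K w = (0, B w.1.2)
    rw [hw, hB]

theorem det_precomp (A : EuclideanSpace ℝ (Fin n) →L[ℝ] EuclideanSpace ℝ (Fin n)) :
    LinearMap.det (M := Covector n)
      ((ContinuousLinearMap.compL ℝ (EuclideanSpace ℝ (Fin n)) _ ℝ).flip A).toLinearMap = A.det := by
  let e : Module.Dual ℝ (EuclideanSpace ℝ (Fin n)) ≃ₗ[ℝ] Covector n :=
    LinearMap.toContinuousLinearMap
  refine Eq.trans ?_ (LinearMap.det_dualMap A.toLinearMap)
  rw [← LinearMap.det_conj (LinearMap.dualMap A.toLinearMap) e]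
  congr 1

/-- The diagonal blocks are the coordinate change `D` of the base and its inverse transpose. -/
theorem det_chartChange_cotangent {x y w : Cotangent n Q}
    (hx : w.proj ∈ (chartAt (EuclideanSpace ℝ (Fin n)) x.proj).source)
    (hy : w.proj ∈ (chartAt (EuclideanSpace ℝ (Fin n)) y.proj).source) :
    (chartChange (cotangentModel n) x y w).det = 1 := by
  obtain ⟨h1, S, hS, h2⟩ := exists_chartChange_cotangent hx hy
  set C := chartChange (cotangentModel n) x y w
  set D := chartChange (𝓡 n) x.proj y.proj w.proj
  let B : Covector n →ₗ[ℝ] Covector n :=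
    (ContinuousLinearMap.snd ℝ (EuclideanSpace ℝ (Fin n)) (Covector n) ∘L C ∘L
      ContinuousLinearMap.inr ℝ (EuclideanSpace ℝ (Fin n)) (Covector n)).toLinearMap
  have h3 : C.det = D.det * B.det :=
    det_eq_of_block (K := C.toLinearMap) (R := D.toLinearMap) h1 fun b =>
      Prod.ext ((h1 (0, b)).trans (map_zero D)) rfl
  have h4 : ((ContinuousLinearMap.compL ℝ (EuclideanSpace ℝ (Fin n)) _ ℝ).flip D).toLinearMap ∘ₗ B =
      LinearMap.id := by
    refine LinearMap.ext fun b => ?_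
    have h5 := h2 (0, b)
    simp only [map_zero, zero_add] at h5
    exact h5
  rw [h3, ← det_precomp D, ← LinearMap.det_comp, h4, LinearMap.det_id]

/-- The vector which corresponds to a covector by means of the symplectic form. -/
def symplecticDual (α : (EuclideanSpace ℝ (Fin n) × Covector n) →L[ℝ] ℝ) :
    EuclideanSpace ℝ (Fin n) × Covector n :=
  (∑ i, α ((0 : EuclideanSpace ℝ (Fin n)), (EuclideanSpace.proj i : Covector n)) •
    EuclideanSpace.single i (1 : ℝ),
    -(α ∘L ContinuousLinearMap.inl ℝ (EuclideanSpace ℝ (Fin n)) (Covector n)))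

theorem covector_eq_sum (d : Covector n) :
    d = ∑ i, d (EuclideanSpace.single i (1 : ℝ)) • (EuclideanSpace.proj i : Covector n) := by
  ext a
  conv_lhs => rw [← (EuclideanSpace.basisFun (Fin n) ℝ).sum_repr a]
  simp [mul_comm, sum_apply]

theorem apply_symplecticDual_fst (α : (EuclideanSpace ℝ (Fin n) × Covector n) →L[ℝ] ℝ)
    (d : Covector n) : d (symplecticDual α).1 = α (0, d) := by
  have h1 : α (0, d) = (α ∘L ContinuousLinearMap.inr ℝ (EuclideanSpace ℝ (Fin n)) (Covector n)) d :=
    rfl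
  rw [h1]
  conv_rhs => rw [covector_eq_sum d, map_sum]
  change d (∑ i, α (0, EuclideanSpace.proj i) • EuclideanSpace.single i (1 : ℝ)) = _
  rw [map_sum]
  refine Finset.sum_congr rfl fun i _ => ?_
  rw [map_smul, map_smul, smul_eq_mul, smul_eq_mul, mul_comm]
  rfl

theorem symplecticDual_snd (α : (EuclideanSpace ℝ (Fin n) × Covector n) →L[ℝ] ℝ)
    (a : EuclideanSpace ℝ (Fin n)) : (symplecticDual α).2 a = -α (a, 0) := rfl

theorem coordinateSymplecticForm_symplecticDual
    (α : (EuclideanSpace ℝ (Fin n) × Covector n) →L[ℝ] ℝ)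
    (w : EuclideanSpace ℝ (Fin n) × Covector n) :
    coordinateSymplecticForm n ![symplecticDual α, w] = α w := by
  rw [coordinateSymplecticForm_apply]
  simp only [Matrix.cons_val_zero, Matrix.cons_val_one]
  rw [apply_symplecticDual_fst, symplecticDual_snd, sub_neg_eq_add, ← map_add]
  simp

theorem eq_symplecticDual {u : EuclideanSpace ℝ (Fin n) × Covector n}
    {α : (EuclideanSpace ℝ (Fin n) × Covector n) →L[ℝ] ℝ}
    (h : ∀ w, coordinateSymplecticForm n ![u, w] = α w) : u = symplecticDual α := by
  have h1 : ∀ w : EuclideanSpace ℝ (Fin n) × Covector n,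
      w.2 u.1 - u.2 w.1 = w.2 (symplecticDual α).1 - (symplecticDual α).2 w.1 := by
    intro w
    have h2 := (h w).trans (coordinateSymplecticForm_symplecticDual α w).symm
    rw [coordinateSymplecticForm_apply, coordinateSymplecticForm_apply] at h2
    exact h2
  refine Prod.ext ?_ (ContinuousLinearMap.ext fun a => ?_)
  · ext i
    have h2 := h1 (0, EuclideanSpace.proj i)
    simpa using h2
  · have h2 := h1 (a, 0)
    simpa using h2

/-- Since coordinate changes are symplectic, they commute with taking duals. In a fixed chart the
dual is therefore a constant linear map applied to smooth components. -/
theorem SmoothCovAt.symplecticDual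
    {α : Cotangent n Q → (EuclideanSpace ℝ (Fin n) × Covector n) →L[ℝ] ℝ} {x₀ : Cotangent n Q}
    (hα : SmoothCovAt (cotangentModel n) (cotangentModel n) id α x₀) :
    SmoothVecAt (cotangentModel n) (cotangentModel n) id
      (fun x => ImpactMechanics.symplecticDual (α x)) x₀ := by
  have h1 : ContMDiffAt (cotangentModel n) 𝓘(ℝ, EuclideanSpace ℝ (Fin n) × Covector n) ∞
      (fun x => ImpactMechanics.symplecticDual
        (α x ∘L chartChange (cotangentModel n) x₀ x x)) x₀ := by
    refine ContMDiffAt.prodMk_space (contMDiffAt_finsetSum fun i _ => ?_) ?_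
    · exact (hα.clm_apply contMDiffAt_const).smul contMDiffAt_const
    · exact (hα.clm_comp contMDiffAt_const).neg
  refine h1.congr_of_eventuallyEq ?_
  filter_upwards [chart_source_mem_nhds (ModelProd (EuclideanSpace ℝ (Fin n)) (Covector n)) x₀]
    with x hx
  have hx' := mem_cotangent_chart_source.1 hx
  refine eq_symplecticDual fun w => ?_
  have h2 := chartChange_apply_apply' (I := cotangentModel n) hx w
  rw [← h2]
  refine (symplectic_chartChange (mem_chart_source _ _) hx' _ _).trans ?_
  rw [coordinateSymplecticForm_symplecticDual, ContinuousLinearMap.comp_apply, h2]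

theorem SmoothCovAt.comp_fst {η : Q → Covector n} {x₀ : Cotangent n Q}
    (hη : SmoothCovAt (𝓡 n) (𝓡 n) id η x₀.proj) :
    SmoothCovAt (cotangentModel n) (cotangentModel n) id
      (fun x : Cotangent n Q => η x.proj ∘L
        ContinuousLinearMap.fst ℝ (EuclideanSpace ℝ (Fin n)) (Covector n)) x₀ := by
  have h1 : ContMDiffAt (cotangentModel n) 𝓘(ℝ, Covector n) ∞ (fun x : Cotangent n Q =>
      η x.proj ∘L chartChange (𝓡 n) x₀.proj x.proj x.proj) x₀ :=
    hη.comp (contMDiff_proj (n := ∞) (IB := 𝓡 n) (F := Covector n) _).contMDiffAt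
  refine (h1.clm_comp (contMDiffAt_const
    (c := ContinuousLinearMap.fst ℝ (EuclideanSpace ℝ (Fin n)) (Covector n)))).congr_of_eventuallyEq ?_
  filter_upwards [chart_source_mem_nhds (ModelProd (EuclideanSpace ℝ (Fin n)) (Covector n)) x₀]
    with x hx
  have h2 := (exists_chartChange_cotangent (mem_cotangent_chart_source.1 hx)
    (mem_chart_source (EuclideanSpace ℝ (Fin n)) x.proj)).1
  exact ContinuousLinearMap.ext fun v => congrArg (η x.proj) (h2 v)

end Symplectic

/-! ### Linear algebra of the constraints at one point -/

section ConstraintAlgebra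

variable {V : Type*} [NormedAddCommGroup V] [NormedSpace ℝ V] {m : ℕ}

/-- A positive definite symmetric bilinear form with its inverse, and linearly independent
covectors. -/
structure IsConstraintData (G : V →L[ℝ] V →L[ℝ] ℝ) (σ : (V →L[ℝ] ℝ) →L[ℝ] V)
    (e : Fin m → V →L[ℝ] ℝ) : Prop where
  symm : ∀ u v, G u v = G v u
  pos : ∀ u, u ≠ 0 → 0 < G u u
  flat_sharp : ∀ p, G (σ p) = p
  independent : LinearIndependent ℝ e

variable {G : V →L[ℝ] V →L[ℝ] ℝ} {σ : (V →L[ℝ] ℝ) →L[ℝ] V} {e : Fin m → V →L[ℝ] ℝ}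

/-- The Gram matrix of the covectors `e`. -/
def gramMatrix (σ : (V →L[ℝ] ℝ) →L[ℝ] V) (e : Fin m → V →L[ℝ] ℝ) : Matrix (Fin m) (Fin m) ℝ :=
  Matrix.of fun a b => e a (σ (e b))

namespace IsConstraintData

variable (hG : IsConstraintData G σ e)
include hG

theorem eq_zero {u : V} (hu : G u u = 0) : u = 0 := by
  by_contra h
  exact (hG.pos u h).ne' hu

theorem injective : Function.Injective G :=
  (injective_iff_map_eq_zero G).2 fun u hu => hG.eq_zero (by rw [hu]; rfl)

theorem sharp_flat (u : V) : σ (G u) = u := hG.injective (hG.flat_sharp _)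

theorem apply_sharp (p r : V →L[ℝ] ℝ) : p (σ r) = r (σ p) := by
  conv_lhs => rw [← hG.flat_sharp p]
  rw [hG.symm, hG.flat_sharp]

/-- If `c` is in the kernel, the vector `∑ c_b σ(e_b)` is annihilated by all `e_a`, hence orthogonal
to itself and zero. Independence of the `e_a` gives `c = 0`. -/
theorem isUnit_det_gramMatrix : IsUnit (gramMatrix σ e).det := by
  rw [← Matrix.isUnit_iff_isUnit_det, ← Matrix.mulVec_injective_iff_isUnit]
  refine (injective_iff_map_eq_zero (gramMatrix σ e).mulVecLin).2 fun c hc => ?_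
  have h1 : ∀ a, e a (∑ b, c b • σ (e b)) = 0 := fun a => by
    have h2 := congrFun hc a
    rw [map_sum]
    simp only [map_smul, smul_eq_mul]
    exact (Finset.sum_congr rfl fun b _ => mul_comm _ _).trans h2
  have h2 : ∑ b, c b • σ (e b) = 0 := hG.eq_zero (by
    conv_lhs => enter [1]; rw [map_sum]
    rw [sum_apply]
    refine Finset.sum_eq_zero fun a _ => ?_
    rw [map_smul, smul_apply, hG.flat_sharp, h1, smul_zero])
  have h3 : ∑ b, c b • e b = 0 := by
    have h4 := congrArg G h2
    rw [map_sum, map_zero] at h4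
    rw [← h4]
    exact Finset.sum_congr rfl fun b _ => by rw [map_smul, hG.flat_sharp]
  exact funext (Fintype.linearIndependent_iff.1 hG.independent c h3)

theorem sum_inv_mul (a b : Fin m) :
    ∑ c, (gramMatrix σ e)⁻¹ a c * gramMatrix σ e c b = if a = b then 1 else 0 := by
  rw [← Matrix.mul_apply, Matrix.nonsing_inv_mul _ hG.isUnit_det_gramMatrix, Matrix.one_apply]

theorem sum_mul_inv (a b : Fin m) :
    ∑ c, gramMatrix σ e a c * (gramMatrix σ e)⁻¹ c b = if a = b then 1 else 0 := by
  rw [← Matrix.mul_apply, Matrix.mul_nonsing_inv _ hG.isUnit_det_gramMatrix, Matrix.one_apply]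

theorem sum_inv_solve (y : Fin m → ℝ) (a : Fin m) :
    ∑ b, gramMatrix σ e a b * ∑ c, (gramMatrix σ e)⁻¹ b c * y c = y a := by
  simp only [Finset.mul_sum, ← mul_assoc]
  rw [Finset.sum_comm]
  simp only [← Finset.sum_mul, hG.sum_mul_inv, ite_mul, one_mul, zero_mul, Finset.sum_ite_eq,
    Finset.mem_univ, if_true]

theorem eq_of_gramMatrix_mulVec {y c : Fin m → ℝ} (h : ∀ a, ∑ b, gramMatrix σ e a b * c b = y a)
    (b : Fin m) : c b = ∑ a, (gramMatrix σ e)⁻¹ b a * y a := by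
  simp only [← h, Finset.mul_sum, ← mul_assoc]
  rw [Finset.sum_comm]
  simp only [← Finset.sum_mul, hG.sum_inv_mul, ite_mul, one_mul, zero_mul, Finset.sum_ite_eq,
    Finset.mem_univ, if_true]

end IsConstraintData

end ConstraintAlgebra

/-! ### Smoothness of inverse matrices -/

section Smoothness

open Set Filter Topology

variable {E H : Type*} [NormedAddCommGroup E] [NormedSpace ℝ E] [TopologicalSpace H]
  {I : ModelWithCorners ℝ E H} {M : Type*} [TopologicalSpace M] [ChartedSpace H M]

theorem contMDiffAt_finsetProd_real {ι : Type*} {s : Finset ι} {f : ι → M → ℝ} {x : M}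
    (hf : ∀ i ∈ s, ContMDiffAt I 𝓘(ℝ, ℝ) ∞ (f i) x) :
    ContMDiffAt I 𝓘(ℝ, ℝ) ∞ (fun y => ∏ i ∈ s, f i y) x := by
  classical
  induction s using Finset.induction_on with
  | empty => simpa using contMDiffAt_const
  | insert i s hi ih =>
    simp only [Finset.prod_insert hi]
    exact (hf i (Finset.mem_insert_self i s)).smul
      (ih fun j hj => hf j (Finset.mem_insert_of_mem hj))

theorem contMDiffAt_det {m : ℕ} {A : M → Matrix (Fin m) (Fin m) ℝ} {x : M}
    (hA : ∀ a b, ContMDiffAt I 𝓘(ℝ, ℝ) ∞ (fun y => A y a b) x) :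
    ContMDiffAt I 𝓘(ℝ, ℝ) ∞ (fun y => (A y).det) x := by
  simp only [Matrix.det_apply']
  refine contMDiffAt_finsetSum fun τ _ => ?_
  have h1 : ContMDiffAt I 𝓘(ℝ, ℝ) ∞ (fun _ : M => ((Equiv.Perm.sign τ : ℤ) : ℝ)) x :=
    contMDiffAt_const
  exact h1.smul (contMDiffAt_finsetProd_real (f := fun i y => A y (τ i) i) fun i _ => hA (τ i) i)

/-- Cramer's rule expresses the entry through determinants, which are polynomial. -/
theorem contMDiffAt_inv_apply {m : ℕ} {A : M → Matrix (Fin m) (Fin m) ℝ} {x : M}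
    (hA : ∀ a b, ContMDiffAt I 𝓘(ℝ, ℝ) ∞ (fun y => A y a b) x) (h : (A x).det ≠ 0) (a b : Fin m) :
    ContMDiffAt I 𝓘(ℝ, ℝ) ∞ (fun y => (A y)⁻¹ a b) x := by
  have h1 : ∀ y, (A y)⁻¹ a b = (A y).det⁻¹ • ((A y).updateRow b (Pi.single a 1)).det := fun y => by
    rw [Matrix.inv_def, Matrix.smul_apply, Matrix.adjugate_apply, Ring.inverse_eq_inv']
  simp only [h1]
  refine ((contMDiffAt_det hA).inv₀ h).smul (contMDiffAt_det fun c d => ?_)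
  by_cases hc : c = b
  · subst hc
    simp only [Matrix.updateRow_self]
    exact contMDiffAt_const
  · simp only [Matrix.updateRow_ne hc]
    exact hA c d

end Smoothness

/-! ### Metric and constraint momenta on the cotangent bundle -/

section Mechanics

open Set Filter Topology

variable {n m : ℕ} {Q : Type*} [TopologicalSpace Q] [ChartedSpace (EuclideanSpace ℝ (Fin n)) Q]
  [IsManifold (𝓡 n) ∞ Q] (L : NaturalLagrangian n Q)
  {η : Fin m → (q : Q) → TangentSpace (𝓡 n) q →L[ℝ] ℝ}

/-- The metric as a field of bilinear forms on the model space. -/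
def NaturalLagrangian.flat (q : Q) : EuclideanSpace ℝ (Fin n) →L[ℝ] Covector n := L.fiberDeriv q

/-- The inverse of the metric, on the model space. -/
def NaturalLagrangian.raise (q : Q) : Covector n →L[ℝ] EuclideanSpace ℝ (Fin n) := L.sharp q

/-- The value of a one-form, as a covector of the model space. -/
def covectorAt (η : (q : Q) → TangentSpace (𝓡 n) q →L[ℝ] ℝ) (q : Q) : Covector n := η q

theorem IsRegularRealization.constraintData (hη : IsRegularRealization η) (q : Q) :
    IsConstraintData (L.flat q) (L.raise q) fun a => covectorAt (η a) q where
  symm := L.metric.symm q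
  pos := L.metric.pos q
  flat_sharp := L.fiberDeriv_sharp q
  independent := hη.independent q

/-- The case of no constraints, from which the facts about the metric alone are drawn. -/
theorem NaturalLagrangian.constraintData (q : Q) :
    IsConstraintData (L.flat q) (L.raise q) fun a : Fin 0 => a.elim0 where
  symm := L.metric.symm q
  pos := L.metric.pos q
  flat_sharp := L.fiberDeriv_sharp q
  independent := linearIndependent_empty_type

theorem NaturalLagrangian.smooth_flat (q₀ : Q) :
    SmoothBilinAt (𝓡 n) (𝓡 n) id L.flat q₀ := by
  have h1 := L.metric.contMDiff q₀
  rw [contMDiffAt_hom_bundle] at h1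
  refine h1.2.congr_of_eventuallyEq ?_
  filter_upwards [chart_source_mem_nhds (EuclideanSpace ℝ (Fin n)) q₀] with q hq
  symm
  unfold ContinuousLinearMap.inCoordinates
  refine ContinuousLinearMap.ext fun v => ?_
  rw [TangentBundle.symmL_trivializationAt_eq_core hq, ContinuousLinearMap.comp_apply,
    Trivialization.continuousLinearMapAt_apply_of_mem]
  · exact inCoordinates_covector hq _
  · rw [hom_trivializationAt_baseSet]
    exact ⟨hq, mem_univ q⟩

theorem smooth_covectorAt (hη : IsRegularRealization η) (a : Fin m) (q₀ : Q) :
    SmoothCovAt (𝓡 n) (𝓡 n) id (covectorAt (η a)) q₀ :=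
  (contMDiffAt_cotangent_iff.1 (hη.smooth a q₀)).2

variable {E' H' : Type*} [NormedAddCommGroup E'] [NormedSpace ℝ E'] [TopologicalSpace H']
  {J : ModelWithCorners ℝ E' H'} {N : Type*} [TopologicalSpace N] [ChartedSpace H' N]

theorem SmoothCovAt.raise {b : N → Q} {p : N → Covector n} {x₀ : N}
    (hb : ContMDiffAt J (𝓡 n) ∞ b x₀) (hp : SmoothCovAt (𝓡 n) J b p x₀) :
    SmoothVecAt (𝓡 n) J b (fun x => L.raise (b x) (p x)) x₀ := by
  refine SmoothBilinAt.solve hb.continuousAt ((L.smooth_flat (b x₀)).comp hb)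
    (fun x => (L.constraintData (b x)).injective) ?_
  refine ContMDiffAt.congr_of_eventuallyEq hp (Eventually.of_forall fun x => ?_)
  exact congrArg (fun p' : Covector n => p' ∘L _) ((L.constraintData (b x)).flat_sharp _)

theorem SmoothVecAt.flat {b : N → Q} {v : N → EuclideanSpace ℝ (Fin n)} {x₀ : N}
    (hb : ContMDiffAt J (𝓡 n) ∞ b x₀) (hv : SmoothVecAt (𝓡 n) J b v x₀) :
    SmoothCovAt (𝓡 n) J b (fun x => L.flat (b x) (v x)) x₀ :=
  SmoothBilinAt.apply hb.continuousAt ((L.smooth_flat (b x₀)).comp hb) hv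

theorem smooth_proj : ContMDiff (cotangentModel n) (𝓡 n) ∞ (TotalSpace.proj : Cotangent n Q → Q) :=
  contMDiff_proj (n := ∞) (IB := 𝓡 n) (F := Covector n) _

theorem smooth_fiberPart (x₀ : Cotangent n Q) :
    SmoothCovAt (𝓡 n) (cotangentModel n) (fun x : Cotangent n Q => x.proj) fiberPart x₀ :=
  (contMDiffAt_cotangent_iff.1 contMDiffAt_id).2

theorem smooth_covectorAt_proj (hη : IsRegularRealization η) (a : Fin m) (x₀ : Cotangent n Q) :
    SmoothCovAt (𝓡 n) (cotangentModel n) (fun x : Cotangent n Q => x.proj)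
      (fun x => covectorAt (η a) x.proj) x₀ :=
  (smooth_covectorAt hη a x₀.proj).comp (smooth_proj x₀)

variable (η) in
/-- The constraint mass matrix. -/
def constraintGram (q : Q) : Matrix (Fin m) (Fin m) ℝ :=
  gramMatrix (L.raise q) fun a => covectorAt (η a) q

theorem smooth_constraintGram_inv (hη : IsRegularRealization η) (a b : Fin m) :
    ContMDiff (𝓡 n) 𝓘(ℝ, ℝ) ∞ (fun q => (constraintGram L η q)⁻¹ a b) := fun q₀ => by
  refine contMDiffAt_inv_apply (A := constraintGram L η) (fun c d => ?_)
    (hη.constraintData L q₀).isUnit_det_gramMatrix.ne_zero a b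
  exact SmoothCovAt.apply continuousAt_id (smooth_covectorAt hη c q₀)
    ((smooth_covectorAt hη d q₀).raise L contMDiffAt_id)

variable (η) in
/-- The momentum functions of the constraints, as one map. -/
def constraintMomentum (x : Cotangent n Q) (a : Fin m) : ℝ :=
  fiberPart x (L.raise x.proj (covectorAt (η a) x.proj))

theorem smooth_constraintMomentum_apply (hη : IsRegularRealization η) (a : Fin m) :
    ContMDiff (cotangentModel n) 𝓘(ℝ, ℝ) ∞ fun x => constraintMomentum L η x a := fun x₀ =>
  SmoothCovAt.apply (smooth_proj x₀).continuousAt (smooth_fiberPart x₀)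
    ((smooth_covectorAt_proj hη a x₀).raise L (smooth_proj x₀))

theorem smooth_constraintMomentum (hη : IsRegularRealization η) :
    ContMDiff (cotangentModel n) 𝓘(ℝ, Fin m → ℝ) ∞ (constraintMomentum L η) :=
  contMDiff_pi_space.2 fun a => smooth_constraintMomentum_apply L hη a

theorem vectorDeriv_constraintMomentum (hη : IsRegularRealization η) (x : Cotangent n Q)
    (v : EuclideanSpace ℝ (Fin n) × Covector n) (a : Fin m) :
    vectorDeriv (cotangentModel n) (constraintMomentum L η) x v a =
      scalarDeriv (cotangentModel n) (fun y => constraintMomentum L η y a) x v := by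
  have h1 := ((smooth_constraintMomentum L hη).mdifferentiableAt (by simp) (x := x)).hasMFDerivAt
  have h2 := ((ContinuousLinearMap.proj (R := ℝ) (φ := fun _ : Fin m => ℝ) a).hasMFDerivAt
    (x := constraintMomentum L η x)).comp x h1
  exact (DFunLike.congr_fun h2.mfderiv v).symm

/-- By symmetry of the metric, `P(W^α)(q, p) = η^α(FL⁻¹ p)`. -/
theorem mem_phaseSpace_iff (hη : IsRegularRealization η) {x : Cotangent n Q} :
    x ∈ phaseSpace L η ↔ constraintMomentum L η x = 0 := by
  have h := hη.constraintData L x.proj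
  constructor
  · rintro ⟨(v : EuclideanSpace ℝ (Fin n)), hv, hvx⟩
    funext a
    have h1 : L.flat x.proj v = fiberPart x := hvx
    have h2 : covectorAt (η a) x.proj v = 0 := (Submodule.mem_iInf _).1 hv a
    rw [constraintMomentum, ← h1, h.symm, h.flat_sharp]
    exact h2
  · intro hx
    refine ⟨L.raise x.proj (fiberPart x), (Submodule.mem_iInf _).2 fun a => ?_, h.flat_sharp _⟩
    exact (h.apply_sharp _ _).trans (congrFun hx a)

theorem phaseTangent_iff (hη : IsRegularRealization η) {x : Cotangent n Q}
    {v : TangentSpace (cotangentModel n) x} : v ∈ phaseTangent L η x ↔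
      vectorDeriv (cotangentModel n) (constraintMomentum L η) x v = 0 := by
  rw [funext_iff]
  refine (Submodule.mem_iInf _).trans (forall_congr' fun a => ?_)
  exact (vectorDeriv_constraintMomentum L hη x v a).symm ▸ Iff.rfl

theorem scalarDeriv_fiber {f : Cotangent n Q → ℝ} {q : Q} {p β : Covector n} {d : ℝ}
    (hf : MDifferentiableAt (cotangentModel n) 𝓘(ℝ, ℝ) f (cotangentMk q p))
    (hd : HasDerivAt (fun s : ℝ => f (cotangentMk q (p + s • β))) d 0) :
    scalarDeriv (cotangentModel n) f (cotangentMk q p) (0, β) = d := by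
  have h0 : p + (0 : ℝ) • β = p := by rw [zero_smul, add_zero]
  have h2 : MDifferentiableAt (cotangentModel n) 𝓘(ℝ, ℝ) f (cotangentMk q (p + (0 : ℝ) • β)) := by
    rwa [h0]
  have h1 : HasFDerivAt (fun s : ℝ => f (cotangentMk q (p + s • β)))
      (scalarDeriv (cotangentModel n) f (cotangentMk q (p + (0 : ℝ) • β)) ∘L
        (1 : ℝ →L[ℝ] ℝ).smulRight ((0, β) : EuclideanSpace ℝ (Fin n) × Covector n)) (0 : ℝ) :=
    (h2.hasMFDerivAt.comp (0 : ℝ) (hasMFDerivAt_fiberCurve q p β 0)).hasFDerivAt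
  have h3 := DFunLike.congr_fun (h1.unique hd.hasFDerivAt) (1 : ℝ)
  have h4 : scalarDeriv (cotangentModel n) f (cotangentMk q (p + (0 : ℝ) • β))
      ((1 : ℝ) • ((0, β) : EuclideanSpace ℝ (Fin n) × Covector n)) = (1 : ℝ) • d := h3
  rwa [one_smul, one_smul, h0] at h4

theorem scalarDeriv_constraintMomentum_fiber (hη : IsRegularRealization η) (x : Cotangent n Q)
    (β : Covector n) (a : Fin m) :
    scalarDeriv (cotangentModel n) (fun y => constraintMomentum L η y a) x (0, β) =
      β (L.raise x.proj (covectorAt (η a) x.proj)) := by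
  refine scalarDeriv_fiber (q := x.proj) (p := fiberPart x)
    ((smooth_constraintMomentum_apply L hη a).mdifferentiableAt (by simp)) ?_
  have h1 := ((hasDerivAt_id (0 : ℝ)).mul_const
    (β (L.raise x.proj (covectorAt (η a) x.proj)))).const_add (constraintMomentum L η x a)
  rw [one_mul] at h1
  exact h1

end Mechanics

/-! ### The nonholonomic field and translations along the constraint forces -/

section Dynamics

open Set Filter Topology

variable {n m : ℕ} {Q : Type*} [TopologicalSpace Q] [ChartedSpace (EuclideanSpace ℝ (Fin n)) Q]
  [IsManifold (𝓡 n) ∞ Q] (L : NaturalLagrangian n Q)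
  {η : Fin m → (q : Q) → TangentSpace (𝓡 n) q →L[ℝ] ℝ}

/-- A covector that factors through the base has a vertical dual: constraint forces act on momenta
only. -/
theorem symplecticDual_add_sum (α : (EuclideanSpace ℝ (Fin n) × Covector n) →L[ℝ] ℝ)
    (c : Fin m → ℝ) (p : Fin m → Covector n) :
    symplecticDual (α + ∑ b, c b •
      (p b ∘L ContinuousLinearMap.fst ℝ (EuclideanSpace ℝ (Fin n)) (Covector n))) =
      symplecticDual α + (0, -∑ b, c b • p b) := by
  symm
  refine eq_symplecticDual fun w => ?_
  have h1 := coordinateSymplecticForm_symplecticDual α w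
  rw [coordinateSymplecticForm_apply] at h1 ⊢
  simp only [Matrix.cons_val_zero, Matrix.cons_val_one] at h1 ⊢
  simp only [add_apply, sum_apply, smul_apply, ContinuousLinearMap.comp_apply,
    ContinuousLinearMap.coe_fst', Prod.fst_add, Prod.snd_add, neg_apply, add_zero]
  rw [← h1]
  ring

theorem smooth_hamiltonian : ContMDiff (cotangentModel n) 𝓘(ℝ, ℝ) ∞ L.hamiltonian := fun x₀ => by
  have hp := smooth_proj x₀
  have hu := (smooth_fiberPart x₀).raise L hp
  have h1 := SmoothCovAt.apply hp.continuousAt (smooth_fiberPart x₀) hu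
  have h2 := SmoothCovAt.apply hp.continuousAt (hu.flat L hp) hu
  have h3 : ContMDiffAt (cotangentModel n) 𝓘(ℝ, ℝ) ∞ (fun _ : Cotangent n Q => (1 / 2 : ℝ)) x₀ :=
    contMDiffAt_const
  have h4 : ContMDiffAt (cotangentModel n) 𝓘(ℝ, ℝ) ∞
    (fun x : Cotangent n Q => L.potential x.proj) x₀ := (L.smooth_potential x₀.proj).comp x₀ hp
  exact h1.sub ((h3.smul h2).sub h4)

theorem scalarDeriv_hamiltonian_fiber (x : Cotangent n Q) (β : Covector n) :
    scalarDeriv (cotangentModel n) L.hamiltonian x (0, β) = β (L.raise x.proj (fiberPart x)) := by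
  refine scalarDeriv_fiber (q := x.proj) (p := fiberPart x)
    ((smooth_hamiltonian L).mdifferentiableAt (by simp)) ?_
  have hG := L.constraintData x.proj
  have h1 : ∀ p : Covector n, L.hamiltonian (cotangentMk x.proj p) =
      1 / 2 * p (L.raise x.proj p) + L.potential x.proj := fun p => by
    have h2 : L.hamiltonian (cotangentMk x.proj p) = p (L.raise x.proj p) -
      (1 / 2 * L.flat x.proj (L.raise x.proj p) (L.raise x.proj p) - L.potential x.proj) := rfl
    rw [h2, hG.flat_sharp]
    ring
  have h3 : (fun s : ℝ => L.hamiltonian (cotangentMk x.proj (fiberPart x + s • β))) = fun s =>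
      L.hamiltonian (cotangentMk x.proj (fiberPart x)) + s * β (L.raise x.proj (fiberPart x)) +
        s ^ 2 * (1 / 2 * β (L.raise x.proj β)) := by
    funext s
    rw [h1, h1]
    simp only [map_add, map_smul, add_apply, smul_apply, smul_eq_mul,
      hG.apply_sharp (fiberPart x) β]
    ring
  rw [h3]
  have h4 := ((hasDerivAt_id (0 : ℝ)).mul_const
    (β (L.raise x.proj (fiberPart x)))).const_add (L.hamiltonian (cotangentMk x.proj (fiberPart x)))
  have h5 : HasDerivAt (fun t : ℝ => t ^ 2 * (1 / 2 * β (L.raise x.proj β))) 0 0 := by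
    simpa using (hasDerivAt_pow 2 (0 : ℝ)).mul_const (1 / 2 * β (L.raise x.proj β))
  have h6 := h4.add h5
  rw [one_mul, add_zero] at h6
  exact h6

variable (η) in
/-- The multipliers of the constraint forces. -/
def constraintMultiplier (x : Cotangent n Q) (b : Fin m) : ℝ :=
  ∑ c, (constraintGram L η x.proj)⁻¹ b c *
    scalarDeriv (cotangentModel n) (fun y => constraintMomentum L η y c) x
      (symplecticDual (scalarDeriv (cotangentModel n) L.hamiltonian x))

variable (η) in
/-- The sum of `dH` and the constraint forces. -/
def constrainedDifferential (x : Cotangent n Q) :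
    (EuclideanSpace ℝ (Fin n) × Covector n) →L[ℝ] ℝ :=
  scalarDeriv (cotangentModel n) L.hamiltonian x + ∑ b, constraintMultiplier L η x b •
    (covectorAt (η b) x.proj ∘L ContinuousLinearMap.fst ℝ (EuclideanSpace ℝ (Fin n)) (Covector n))

variable (η) in
/-- The nonholonomic vector field, extended to the whole cotangent bundle. -/
def constrainedField (x : Cotangent n Q) : EuclideanSpace ℝ (Fin n) × Covector n :=
  symplecticDual (constrainedDifferential L η x)

theorem smooth_constrainedField (hη : IsRegularRealization η) :
    ContMDiff (cotangentModel n) (cotangentModel n).tangent ∞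
      fun x => (⟨x, constrainedField L η x⟩ : TangentBundle (cotangentModel n) (Cotangent n Q)) :=
    fun x₀ => by
  refine smoothVecAt_id_iff.1 (SmoothCovAt.symplecticDual ?_)
  have hH := smoothCovAt_scalarDeriv (smooth_hamiltonian L x₀)
  refine hH.add (SmoothCovAt.sum fun b _ => SmoothCovAt.smul ?_
    (SmoothCovAt.comp_fst (smooth_covectorAt hη b x₀.proj)))
  refine contMDiffAt_finsetSum fun c _ => ContMDiffAt.smul
    ((smooth_constraintGram_inv L hη b c x₀.proj).comp x₀ (smooth_proj x₀)) ?_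
  exact SmoothCovAt.apply continuousAt_id
    (smoothCovAt_scalarDeriv (smooth_constraintMomentum_apply L hη c x₀)) hH.symplecticDual

/-- The dual of `π_Q^* η^b` is vertical and changes `P(W^a)` at the rate `-m^{ab}`. Tangency is thus
a linear system for the multipliers, with the mass matrix as coefficients. -/
theorem scalarDeriv_constraintMomentum_symplecticDual (hη : IsRegularRealization η)
    (x : Cotangent n Q) (α : (EuclideanSpace ℝ (Fin n) × Covector n) →L[ℝ] ℝ) (c : Fin m → ℝ)
    (a : Fin m) :
    scalarDeriv (cotangentModel n) (fun y => constraintMomentum L η y a) x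
      (symplecticDual (α + ∑ b, c b • (covectorAt (η b) x.proj ∘L
        ContinuousLinearMap.fst ℝ (EuclideanSpace ℝ (Fin n)) (Covector n)))) =
      scalarDeriv (cotangentModel n) (fun y => constraintMomentum L η y a) x (symplecticDual α) -
        ∑ b, constraintGram L η x.proj a b * c b := by
  rw [symplecticDual_add_sum, map_add, scalarDeriv_constraintMomentum_fiber L hη, neg_apply,
    sum_apply, sub_eq_add_neg]
  refine congrArg (fun r => _ + -r) (Finset.sum_congr rfl fun b _ => ?_)
  rw [smul_apply, smul_eq_mul, mul_comm, (hη.constraintData L x.proj).apply_sharp]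
  rfl

theorem scalarDeriv_constraintMomentum_constrainedField (hη : IsRegularRealization η)
    (x : Cotangent n Q) (a : Fin m) :
    scalarDeriv (cotangentModel n) (fun y => constraintMomentum L η y a) x
      (constrainedField L η x) = 0 := by
  rw [constrainedField, constrainedDifferential, scalarDeriv_constraintMomentum_symplecticDual L hη,
    sub_eq_zero]
  exact ((hη.constraintData L x.proj).sum_inv_solve (fun c => scalarDeriv (cotangentModel n)
    (fun y => constraintMomentum L η y c) x
      (symplecticDual (scalarDeriv (cotangentModel n) L.hamiltonian x))) a).symm

/-- The multipliers do not affect the base component, so it is `∂H/∂p = FL⁻¹ p`. -/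
theorem constrainedField_fst (x : Cotangent n Q) :
    (constrainedField L η x).1 = L.raise x.proj (fiberPart x) := by
  have h1 : ∀ β : Covector n, β (constrainedField L η x).1 = β (L.raise x.proj (fiberPart x)) := by
    intro β
    rw [constrainedField, apply_symplecticDual_fst, constrainedDifferential, add_apply, sum_apply,
      scalarDeriv_hamiltonian_fiber]
    simp
  ext i
  exact h1 (EuclideanSpace.proj i)

theorem pullbackOneForm_apply (θ : (q : Q) → TangentSpace (𝓡 n) q →L[ℝ] ℝ) (x : Cotangent n Q)
    (w : EuclideanSpace ℝ (Fin n) × Covector n) :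
    pullbackOneForm θ x w = covectorAt θ x.proj w.1 :=
  congrArg (covectorAt θ x.proj) (DFunLike.congr_fun (hasMFDerivAt_cotangent_proj x).mfderiv w)

/-- Given the multipliers, nondegeneracy of `ω` determines the vector, and tangency then determines
the multipliers because the mass matrix is invertible. This holds at every point of `T^*Q`, so the
field chosen by `Classical.epsilon` is a globally smooth field that conserves all constraint
momenta. -/
theorem nonholonomicVelocity_iff (hη : IsRegularRealization η) (x : Cotangent n Q)
    (v : EuclideanSpace ℝ (Fin n) × Covector n) :
    IsNonholonomicVelocity L η x v ↔ v = constrainedField L η x := by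
  have hval : ∀ (c : Fin m → ℝ) (w : EuclideanSpace ℝ (Fin n) × Covector n),
      (scalarDeriv (cotangentModel n) L.hamiltonian x + ∑ b, c b • (covectorAt (η b) x.proj ∘L
        ContinuousLinearMap.fst ℝ (EuclideanSpace ℝ (Fin n)) (Covector n))) w =
      differential L.hamiltonian x w + ∑ a, c a * pullbackOneForm (η a) x w := by
    intro c w
    rw [add_apply, sum_apply]
    refine congrArg₂ (· + ·) rfl (Finset.sum_congr rfl fun b _ => ?_)
    exact congrArg (fun r => c b * r) (pullbackOneForm_apply (η b) x w).symm
  constructor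
  · rintro ⟨hv, c, hc⟩
    have h1 : v = symplecticDual (scalarDeriv (cotangentModel n) L.hamiltonian x + ∑ b, c b •
        (covectorAt (η b) x.proj ∘L
          ContinuousLinearMap.fst ℝ (EuclideanSpace ℝ (Fin n)) (Covector n))) :=
      eq_symplecticDual fun w => (hc w).trans (hval c w).symm
    have h2 : c = constraintMultiplier L η x := by
      funext b
      refine (hη.constraintData L x.proj).eq_of_gramMatrix_mulVec (fun a => ?_) b
      have h3 : scalarDeriv (cotangentModel n) (fun y => constraintMomentum L η y a) x v = 0 :=
        (Submodule.mem_iInf _).1 hv a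
      rw [h1, scalarDeriv_constraintMomentum_symplecticDual L hη, sub_eq_zero] at h3
      exact h3.symm
    rw [h1, h2]
    rfl
  · rintro rfl
    refine ⟨(Submodule.mem_iInf _).2 fun a =>
      scalarDeriv_constraintMomentum_constrainedField L hη x a, constraintMultiplier L η x,
      fun w => ?_⟩
    exact (coordinateSymplecticForm_symplecticDual _ w).trans (hval _ w)

theorem nonholonomicField_eq (hη : IsRegularRealization η) (x : Cotangent n Q) :
    nonholonomicField L η x = constrainedField L η x :=
  (nonholonomicVelocity_iff L hη x _).1 (Classical.epsilon_spec
    (p := IsNonholonomicVelocity L η x) ⟨_, (nonholonomicVelocity_iff L hη x _).2 rfl⟩)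

variable (η) in
/-- The vertical vectors which are dual to the differentials of the constraint momenta. -/
def constraintShift (q : Q) (b : Fin m) : Covector n :=
  ∑ c, (constraintGram L η q)⁻¹ b c • covectorAt (η c) q

theorem constraintShift_apply (hη : IsRegularRealization η) (q : Q) (a b : Fin m) :
    constraintShift L η q b (L.raise q (covectorAt (η a) q)) = if b = a then 1 else 0 := by
  rw [← (hη.constraintData L q).sum_inv_mul b a, constraintShift, sum_apply]
  rfl

theorem scalarDeriv_constraintMomentum_constraintShift (hη : IsRegularRealization η)
    (x : Cotangent n Q) (a b : Fin m) :
    scalarDeriv (cotangentModel n) (fun y => constraintMomentum L η y a) x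
      (0, constraintShift L η x.proj b) = if a = b then 1 else 0 := by
  rw [scalarDeriv_constraintMomentum_fiber L hη, constraintShift_apply L hη]
  simp only [eq_comm]

variable (η) in
/-- The translation of the cotangent bundle along the constraint forces. -/
def constraintTranslation (p : Cotangent n Q × (Fin m → ℝ)) : Cotangent n Q :=
  cotangentMk p.1.proj (fiberPart p.1 + ∑ b, p.2 b • constraintShift L η p.1.proj b)

theorem smooth_covector_constraintShift (hη : IsRegularRealization η) (b : Fin m) (q₀ : Q) :
    SmoothCovAt (𝓡 n) (𝓡 n) id (fun q => constraintShift L η q b) q₀ :=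
  SmoothCovAt.sum fun c _ => SmoothCovAt.smul (smooth_constraintGram_inv L hη b c q₀)
    (smooth_covectorAt hη c q₀)

theorem isTranslation_constraintTranslation (hη : IsRegularRealization η) :
    IsTranslation (cotangentModel n) (constraintMomentum L η) (constraintTranslation L η) where
  smooth := fun p₀ => by
    have h1 := contMDiffAt_fst (I := cotangentModel n) (J := 𝓘(ℝ, Fin m → ℝ)) (n := ∞) (p := p₀)
    have h2 := contMDiffAt_snd (I := cotangentModel n) (J := 𝓘(ℝ, Fin m → ℝ)) (n := ∞) (p := p₀)
    have h3 : ContMDiffAt ((cotangentModel n).prod 𝓘(ℝ, Fin m → ℝ)) (𝓡 n) ∞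
        (fun p : Cotangent n Q × (Fin m → ℝ) => p.1.proj) p₀ := (smooth_proj p₀.1).comp p₀ h1
    refine contMDiffAt_cotangent_iff.2 ⟨h3, ?_⟩
    refine SmoothCovAt.add ((smooth_fiberPart p₀.1).comp h1) (SmoothCovAt.sum fun b _ =>
      SmoothCovAt.smul ?_ (SmoothCovAt.comp (g := fun p : Cotangent n Q × (Fin m → ℝ) => p.1.proj)
        (smooth_covector_constraintShift L hη b p₀.1.proj) h3))
    exact contMDiffAt_pi_space.1 h2 b
  apply_zero := fun x => by
    simp only [constraintTranslation, Pi.zero_apply, zero_smul, Finset.sum_const_zero, add_zero]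
    rfl
  shift := fun x c => by
    funext a
    change (fiberPart x + ∑ b, c b • constraintShift L η x.proj b)
      (L.raise x.proj (covectorAt (η a) x.proj)) = _
    rw [add_apply, sum_apply]
    simp only [smul_apply, constraintShift_apply L hη, smul_eq_mul, mul_ite, mul_one, mul_zero,
      Finset.sum_ite_eq', Finset.mem_univ, if_true]
    rfl

end Dynamics

/-! ### The impact as a reflection -/

section ImpactAlgebra

variable {V : Type*} [NormedAddCommGroup V] [NormedSpace ℝ V] {m : ℕ}

/-- The component of the gradient `σ θ` along the joint kernel of the covectors `e`. -/
def tangentialGradient (σ : (V →L[ℝ] ℝ) →L[ℝ] V) (e : Fin m → V →L[ℝ] ℝ) (θ : V →L[ℝ] ℝ) : V :=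
  σ θ + ∑ a, (-∑ b, (gramMatrix σ e)⁻¹ a b * θ (σ (e b))) • σ (e a)

/-- The reflection along the tangential gradient. -/
def reboundMap (σ : (V →L[ℝ] ℝ) →L[ℝ] V) (e : Fin m → V →L[ℝ] ℝ) (θ : V →L[ℝ] ℝ) : V →L[ℝ] V :=
  ContinuousLinearMap.id ℝ V + θ.smulRight
    ((-2 * (θ (tangentialGradient σ e θ))⁻¹) • tangentialGradient σ e θ)

variable {G : V →L[ℝ] V →L[ℝ] ℝ} {σ : (V →L[ℝ] ℝ) →L[ℝ] V} {e : Fin m → V →L[ℝ] ℝ}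
  {θ : V →L[ℝ] ℝ}

theorem reboundMap_apply (u : V) : reboundMap σ e θ u = u + θ u •
    ((-2 * (θ (tangentialGradient σ e θ))⁻¹) • tangentialGradient σ e θ) := rfl

namespace IsConstraintData

variable (hG : IsConstraintData G σ e)
include hG

theorem apply_tangentialGradient (a : Fin m) : e a (tangentialGradient σ e θ) = 0 := by
  have h1 := hG.sum_inv_solve (fun b => θ (σ (e b))) a
  rw [tangentialGradient, map_add, map_sum, hG.apply_sharp (e a) θ, ← h1, ← Finset.sum_add_distrib]
  refine Finset.sum_eq_zero fun b _ => ?_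
  rw [map_smul, smul_eq_mul, gramMatrix, Matrix.of_apply]
  ring

/-- The tangential gradient differs from `σ θ` by a combination of the `σ (e a)`, to which it is
orthogonal. -/
theorem flat_tangentialGradient_self :
    G (tangentialGradient σ e θ) (tangentialGradient σ e θ) = θ (tangentialGradient σ e θ) := by
  conv_lhs => enter [1]; rw [tangentialGradient, map_add, map_sum, hG.flat_sharp]
  rw [add_apply, sum_apply, Finset.sum_eq_zero, add_zero]
  intro a _
  rw [map_smul, smul_apply, hG.flat_sharp, hG.apply_tangentialGradient, smul_zero]

/-- The value is the square of the length of the tangential gradient `ξ`, so it vanishes only for `ξ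
= 0`. But `G ξ` and `θ` agree on the joint kernel of `e`, which contains `v`. This is why the impact
denominator is nonzero. -/
theorem apply_tangentialGradient_ne_zero {v : V} (hv : ∀ a, e a v = 0) (hθ : θ v ≠ 0) :
    θ (tangentialGradient σ e θ) ≠ 0 := by
  intro h
  have h1 : tangentialGradient σ e θ = 0 := hG.eq_zero (hG.flat_tangentialGradient_self.trans h)
  have h2 := DFunLike.congr_fun (congrArg G h1) v
  rw [tangentialGradient, map_add, map_sum, hG.flat_sharp, add_apply, sum_apply,
    Finset.sum_eq_zero, add_zero, map_zero] at h2
  · exact hθ h2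
  · intro a _
    rw [map_smul, smul_apply, hG.flat_sharp, hv, smul_zero]

theorem apply_reboundMap (a : Fin m) (u : V) : e a (reboundMap σ e θ u) = e a u := by
  rw [reboundMap_apply, map_add, map_smul, map_smul, hG.apply_tangentialGradient, smul_zero,
    smul_zero, add_zero]

end IsConstraintData

/-- The coefficient is such that `θ` changes sign, so the second application undoes the first. -/
theorem reboundMap_comp_self (h : θ (tangentialGradient σ e θ) ≠ 0) :
    reboundMap σ e θ ∘L reboundMap σ e θ = ContinuousLinearMap.id ℝ V := by
  refine ContinuousLinearMap.ext fun u => ?_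
  have h1 : θ (reboundMap σ e θ u) = -θ u := by
    rw [reboundMap_apply, map_add, map_smul, map_smul, smul_eq_mul, smul_eq_mul, mul_assoc,
      inv_mul_cancel₀ h]
    ring
  rw [ContinuousLinearMap.comp_apply, reboundMap_apply (reboundMap σ e θ u), h1, reboundMap_apply,
    neg_smul, add_neg_cancel_right]
  rfl

theorem det_reboundMap_sq (h : θ (tangentialGradient σ e θ) ≠ 0) :
    (reboundMap σ e θ).det * (reboundMap σ e θ).det = 1 := by
  rw [← det_comp, reboundMap_comp_self h]
  exact LinearMap.det_id

end ImpactAlgebra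

/-! ### The saltation operator of the nonholonomic impact -/

section Impact

open Set Filter Topology

variable {n m : ℕ} {Q : Type*} [TopologicalSpace Q] [ChartedSpace (EuclideanSpace ℝ (Fin n)) Q]
  [IsManifold (𝓡 n) ∞ Q] (L : NaturalLagrangian n Q)
  {η : Fin m → (q : Q) → TangentSpace (𝓡 n) q →L[ℝ] ℝ} {h : Q → ℝ}

variable (η h) in
/-- The tangential gradient of a function on the configuration manifold. -/
def tangentialGrad (q : Q) : EuclideanSpace ℝ (Fin n) :=
  tangentialGradient (L.raise q) (fun a => covectorAt (η a) q) (scalarDeriv (𝓡 n) h q)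

variable (η h) in
/-- The change of velocity at an impact, as a linear map. -/
def rebound (q : Q) : EuclideanSpace ℝ (Fin n) →L[ℝ] EuclideanSpace ℝ (Fin n) :=
  reboundMap (L.raise q) (fun a => covectorAt (η a) q) (scalarDeriv (𝓡 n) h q)

variable (η h) in
/-- The reset map on the whole cotangent bundle. -/
def resetMap (x : Cotangent n Q) : Cotangent n Q :=
  cotangentMk x.proj (L.flat x.proj (rebound L η h x.proj (L.raise x.proj (fiberPart x))))

theorem impactDenominator_eq (q : Q) :
    impactDenominator L η h q = scalarDeriv (𝓡 n) h q (tangentialGrad L η h q) := by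
  rw [tangentialGrad, tangentialGradient, map_add, map_sum]
  refine Eq.trans (sub_eq_add_neg _ _) (congrArg₂ (· + ·) rfl ?_)
  rw [← Finset.sum_neg_distrib]
  refine Finset.sum_congr rfl fun a _ => ?_
  rw [map_smul, smul_eq_mul, neg_mul, Finset.sum_mul]
  refine congrArg Neg.neg (Finset.sum_congr rfl fun b _ => ?_)
  exact mul_right_comm _ _ _

/-- The terms `λ_k W^k + ε ∇h` combine to a multiple of the tangential gradient, with coefficient
`-2 dh(v)` over the denominator. -/
theorem impactVelocity_eq (q : Q) (v : EuclideanSpace ℝ (Fin n)) :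
    impactVelocity L η h q v = rebound L η h q v := by
  have key : ∀ (θv d : ℝ) (s : Fin m → ℝ) (w : Fin m → EuclideanSpace ℝ (Fin n))
      (g : EuclideanSpace ℝ (Fin n)),
      v + (∑ a, (2 * s a * θv / d) • w a) + (-2 * θv / d) • g =
        v + θv • ((-2 * d⁻¹) • (g + ∑ a, (-s a) • w a)) := by
    intro θv d s w g
    rw [add_assoc, smul_add, smul_add, Finset.smul_sum, Finset.smul_sum, add_comm (∑ a, _)]
    refine congrArg (v + ·) (congrArg₂ (· + ·) ?_ (Finset.sum_congr rfl fun a _ => ?_))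
    · rw [smul_smul]; ring_nf
    · rw [smul_smul, smul_smul]; ring_nf
  refine Eq.trans ?_ ((key (scalarDeriv (𝓡 n) h q v) (scalarDeriv (𝓡 n) h q (tangentialGrad L η h q))
    (fun a => ∑ b, (constraintGram L η q)⁻¹ a b *
      scalarDeriv (𝓡 n) h q (L.raise q (covectorAt (η b) q)))
    (fun a => L.raise q (covectorAt (η a) q)) (L.raise q (scalarDeriv (𝓡 n) h q))))
  rw [← impactDenominator_eq]
  rfl

theorem reset_eq (x : Cotangent n Q) :
    (nonholonomicImpactSystem L η h).reset x = resetMap L η h x :=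
  congrArg (fun v => cotangentMk x.proj (L.flat x.proj v)) (impactVelocity_eq L x.proj _)

theorem smooth_tangentialGrad (hη : IsRegularRealization η) (hh : ContMDiff (𝓡 n) 𝓘(ℝ, ℝ) ∞ h)
    (q₀ : Q) : SmoothVecAt (𝓡 n) (𝓡 n) id (tangentialGrad L η h) q₀ := by
  have hd := smoothCovAt_scalarDeriv (hh q₀)
  have hW : ∀ a, SmoothVecAt (𝓡 n) (𝓡 n) id (fun q => L.raise q (covectorAt (η a) q)) q₀ :=
    fun a => (smooth_covectorAt hη a q₀).raise L contMDiffAt_id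
  refine SmoothVecAt.add (hd.raise L contMDiffAt_id) (SmoothVecAt.sum fun a _ =>
    SmoothVecAt.smul (ContMDiffAt.neg (contMDiffAt_finsetSum fun b _ => ?_)) (hW a))
  exact (smooth_constraintGram_inv L hη a b q₀).smul (SmoothCovAt.apply continuousAt_id hd (hW b))

theorem smooth_denominator (hη : IsRegularRealization η) (hh : ContMDiff (𝓡 n) 𝓘(ℝ, ℝ) ∞ h) :
    ContMDiff (𝓡 n) 𝓘(ℝ, ℝ) ∞ fun q => scalarDeriv (𝓡 n) h q (tangentialGrad L η h q) := fun q₀ =>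
  SmoothCovAt.apply continuousAt_id (smoothCovAt_scalarDeriv (hh q₀)) (smooth_tangentialGrad L hη hh q₀)

theorem smoothAt_resetMap (hη : IsRegularRealization η) (hh : ContMDiff (𝓡 n) 𝓘(ℝ, ℝ) ∞ h)
    {x₀ : Cotangent n Q}
    (hx₀ : scalarDeriv (𝓡 n) h x₀.proj (tangentialGrad L η h x₀.proj) ≠ 0) :
    ContMDiffAt (cotangentModel n) (cotangentModel n) ∞ (resetMap L η h) x₀ := by
  have hp := smooth_proj x₀
  refine contMDiffAt_cotangent_iff.2 ⟨hp, SmoothVecAt.flat L hp ?_⟩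
  have hu := (smooth_fiberPart x₀).raise L hp
  have hξ := (smooth_tangentialGrad L hη hh x₀.proj).comp hp
  have hd := (smoothCovAt_scalarDeriv (hh x₀.proj)).comp hp
  have hc : ContMDiffAt (cotangentModel n) 𝓘(ℝ, ℝ) ∞ (fun _ : Cotangent n Q => (-2 : ℝ)) x₀ :=
    contMDiffAt_const
  exact hu.add (SmoothVecAt.smul (SmoothCovAt.apply hp.continuousAt hd hu)
    (SmoothVecAt.smul (hc.smul (((smooth_denominator L hη hh x₀.proj).comp x₀ hp).inv₀ hx₀)) hξ))

theorem constraintMomentum_resetMap (hη : IsRegularRealization η) (x : Cotangent n Q) :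
    constraintMomentum L η (resetMap L η h x) = constraintMomentum L η x := by
  funext a
  have hG := hη.constraintData L x.proj
  change L.flat x.proj (rebound L η h x.proj (L.raise x.proj (fiberPart x)))
    (L.raise x.proj (covectorAt (η a) x.proj)) = _
  rw [hG.symm, hG.flat_sharp]
  exact (hG.apply_reboundMap a _).trans (hG.apply_sharp _ _)

theorem endDeriv_resetMap_fst {x : Cotangent n Q}
    (hx : MDifferentiableAt (cotangentModel n) (cotangentModel n) (resetMap L η h) x)
    (v : EuclideanSpace ℝ (Fin n) × Covector n) :
    (endDeriv (cotangentModel n) (resetMap L η h) x v).1 = v.1 := by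
  have h1 := (hasMFDerivAt_cotangent_proj (resetMap L η h x)).comp x hx.hasMFDerivAt
  exact DFunLike.congr_fun (hasMFDerivAt_unique h1 (hasMFDerivAt_cotangent_proj x)) v

theorem endDeriv_resetMap_fiber {x : Cotangent n Q}
    (hx : MDifferentiableAt (cotangentModel n) (cotangentModel n) (resetMap L η h) x)
    (β : Covector n) :
    endDeriv (cotangentModel n) (resetMap L η h) x (0, β) =
      (0, L.flat x.proj (rebound L η h x.proj (L.raise x.proj β))) := by
  let A : Covector n →L[ℝ] Covector n := L.flat x.proj ∘L rebound L η h x.proj ∘L L.raise x.proj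
  have h0 : cotangentMk x.proj (fiberPart x + (0 : ℝ) • β) = x := by
    rw [zero_smul, add_zero]; rfl
  have hx' : MDifferentiableAt (cotangentModel n) (cotangentModel n) (resetMap L η h)
      (cotangentMk x.proj (fiberPart x + (0 : ℝ) • β)) := h0.symm ▸ hx
  have h1 := hx'.hasMFDerivAt.comp (0 : ℝ) (hasMFDerivAt_fiberCurve x.proj (fiberPart x) β 0)
  have h2 := hasMFDerivAt_fiberCurve x.proj (A (fiberPart x)) (A β) 0
  have h3 : (resetMap L η h ∘ fun s : ℝ => cotangentMk x.proj (fiberPart x + s • β)) =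
      fun s : ℝ => cotangentMk x.proj (A (fiberPart x) + s • A β) := by
    funext s
    change cotangentMk x.proj (A (fiberPart x + s • β)) = _
    rw [map_add, map_smul]
  rw [h3] at h1
  have h4 : endDeriv (cotangentModel n) (resetMap L η h)
      (cotangentMk x.proj (fiberPart x + (0 : ℝ) • β))
      ((1 : ℝ) • ((0, β) : EuclideanSpace ℝ (Fin n) × Covector n)) =
      (1 : ℝ) • ((0, A β) : EuclideanSpace ℝ (Fin n) × Covector n) :=
    DFunLike.congr_fun (hasMFDerivAt_unique h1 h2) (1 : ℝ)
  rw [one_smul, one_smul, h0] at h4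
  exact h4

theorem scalarDeriv_surface (hh : ContMDiff (𝓡 n) 𝓘(ℝ, ℝ) ∞ h) (x : Cotangent n Q)
    (v : EuclideanSpace ℝ (Fin n) × Covector n) :
    scalarDeriv (cotangentModel n) (fun y : Cotangent n Q => h y.proj) x v =
      scalarDeriv (𝓡 n) h x.proj v.1 :=
  DFunLike.congr_fun (HasMFDerivAt.comp x (hh.mdifferentiableAt (by simp)).hasMFDerivAt
    (hasMFDerivAt_cotangent_proj x)).mfderiv v

/-- Both diagonal blocks with respect to the vertical subspace are conjugate to the reflection,
whose determinant squares to one. -/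
theorem det_saltation_resetMap (hη : IsRegularRealization η) (hh : ContMDiff (𝓡 n) 𝓘(ℝ, ℝ) ∞ h)
    {x : Cotangent n Q}
    (hx : scalarDeriv (𝓡 n) h x.proj (tangentialGrad L η h x.proj) ≠ 0)
    (hspeed : scalarDeriv (𝓡 n) h x.proj (L.raise x.proj (fiberPart x)) ≠ 0) :
    (saltation (cotangentModel n) (constrainedField L η) (fun y : Cotangent n Q => h y.proj)
      (resetMap L η h) x).det = 1 := by
  have hd := (smoothAt_resetMap L hη hh hx).mdifferentiableAt (by simp)
  have hG := hη.constraintData L x.proj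
  set S := saltation (cotangentModel n) (constrainedField L η) (fun y : Cotangent n Q => h y.proj)
      (resetMap L η h) x with hS
  have happ : ∀ v, S v = endDeriv (cotangentModel n) (resetMap L η h) x v +
      scalarDeriv (𝓡 n) h x.proj v.1 •
        ((scalarDeriv (𝓡 n) h x.proj (L.raise x.proj (fiberPart x)))⁻¹ •
          (constrainedField L η (resetMap L η h x) -
            endDeriv (cotangentModel n) (resetMap L η h) x (constrainedField L η x))) := by
    intro v
    rw [← scalarDeriv_surface hh x v, ← constrainedField_fst (η := η),
      ← scalarDeriv_surface hh x (constrainedField L η x)]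
    rfl
  have hraise : (constrainedField L η (resetMap L η h x)).1 =
      rebound L η h x.proj (L.raise x.proj (fiberPart x)) :=
    (constrainedField_fst L _).trans (hG.sharp_flat _)
  -- With `R` the rebound and `q̇ = FL⁻¹ p`, the reset contributes `v.1` and the correction
  -- contributes `(dh(v.1) / dh(q̇)) (R q̇ - q̇)`. This is `R v.1 - v.1`, because `R - id` is `dh`
  -- times a fixed vector.
  have hfst : ∀ v, (S v).1 = rebound L η h x.proj v.1 := by
    intro v
    rw [happ, Prod.fst_add, Prod.smul_fst, Prod.smul_fst, Prod.fst_sub,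
      endDeriv_resetMap_fst L hd, endDeriv_resetMap_fst L hd, hraise, constrainedField_fst, rebound,
      reboundMap_apply, reboundMap_apply, add_sub_cancel_left, smul_smul (_⁻¹), inv_mul_cancel₀ hspeed,
      one_smul]
  let B : Covector n →ₗ[ℝ] Covector n :=
    (L.flat x.proj ∘L rebound L η h x.proj ∘L L.raise x.proj).toLinearMap
  have hfib : ∀ β, S (0, β) = (0, B β) := by
    intro β
    rw [happ, endDeriv_resetMap_fiber L hd, map_zero, zero_smul, add_zero]
    rfl
  let ε : EuclideanSpace ℝ (Fin n) ≃ₗ[ℝ] Covector n :=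
    { (L.flat x.proj).toLinearMap with
      invFun := L.raise x.proj
      left_inv := hG.sharp_flat
      right_inv := hG.flat_sharp }
  have hB : B.det = (rebound L η h x.proj).det :=
    LinearMap.det_conj (rebound L η h x.proj).toLinearMap ε
  refine (det_eq_of_block (K := S.toLinearMap) (R := (rebound L η h x.proj).toLinearMap)
    hfst hfib).trans ?_
  rw [hB]
  exact det_reboundMap_sq hx

/-- The impact surface with the reset map, together with the density `ρ`. -/
def mechanicalImpactData (hη : IsRegularRealization η) (hh : ContMDiff (𝓡 n) 𝓘(ℝ, ℝ) ∞ h)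
    (ρ : Q → ℝ) : ImpactData (cotangentModel n) (constrainedField L η) (constraintMomentum L η)
      (fun x : Cotangent n Q => ρ x.proj) where
  dom := {x | scalarDeriv (𝓡 n) h x.proj (tangentialGrad L η h x.proj) ≠ 0}
  isOpen_dom := isOpen_ne_fun ((smooth_denominator L hη hh).continuous.comp smooth_proj.continuous)
    continuous_const
  surface := fun x => h x.proj
  reset := resetMap L η h
  smooth_surface := hh.comp smooth_proj
  smooth_reset := fun _ hx => (smoothAt_resetMap L hη hh hx).contMDiffWithinAt
  continuous_speed := by
    simp only [scalarDeriv_surface hh, constrainedField_fst]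
    refine ContMDiff.continuous (I := cotangentModel n) (I' := 𝓘(ℝ, ℝ)) (n := ∞) fun x₀ => ?_
    have hp := smooth_proj x₀
    exact SmoothCovAt.apply hp.continuousAt ((smoothCovAt_scalarDeriv (hh x₀.proj)).comp hp)
      ((smooth_fiberPart x₀).raise L hp)
  conserve := fun x _ => constraintMomentum_resetMap L hη x
  weight := fun x hx _ hspeed => by
    rw [scalarDeriv_surface hh, constrainedField_fst] at hspeed
    rw [det_saltation_resetMap L hη hh hx hspeed, mul_one]
    -- The reset keeps the base point, so a density pulled back from `Q` is unchanged.
    rfl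

/-- The number `P(∇h)` is the rate of change of `h` along the motion, so its sign gives
transversality. That `dh` does not annihilate `𝓓` keeps the denominator away from zero. -/
theorem impact_mem_mechanicalImpactData (hη : IsRegularRealization η) (hh : IsImpactFunction η h)
    (ρ : Q → ℝ) {w : Cotangent n Q} (hw : w ∈ (nonholonomicImpactSystem L η h).impact) :
    w ∈ (mechanicalImpactData L hη hh.smooth ρ).dom ∧
      (mechanicalImpactData L hη hh.smooth ρ).surface w = 0 ∧
      scalarDeriv (cotangentModel n) (mechanicalImpactData L hη hh.smooth ρ).surface w
        (constrainedField L η w) ≠ 0 ∧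
      (nonholonomicImpactSystem L η h).reset w =
        (mechanicalImpactData L hη hh.smooth ρ).reset w := by
  obtain ⟨-, h0, hneg⟩ := hw
  refine ⟨?_, h0, ?_, reset_eq L w⟩
  · obtain ⟨v, hv, hv'⟩ := hh.nontrivial w.proj h0
    exact (hη.constraintData L w.proj).apply_tangentialGradient_ne_zero
      (fun a => (Submodule.mem_iInf _).1 hv a) hv'
  · refine ne_of_lt (lt_of_eq_of_lt ?_ hneg)
    refine (scalarDeriv_surface hh.smooth w _).trans ?_
    rw [constrainedField_fst]
    exact (hη.constraintData L w.proj).apply_sharp _ _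

end Impact

/-! ### From forward to two-sided invariance of a density -/

section Shrink

open Set Filter Topology

variable {E H : Type*} [NormedAddCommGroup E] [NormedSpace ℝ E] [TopologicalSpace H]
  {I : ModelWithCorners ℝ E H} {M : Type*} [TopologicalSpace M] [ChartedSpace H M]
  {F : Type*} [Zero F] {X : M → E} {P : M → F} {c : M → ℝ}

/-- A density which is preserved forward in time is preserved by small flow boxes. -/
theorem FlowBox.exists_preserves (B : FlowBox I X) {x₀ : M} (hx₀ : x₀ ∈ B.dom)
    (hP : ∀ s ∈ Ioo (-B.time) B.time, ∀ x ∈ B.dom, P (B.flow (s, x)) = P x)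
    (hc : ∀ s ∈ Ico 0 B.time, ∀ x ∈ B.dom, P x = 0 →
      c (B.flow (s, x)) * (endDeriv I (fun y => B.flow (s, y)) x).det = c x) :
    ∃ B' : FlowBox I X, x₀ ∈ B'.dom ∧ B'.Preserves P c := by
  have hz : (0 : ℝ) ∈ Ioo (-B.time) B.time := ⟨neg_lt_zero.2 B.time_pos, B.time_pos⟩
  have hcont : ContinuousAt B.flow (0, x₀) := (B.contMDiffAt hz hx₀).continuousAt
  have hev : ∀ᶠ p in 𝓝 ((0 : ℝ), x₀), B.flow p ∈ B.dom :=
    hcont.preimage_mem_nhds (B.isOpen_dom.mem_nhds (by rwa [B.flow_zero x₀ hx₀]))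
  rw [nhds_prod_eq] at hev
  obtain ⟨S, hS, U, hU, hSU⟩ := mem_prod_iff.1 hev
  obtain ⟨δ, hδ, hδS⟩ := Metric.mem_nhds_iff.1 hS
  obtain ⟨V, hVU, hVo, hxV⟩ := mem_nhds_iff.1 (inter_mem hU (B.isOpen_dom.mem_nhds hx₀))
  have hstay : ∀ s ∈ Ioo (-min δ B.time) (min δ B.time), s ∈ Ioo (-B.time) B.time ∧
      ∀ x ∈ V, B.flow (s, x) ∈ B.dom := by
    intro s hs
    have h1 := min_le_left δ B.time
    have h2 := min_le_right δ B.time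
    refine ⟨⟨by linarith [hs.1], by linarith [hs.2]⟩, fun x hx => hSU ⟨hδS ?_, (hVU hx).1⟩⟩
    rw [Metric.mem_ball, Real.dist_eq, sub_zero, abs_lt]
    exact ⟨by linarith [hs.1], by linarith [hs.2]⟩
  have hVd : ∀ x ∈ V, x ∈ B.dom := fun x hx => (hVU hx).2
  -- For negative `s`, the flow for the time `-s` undoes the flow for the time `s`. The forward
  -- identity at the point `flow (s, x)` is then the backward identity at `x`.
  have hback : ∀ s ∈ Ioo (-min δ B.time) (min δ B.time), s < 0 → ∀ x ∈ V,
      B.flow (-s, B.flow (s, x)) = x := by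
    intro s hs hs0 x hx
    have hr : ∀ r ∈ Icc s 0, r ∈ Ioo (-min δ B.time) (min δ B.time) := fun r hr =>
      ⟨lt_of_lt_of_le hs.1 hr.1, lt_of_le_of_lt hr.2 (lt_min hδ B.time_pos)⟩
    have h1 := B.unique (fun r => B.flow (r, x)) s 0 hs0.le (by linarith [(hstay s hs).1.1])
      (fun r h => (hstay r (hr r h)).2 x hx) fun r h =>
        (B.hasMFDerivAt_time r (hstay r (hr r h)).1 x (hVd x hx)).hasMFDerivWithinAt
    rw [zero_sub] at h1
    exact h1.symm.trans (B.flow_zero x (hVd x hx))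
  refine ⟨⟨min δ B.time, lt_min hδ B.time_pos, V, hVo, B.flow,
    B.smooth.mono fun p hp => ⟨(hstay p.1 hp.1).1, hVd p.2 hp.2⟩,
    fun x hx => B.flow_zero x (hVd x hx),
    fun s hs x hx => B.hasMFDerivAt_time s (hstay s hs).1 x (hVd x hx),
    fun s hs x hx => B.mfderiv_apply s (hstay s hs).1 x (hVd x hx),
    fun γ a b hab hlt hγ hi => B.unique γ a b hab (lt_of_lt_of_le hlt (min_le_right _ _))
      (fun s hs => hVd _ (hγ s hs)) hi⟩, hxV,
    ⟨fun s hs x hx => hP s (hstay s hs).1 x (hVd x hx), fun s hs x hx hPx => ?_⟩⟩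
  change c (B.flow (s, x)) * (endDeriv I (fun y => B.flow (s, y)) x).det = c x
  obtain ⟨hsB, hsV⟩ := hstay s hs
  rcases le_or_gt 0 s with h0 | h0
  · exact hc s ⟨h0, hsB.2⟩ x (hVd x hx) hPx
  have hneg : -s ∈ Ioo (-B.time) B.time := ⟨by linarith [hsB.2], by linarith [hsB.1]⟩
  have hy := hsV x hx
  have h1 := hc (-s) ⟨by linarith, hneg.2⟩ (B.flow (s, x)) hy ((hP s hsB x (hVd x hx)).trans hPx)
  rw [hback s hs h0 x hx] at h1
  have hd : ∀ r ∈ Ioo (-B.time) B.time, ∀ y ∈ B.dom,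
      MDifferentiableAt I I (fun z => B.flow (r, z)) y := fun r hr y hy =>
    ((B.contMDiffAt hr hy).comp y (f := fun z => (r, z))
      (contMDiffAt_const.prodMk contMDiffAt_id)).mdifferentiableAt (by simp)
  have h2 : HasMFDerivAt I I (fun z => B.flow (-s, B.flow (s, z))) x
      (endDeriv I (fun z => B.flow (-s, z)) (B.flow (s, x)) ∘L
        endDeriv I (fun z => B.flow (s, z)) x : E →L[ℝ] E) :=
    HasMFDerivAt.comp (g := fun z => B.flow (-s, z)) (f := fun z => B.flow (s, z)) x (hd (-s) hneg _ hy).hasMFDerivAt (hd s hsB x (hVd x hx)).hasMFDerivAt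
  have h3 : HasMFDerivAt I I (fun z : M => z) x (ContinuousLinearMap.id ℝ E) := hasMFDerivAt_id x
  have h4 : endDeriv I (fun z => B.flow (-s, z)) (B.flow (s, x)) ∘L
        endDeriv I (fun z => B.flow (s, z)) x = ContinuousLinearMap.id ℝ E :=
    hasMFDerivAt_unique (h2.congr_of_eventuallyEq (Filter.eventuallyEq_of_mem (hVo.mem_nhds hx)
      fun z hz => (hback s hs h0 z hz).symm)) h3
  have h5 := congrArg ContinuousLinearMap.det h4
  rw [det_comp] at h5
  have h6 : (ContinuousLinearMap.id ℝ E).det = 1 := LinearMap.det_id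
  rw [← h1, mul_assoc, h5, h6, mul_one]

end Shrink

/-! ### Invariance of the nonholonomic volume as a determinant identity -/

section Volume

open Set Filter Topology

variable {n m k : ℕ} (hk : m + k = 2 * n) {Q : Type*} [TopologicalSpace Q]
  [ChartedSpace (EuclideanSpace ℝ (Fin n)) Q] [IsManifold (𝓡 n) ∞ Q] (L : NaturalLagrangian n Q)
  {η : Fin m → (q : Q) → TangentSpace (𝓡 n) q →L[ℝ] ℝ}

theorem finrank_cotangentModel :
    Module.finrank ℝ (EuclideanSpace ℝ (Fin n) × Covector n) = 2 * n := by
  have h1 : Module.finrank ℝ (Covector n) = n := by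
    rw [← (LinearMap.toContinuousLinearMap :
      (EuclideanSpace ℝ (Fin n) →ₗ[ℝ] ℝ) ≃ₗ[ℝ] Covector n).finrank_eq]
    exact (Subspace.dual_finrank_eq (K := ℝ) (V := EuclideanSpace ℝ (Fin n))).trans
      finrank_euclideanSpace_fin
  rw [Module.finrank_prod, h1, finrank_euclideanSpace_fin]
  ring

variable (n) in
/-- The power `ωⁿ` of the symplectic form on the model space. -/
def liouvilleForm : (EuclideanSpace ℝ (Fin n) × Covector n) [⋀^Fin (2 * n)]→ₗ[ℝ] ℝ :=
  wedgePow (coordinateSymplecticForm n) n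

variable (η) in
/-- The differential of a constraint momentum, on the model space. -/
def constraintCovector (x : Cotangent n Q) (a : Fin m) :
    (EuclideanSpace ℝ (Fin n) × Covector n) →ₗ[ℝ] ℝ :=
  (scalarDeriv (cotangentModel n) (fun y => constraintMomentum L η y a) x).toLinearMap

theorem constraintCovector_eq_zero {x : Cotangent n Q} (u : phaseTangent L η x) (a : Fin m) :
    constraintCovector L η x a u.1 = 0 :=
  (Submodule.mem_iInf _).1 u.2 a

theorem mem_phaseTangent_of_constraintCovector {x : Cotangent n Q}
    {v : TangentSpace (cotangentModel n) x} (hv : ∀ a, constraintCovector L η x a v = 0) :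
    v ∈ phaseTangent L η x :=
  (Submodule.mem_iInf _).2 hv

theorem constraintCovector_constraintShift (hη : IsRegularRealization η) (x : Cotangent n Q)
    (a b : Fin m) : constraintCovector L η x a (0, constraintShift L η x.proj b) =
      if a = b then 1 else 0 :=
  scalarDeriv_constraintMomentum_constraintShift L hη x a b

/-- The flow of a box at a fixed time is an admissible test map for invariance. Evaluated on vectors
where the quotient form does not vanish, the equality of forms reduces to the scalar identity. -/
theorem preserves_of_isInvariant (hη : IsRegularRealization η) {ρ : Q → ℝ}
    (hΩ : liouvilleForm n ≠ 0)
    (hinv : (nonholonomicSystem L η).IsInvariant (basicVolume L η hk ρ))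
    (B : FlowBox (cotangentModel n) (constrainedField L η))
    (hP : ∀ s ∈ Ioo (-B.time) B.time, ∀ x ∈ B.dom,
      constraintMomentum L η (B.flow (s, x)) = constraintMomentum L η x)
    {s : ℝ} (hs : s ∈ Ico 0 B.time) {x : Cotangent n Q} (hx : x ∈ B.dom)
    (hPx : constraintMomentum L η x = 0) :
    ρ (B.flow (s, x)).proj * (endDeriv (cotangentModel n) (fun y => B.flow (s, y)) x).det =
      ρ x.proj := by
  have hsB : s ∈ Ioo (-B.time) B.time := ⟨by linarith [hs.1, B.time_pos], hs.2⟩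
  have hr : ∀ r ∈ Icc 0 s, r ∈ Ioo (-B.time) B.time := fun r h =>
    ⟨by linarith [h.1, B.time_pos], lt_of_le_of_lt h.2 hs.2⟩
  have hd : ∀ y ∈ B.dom, ContMDiffAt (cotangentModel n) (cotangentModel n) ∞
      (fun y => B.flow (s, y)) y := fun y hy =>
    (B.contMDiffAt hsB hy).comp y (contMDiffAt_const.prodMk contMDiffAt_id)
  have hsol : ∀ y ∈ B.dom ∩ phaseSpace L η, (nonholonomicSystem L η).Flow s y (B.flow (s, y)) := by
    intro y hy
    have hflow := HybridSystem.Flow.smooth (𝓗 := nonholonomicSystem L η) (t := s)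
      (γ := fun r => B.flow (r, y)) hs.1 ⟨fun r h => ?_, fun r h => ?_⟩ fun _ _ => id
    · rwa [B.flow_zero y hy.1] at hflow
    · have h1 := (B.hasMFDerivAt_time r (hr r h) y hy.1).hasMFDerivWithinAt (s := Icc 0 s)
      have h2 : (nonholonomicSystem L η).field (B.flow (r, y)) =
        constrainedField L η (B.flow (r, y)) := nonholonomicField_eq L hη _
      exact h2.symm ▸ h1
    · exact (mem_phaseSpace_iff L hη).2 ((hP r (hr r h) y hy.1).trans
        ((mem_phaseSpace_iff L hη).1 hy.2))
  obtain ⟨hF, heq⟩ := hinv s B.dom (fun y => B.flow (s, y)) hs.1 B.isOpen_dom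
    (fun y hy => (hd y hy).contMDiffWithinAt) hsol x ⟨hx, (mem_phaseSpace_iff L hη).2 hPx⟩
  obtain ⟨u, hu, hne⟩ := exists_quotientForm_ne_zero hk finrank_cotangentModel hΩ
    (constraintCovector_constraintShift L hη x)
  set K := endDeriv (cotangentModel n) (fun y => B.flow (s, y)) x with hKdef
  have hK : ∀ a w, constraintCovector L η (B.flow (s, x)) a (K w) = constraintCovector L η x a w := by
    intro a w
    have h1 := HasMFDerivAt.comp x ((smooth_constraintMomentum_apply L hη a).mdifferentiableAt
      (by simp) (x := B.flow (s, x))).hasMFDerivAt ((hd x hx).mdifferentiableAt (by simp)).hasMFDerivAt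
    have h2 := h1.congr_of_eventuallyEq (f₁ := fun y => constraintMomentum L η y a)
      (Filter.eventuallyEq_of_mem (B.isOpen_dom.mem_nhds hx) fun y hy =>
        (congrFun (hP s hsB y hy) a).symm)
    exact (DFunLike.congr_fun h2.mfderiv w).symm
  have h1 := DFunLike.congr_fun heq fun j =>
    (⟨u j, mem_phaseTangent_of_constraintCovector L fun a => hu a j⟩ : phaseTangent L η x)
  have h2 : ρ (B.flow (s, x)).proj * quotientForm hk (constraintCovector L η (B.flow (s, x)))
      (liouvilleForm n) (fun j => K.toLinearMap (u j)) =
      ρ x.proj * quotientForm hk (constraintCovector L η x) (liouvilleForm n) u := h1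
  rw [quotientForm_map hk finrank_cotangentModel (liouvilleForm n)
    (constraintCovector_constraintShift L hη x) (K := K.toLinearMap) hK hu, ← mul_assoc] at h2
  exact mul_right_cancel₀ hne h2

theorem constrained_flowBox_conserve (hη : IsRegularRealization η)
    (B : FlowBox (cotangentModel n) (constrainedField L η)) {s : ℝ}
    (hs : s ∈ Ioo (-B.time) B.time) {x : Cotangent n Q} (hx : x ∈ B.dom) :
    constraintMomentum L η (B.flow (s, x)) = constraintMomentum L η x :=
  funext fun a => B.conserve_of_scalarDeriv_eq_zero (smooth_constraintMomentum_apply L hη a)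
    (fun y => scalarDeriv_constraintMomentum_constrainedField L hη y a) hs hx

/-- Along an invariant density, the differential of the hybrid flow has a linear extension with the
corresponding determinant. -/
theorem exists_extension_of_flow [T2Space Q] [SecondCountableTopology Q]
    (hη : IsRegularRealization η) {ρ : Q → ℝ} (hρ : Continuous ρ)
    (hforward : ∀ (B : FlowBox (cotangentModel n) (constrainedField L η)), ∀ s ∈ Ico 0 B.time,
      ∀ x ∈ B.dom, constraintMomentum L η x = 0 →
      ρ (B.flow (s, x)).proj * (endDeriv (cotangentModel n) (fun y => B.flow (s, y)) x).det =
        ρ x.proj)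
    {h : Q → ℝ} (hh : IsImpactFunction η h) {t : ℝ} {U : Set (Cotangent n Q)}
    {f : Cotangent n Q → Cotangent n Q} (hU : IsOpen U)
    (hf : ContMDiffOn (cotangentModel n) (cotangentModel n) ∞ f U)
    (hflow : ∀ x ∈ U ∩ phaseSpace L η, (nonholonomicImpactSystem L η h).Flow t x (f x))
    {x : Cotangent n Q} (hx : x ∈ U ∩ phaseSpace L η) :
    ∃ K : (EuclideanSpace ℝ (Fin n) × Covector n) →L[ℝ] (EuclideanSpace ℝ (Fin n) × Covector n),
      (∀ v, vectorDeriv (cotangentModel n) (constraintMomentum L η) x v = 0 →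
        K v = endDeriv (cotangentModel n) f x v) ∧
      (∀ v, vectorDeriv (cotangentModel n) (constraintMomentum L η) (f x) (K v) =
        vectorDeriv (cotangentModel n) (constraintMomentum L η) x v) ∧
      ρ (f x).proj * K.det = ρ x.proj := by
  have hbox : ∀ x, ∃ B : FlowBox (cotangentModel n) (constrainedField L η), x ∈ B.dom ∧
      B.Preserves (constraintMomentum L η) fun x => ρ x.proj := fun x => by
    obtain ⟨B, hB⟩ := exists_flowBox (smooth_constrainedField L hη) x
    exact B.exists_preserves hB (fun s hs y hy => constrained_flowBox_conserve L hη B hs hy)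
      (hforward B)
  obtain ⟨ι, hι, G, hG⟩ := exists_countable_families (nonholonomicImpactSystem L η h)
    (mechanicalImpactData L hη hh.smooth ρ) (fun x _ => nonholonomicField_eq L hη x) hbox
    fun w hw => impact_mem_mechanicalImpactData L hη hh ρ hw
  have : LocallyCompactSpace (Cotangent n Q) :=
    Manifold.locallyCompact_of_finiteDimensional (cotangentModel n)
  refine (isTranslation_constraintTranslation L hη).exists_linear_extension
    (fun x y z hx hy => det_chartChange_cotangent (mem_cotangent_chart_source.1 hx)
      (mem_cotangent_chart_source.1 hy)) (smooth_constraintMomentum L hη)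
    (hρ.comp smooth_proj.continuous) G t hU hf (fun y hy hPy => ?_) hx.1
    ((mem_phaseSpace_iff L hη).1 hx.2)
  exact hG t y (f y) (hflow y ⟨hy, (mem_phaseSpace_iff L hη).2 hPy⟩)

/-- The linear extension `K` agrees with the derivative of the flow on tangent vectors of `𝓓^*` and
intertwines the constraint covectors. Hence the derivative maps into the tangent spaces of `𝓓^*`,
and `quotientForm_map` turns the determinant identity into invariance. -/
theorem isInvariant_nonholonomicImpactSystem [T2Space Q] [SecondCountableTopology Q]
    (hη : IsRegularRealization η) {ρ : Q → ℝ} (hρ : Continuous ρ)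
    (hinv : (nonholonomicSystem L η).IsInvariant (basicVolume L η hk ρ))
    {h : Q → ℝ} (hh : IsImpactFunction η h) :
    (nonholonomicImpactSystem L η h).IsInvariant (basicVolume L η hk ρ) := by
  intro t U f _ hU hf hflow x hx
  obtain ⟨σ, hσc, hσf, hσ⟩ : ∃ σ : Q → ℝ, Continuous σ ∧
      (∀ (B : FlowBox (cotangentModel n) (constrainedField L η)), ∀ s ∈ Ico 0 B.time,
        ∀ x ∈ B.dom, constraintMomentum L η x = 0 →
        σ (B.flow (s, x)).proj * (endDeriv (cotangentModel n) (fun y => B.flow (s, y)) x).det =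
          σ x.proj) ∧ (liouvilleForm n ≠ 0 → σ = ρ) := by
    -- Instead of proving `ωⁿ ≠ 0`, the proof lets the density be zero in the other case. It is
    -- trivially preserved, so `K` still exists for the statement on tangent spaces, while the
    -- volume form itself vanishes.
    by_cases hΩ : liouvilleForm n = 0
    · exact ⟨fun _ => 0, continuous_const, fun _ _ _ _ _ _ => zero_mul _, fun h => absurd hΩ h⟩
    · exact ⟨ρ, hρ, fun B s hs y hy hPy => preserves_of_isInvariant hk L hη hΩ hinv B
        (fun r hr z hz => constrained_flowBox_conserve L hη B hr hz) hs hy hPy, fun _ => rfl⟩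
  obtain ⟨K, hK1, hK2, hK3⟩ := exists_extension_of_flow L hη hσc hσf hh hU hf hflow hx
  have htan : ∀ v ∈ phaseTangent L η x,
      mfderiv (cotangentModel n) (cotangentModel n) f x v ∈ phaseTangent L η (f x) := by
    intro v hv
    have hv' := (phaseTangent_iff L hη).1 hv
    exact (phaseTangent_iff L hη).2 ((congrArg _ (hK1 v hv')).symm.trans ((hK2 v).trans hv'))
  refine ⟨htan, ?_⟩
  refine AlternatingMap.ext fun u => ?_
  have hu : ∀ i j, constraintCovector L η x i (u j).1 = 0 := fun i j =>
    constraintCovector_eq_zero L (u j) i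
  have hKc : ∀ a w, constraintCovector L η (f x) a (K w) = constraintCovector L η x a w := fun a w =>
    (vectorDeriv_constraintMomentum L hη (f x) (K w) a).symm.trans
      ((congrFun (hK2 w) a).trans (vectorDeriv_constraintMomentum L hη x w a))
  have hfu : (fun j => K.toLinearMap (u j).1) = fun j =>
      endDeriv (cotangentModel n) f x (u j).1 :=
    funext fun j => hK1 _ ((phaseTangent_iff L hη).1 (u j).2)
  have h1 := quotientForm_map hk finrank_cotangentModel (liouvilleForm n)
      (constraintCovector_constraintShift L hη x) (K := K.toLinearMap) hKc hu
  have h2 : ρ (f x).proj * quotientForm hk (constraintCovector L η (f x)) (liouvilleForm n)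
      (fun j => K.toLinearMap (u j).1) = ρ x.proj *
      quotientForm hk (constraintCovector L η x) (liouvilleForm n) fun j => (u j).1 := by
    rw [h1]
    by_cases hΩ : liouvilleForm n = 0
    · rw [quotientForm_apply hk finrank_cotangentModel (liouvilleForm n)
        (constraintCovector_constraintShift L hη x) hu, hΩ]
      simp
    · have h3 := hK3
      rw [hσ hΩ] at h3
      rw [← mul_assoc]
      exact congrArg (· * _) h3
  rw [hfu] at h2
  exact h2

end Volume

end ImpactMechanics

end

theorem mainTheorem4 {n m k : ℕ} (hk : m + k = 2 * n) {Q : Type*} [TopologicalSpace Q] [T2Space Q]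
    [SecondCountableTopology Q] [ChartedSpace (EuclideanSpace ℝ (Fin n)) Q]
    [IsManifold (𝓡 n) ∞ Q] (L : ImpactMechanics.NaturalLagrangian n Q)
    (η : Fin m → (q : Q) → TangentSpace (𝓡 n) q →L[ℝ] ℝ)
    (hη : ImpactMechanics.IsRegularRealization η)
    (ρ : Q → ℝ) (hρ : ContMDiff (𝓡 n) 𝓘(ℝ) ∞ ρ)
    (hinv : (ImpactMechanics.nonholonomicSystem L η).IsInvariant
      (ImpactMechanics.basicVolume L η hk ρ)) :
    ∀ h : Q → ℝ, ImpactMechanics.IsImpactFunction η h →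
      (ImpactMechanics.nonholonomicImpactSystem L η h).IsInvariant
        (ImpactMechanics.basicVolume L η hk ρ) := by
  intro h hh
  exact ImpactMechanics.isInvariant_nonholonomicImpactSystem hk L hη hρ.continuous hinv hh
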